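/- **Definitions.** *Necklace splitting.* A necklace is a non-empty path of beads, each having a colour $r\in\{0,1,2,\dots\}$, together with $k\ge 1$ such that the number of beads of each colour $r$ is $k a_r$ with an integer $a_r$; put $n=\sum_r a_r$. A $k$-splitting assigns each bead to one of $k$ parts so that each part gets exactly $a_r$ beads of each colour $r$; its size is the number of cuts, i.e. of pairs of consecutive beads that lie in different parts. The necklace splitting problem asks for a $k$-splitting of minimal size. *Unfairness minimisation on trees.* A plan consists of a finite tree $G$ with a depot $d$ of degree 1, a cyclic order $O(v)$ of the neighbours of each vertex $v$, positive integer edge lengths (written in binary), priority classes $p(e)$, positive limits $t(q,i)$, positive frequency bounds $f(e)$, a maximum length $L$ and a capacity $0<c\le 1$. A vehicle route is a closed walk $e_1,\dots,e_\ell$ from $d$ to $d$ along arcs (edges with a direction) such that each of the two arcs of every edge $e$ is traversed at least once and at most $f(e)$ times, the total length is at most $L$, the length run between the $i$-th and $(i+1)$-st traversal of an arc of $e$ is at most $t(p(e),i)L$, and every sub-route that does not pass through $d$ between its two ends has length at most $cL$. Write $e_i=(s_i,t_i)$. For $i<\ell$, the edge following $e_i$ in $O(t_i)$ has a *forward complaint*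 if it is not used, in either direction, by $e_1,\dots,e_{i+1}$; the edge preceding $e_{i+1}$ in $O(s_{i+1})$ has a *backward complaint* if it is not used by $e_1,\dots,e_{i+1}$. The unfairness index of a route is the number of edges with a forward complaint plus the number of edges with a backward complaint. The problem asks for a route of minimal unfairness index. **Theorem.** There is a polynomial reduction of the necklace splitting problem to the unfairness minimisation problem on trees, even when the plan is a star with weights on the edges. That is, there are maps $f,g$, computable in polynomial time by Turing machines, such that $f$ turns each necklace $N$ into a plan $f(N)$ having a vehicle route, and $g$ turns each vehicle route $w$ of $f(N)$ into a $k$-splitting $g(N,w)$ of $N$, which is of minimal size whenever $w$ has minimal unfairness index. Moreover, for every $N$: 1. $f(N)$ is a star with a centre $x\neq d$ in which the beads of $N$ are distinct leaves $u_1,u_2,\dots$ other than $d$; the length of the edge $xu_i$ is $M_r$, where $r$ is the colour of the $i$-th bead, and the numbers $M_r$ are super-increasing: $M_r>n\sum_{q<r}M_q$. All priority limits $t(q,i)$ are $1$, and the capacity is $c=\frac1{k+1}$. 2. For every vehicle route $w$ of $f(N)$, the size of $g(N,w)$ plus $2$ is at most the unfairness index of $w$; and whenever $g(N,w)$ has a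 cut between beads $i$ and $i+1$, the edge $xu_{i+1}$ has a forward complaint or the edge $xu_i$ has a backward complaint in $w$. 3. For every $k$-splitting of $N$ of size $m$ there is a vehicle route of $f(N)$ with unfairness index $m+2$. 4. If $w$ has minimal unfairness index, then this index is the (minimal) size of $g(N,w)$ plus $2$, and $g(N,w)$ has a cut between beads $i$ and $i+1$ if and only if $xu_{i+1}$ has a forward complaint or $xu_i$ has a backward complaint in $w$. -/

import Mathlib

open Computability

/-! ### Encodings over the finite alphabet `Γ'` (bits, comma, brackets) -/

/-- A number in unary, closed by a comma. -/
def encUnary (n : ℕ) : List Γ' := List.replicate n (Γ'.bit true) ++ [Γ'.comma]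

/-- A number in binary, closed by a comma. -/
def encBinary (n : ℕ) : List Γ' := (encodeNat n).map Γ'.bit ++ [Γ'.comma]

/-- A bracketed list. -/
def encList {α : Type} (enc : α → List Γ') (l : List α) : List Γ' :=
  Γ'.bra :: (l.flatMap enc ++ [Γ'.ket])

/-- A nonnegative rational: numerator and denominator in binary. -/
def encRat (q : ℚ) : List Γ' := encBinary q.num.toNat ++ encBinary q.den

/-! ### Minimisation problems and polynomial reductions -/

/-- A minimisation problem: instances, the solutions of each instance, their cost, and the
representation of instances and solutions by strings. -/
structure MinProblem where
  Inst : Type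
  Sol : Inst → Type
  cost : ∀ x, Sol x → ℕ
  encInst : Inst → List Γ'
  encSol : ∀ x, Sol x → List Γ'

/-- A solution of minimal cost; finding one is what the problem asks for. -/
def MinProblem.IsOptimal (P : MinProblem) {x : P.Inst} (y : P.Sol x) : Prop :=
  ∀ y' : P.Sol x, P.cost x y ≤ P.cost x y'

/-- A polynomial reduction of `P` to `Q`: a polynomial-time map `f` of instances, and a
polynomial-time map `g` that turns solutions of `f x` back into solutions of `x`, optimal ones
into optimal ones. Polynomial time is Turing machine time; the machine for `g` reads `x` and a
solution of `f x`, written in two disjoint copies of the alphabet. -/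
structure PolyReduction (P Q : MinProblem) where
  f : P.Inst → Q.Inst
  g : ∀ x, Q.Sol (f x) → P.Sol x
  f_poly : Nonempty (Turing.TM2ComputableInPolyTime P.encInst Q.encInst f)
  g_poly : Nonempty (Turing.TM2ComputableInPolyTime
    (fun p : (Σ x, Q.Sol (f x)) =>
      (P.encInst p.1).map (Sum.inl : Γ' → Γ' ⊕ Γ') ++ (Q.encSol (f p.1) p.2).map Sum.inr)
    (fun q : (Σ x, P.Sol x) => P.encSol q.1 q.2)
    (fun p => ⟨p.1, g p.1 p.2⟩))
  solvable : ∀ x, Nonempty (P.Sol x) → Nonempty (Q.Sol (f x))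
  optimal : ∀ x (y : Q.Sol (f x)), Q.IsOptimal y → P.IsOptimal (g x y)

/-! ### Necklace splitting -/

/-- An open necklace, given by the colours of its beads in order, together with the number `k` of
parts; the number of beads of each colour is a multiple of `k`. -/
structure Necklace where
  k : ℕ
  beads : List ℕ
  k_pos : 0 < k
  nonempty : beads ≠ []
  dvd_count : ∀ r, k ∣ beads.count r

namespace Necklace

variable (N : Necklace)

/-- The colour of the `i`-th bead. -/
def color (i : Fin N.beads.length) : ℕ := N.beads.get i

/-- The number `n` of beads that each part receives. -/
def n : ℕ := N.beads.length / N.k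

/-- `S`, which assigns to each bead its part, is a `k`-splitting: every part has exactly
`a_r = (number of beads of colour r) / k` beads of each colour `r`. -/
def IsSplitting (S : Fin N.beads.length → Fin N.k) : Prop :=
  ∀ j r, (Finset.univ.filter fun i => S i = j ∧ N.color i = r).card = N.beads.count r / N.k

/-- The `k`-splittings of the necklace. -/
def Splitting : Type := {S : Fin N.beads.length → Fin N.k // N.IsSplitting S}

variable {N}

/-- There is a cut between the consecutive beads `i` and `j = i + 1`: they are in different
parts. -/
def Splitting.IsCut (S : N.Splitting) (i j : Fin N.beads.length) : Prop :=
  (j : ℕ) = i + 1 ∧ S.1 i ≠ S.1 j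

/-- The size of a splitting: its number of cuts. -/
noncomputable def Splitting.size (S : N.Splitting) : ℕ :=
  {p : Fin N.beads.length × Fin N.beads.length | S.IsCut p.1 p.2}.ncard

end Necklace

/-- The necklace splitting problem: find a `k`-splitting of minimal size. The input is the number
`k` of parts and the list of the colours (both numbers are at most the number of beads, if the
colours are numbered consecutively, and are written in unary); a solution is written as the list
of the parts of the beads. -/
noncomputable def necklaceSplitting : MinProblem where
  Inst := Necklace
  Sol N := N.Splitting
  cost _ S := S.size
  encInst N := encUnary N.k ++ encList encUnary N.beads
  encSol _ S := encList (fun j => encUnary j.val) (List.ofFn S.1)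

/-! ### Maintaining plans on trees, vehicle routes, unfairness -/

/-- A maintaining plan whose graph is a tree, all edges being maintained, with a depot of degree
one, a cyclic order of the neighbours of every vertex, and the external parameters. The functions
`len`, `prio`, `freq` matter on edges only. -/
structure TreePlan where
  /-- number of vertices -/
  n : ℕ
  graph : SimpleGraph (Fin n)
  isTree : graph.IsTree
  depot : Fin n
  /-- `order v` lists the neighbours of `v` in their cyclic order. -/
  order : Fin n → List (Fin n)
  order_nodup : ∀ v, (order v).Nodup
  mem_order : ∀ v u, u ∈ order v ↔ graph.Adj v u
  depot_degree : (order depot).length = 1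
  /-- edge lengths -/
  len : Sym2 (Fin n) → ℕ
  len_pos : ∀ e ∈ graph.edgeSet, 0 < len e
  /-- Row `q` lists the values `t(q,1), t(q,2), …` of the priority limits of class `q`; the last
  value of the row stays in force from there on. The number of rows is the number `z` of priority
  classes, numbered from `0`. -/
  limits : List (List ℚ)
  limits_ne : ∀ row ∈ limits, row ≠ []
  limits_pos : ∀ row ∈ limits, ∀ q ∈ row, 0 < q
  /-- priority class of an edge -/
  prio : Sym2 (Fin n) → ℕ
  prio_lt : ∀ e ∈ graph.edgeSet, prio e < limits.length
  /-- upper bound on the number of traversals of each of the two arcs of an edge -/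
  freq : Sym2 (Fin n) → ℕ
  freq_pos : ∀ e ∈ graph.edgeSet, 0 < freq e
  /-- maximum length of a route -/
  L : ℕ
  /-- capacity -/
  c : ℚ
  c_pos : 0 < c
  c_le_one : c ≤ 1

namespace TreePlan

variable (I : TreePlan)

/-- The limit `t(q,i)`, `i ≥ 1`. -/
def limit (q i : ℕ) : ℚ :=
  let row := I.limits.getD q []
  row.getD (i - 1) (row.getLastD 1)

/-- The arcs of the symmetric orientation. -/
abbrev Arc : Type := I.graph.Dart

/-- Closed walks that start and end in the depot. -/
abbrev ClosedWalk : Type := I.graph.Walk I.depot I.depot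

variable {I}

/-- The total length of a sequence of arcs. -/
def arcLen (l : List I.Arc) : ℕ := (l.map fun a => I.len a.edge).sum

/-- The part `e_{i+1}, …, e_j` of the closed walk `e_1, …, e_ℓ`. -/
def segment (w : I.ClosedWalk) (i j : ℕ) : List I.Arc := (w.darts.take j).drop i

/-- Vehicle routes: (a) every arc is traversed at least once and at most as often as allowed;
(b) the total length is at most `L`; (c) whenever positions `a < b` carry the `i`-th and the
`(i+1)`-st traversal of the same arc `e`, the length run from the one to the other is at most
`t(p(e),i) L`; (d) every sub-route which does not pass through the depot between its two ends has
length at most `c L`, that is, the route visits the depot within each longer sub-route. -/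
def IsVehicleRoute (w : I.ClosedWalk) : Prop :=
  (∀ a : I.Arc, 1 ≤ w.darts.count a ∧ w.darts.count a ≤ I.freq a.edge) ∧
  arcLen w.darts ≤ I.L ∧
  (∀ (a b : ℕ) (e : I.Arc), a < b → w.darts[a]? = some e → w.darts[b]? = some e →
    (∀ m, a < m → m < b → w.darts[m]? ≠ some e) →
    (arcLen (segment w a b) : ℚ) ≤
      I.limit (I.prio e.edge) ((w.darts.take (a + 1)).count e) * I.L) ∧
  (∀ a b : ℕ, a < b → b ≤ w.length → (∀ m, a < m → m < b → w.getVert m ≠ I.depot) →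
    (arcLen (segment w a b) : ℚ) ≤ I.c * I.L)

/-- The edge at the head `t` of the arc `(s,t)` which follows the edge `st` in the cyclic order
at `t`. -/
def nextEdge (e : I.Arc) : Sym2 (Fin I.n) :=
  s(e.snd, (I.order e.snd).next e.fst ((I.mem_order _ _).2 e.adj.symm))

/-- The edge at the tail `s` of the arc `(s,t)` which precedes the edge `st` in the cyclic order
at `s`. -/
def prevEdge (e : I.Arc) : Sym2 (Fin I.n) :=
  s(e.fst, (I.order e.fst).prev e.snd ((I.mem_order _ _).2 e.adj))

/-- The edge `x` is traversed, in some direction, by one of the first `m` arcs of `w`. -/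
def UsedWithin (w : I.ClosedWalk) (m : ℕ) (x : Sym2 (Fin I.n)) : Prop :=
  ∃ a ∈ w.darts.take m, a.edge = x

/-- `x` has a forward complaint: for some arc `e_i` of the walk that is not the last one, `x`
follows `e_i` at its head, and is not used by `e_1, …, e_{i+1}`. (Positions are counted from `0`
in lists.) -/
def ForwardComplaint (w : I.ClosedWalk) (x : Sym2 (Fin I.n)) : Prop :=
  ∃ (i : ℕ) (h : i + 1 < w.darts.length),
    nextEdge (w.darts[i]'(Nat.lt_of_succ_lt h)) = x ∧ ¬ UsedWithin w (i + 2) x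

/-- `x` has a backward complaint: for some arc `e_{i+1}` of the walk that is not the first one,
`x` precedes `e_{i+1}` at its tail, and is not used by `e_1, …, e_{i+1}`. -/
def BackwardComplaint (w : I.ClosedWalk) (x : Sym2 (Fin I.n)) : Prop :=
  ∃ (i : ℕ) (h : i + 1 < w.darts.length),
    prevEdge w.darts[i + 1] = x ∧ ¬ UsedWithin w (i + 2) x

/-- The unfairness index: the number of edges with a forward complaint plus the number of edges
with a backward complaint. -/
noncomputable def unfairness (w : I.ClosedWalk) : ℕ :=
  {x | ForwardComplaint w x}.ncard + {x | BackwardComplaint w x}.ncard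

variable (I)

/-- The vehicle routes of the plan. -/
def Route : Type := {w : I.ClosedWalk // IsVehicleRoute w}

/-- The representation of a plan by a string: the depot; for every vertex, its neighbours in
cyclic order, each with the length, the priority class and the frequency bound of the edge; the
priority limits; `L` and `c`. Vertex names and priority classes are written in unary, all the other
numbers in binary. -/
def encode : List Γ' :=
  encUnary I.depot.val ++
  encList (fun v : Fin I.n => encList (fun u : Fin I.n =>
      encUnary u.val ++ encBinary (I.len s(v, u)) ++ encUnary (I.prio s(v, u)) ++
        encBinary (I.freq s(v, u))) (I.order v))
    (List.finRange I.n) ++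
  encList (encList encRat) I.limits ++ encBinary I.L ++ encRat I.c

end TreePlan

/-- The plan `I` is an edge-weighted star with centre `x` in which the beads of the necklace `N`
are distinct leaves `u i` other than the depot; the length of the edge of a bead depends on the
colour of the bead only, and these lengths increase so fast that each exceeds `n` times the sum of
those of all smaller colours; all priority limits are `1`. -/
structure TreePlan.IsNecklaceStar (I : TreePlan) (N : Necklace) (x : Fin I.n)
    (u : Fin N.beads.length → Fin I.n) : Prop where
  star : I.graph = SimpleGraph.starGraph x
  depot_ne : I.depot ≠ x
  u_inj : Function.Injective u
  u_ne : ∀ i, u i ≠ x ∧ u i ≠ I.depot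
  weights : ∃ M : ℕ → ℕ, (∀ i, I.len s(x, u i) = M (N.color i)) ∧
    ∀ r, N.n * ∑ q ∈ Finset.range r, M q < M r
  limit_eq : ∀ q i, q < I.limits.length → 1 ≤ i → I.limit q i = 1

/-- The unfairness minimisation problem on trees: find a vehicle route of minimal unfairness
index. A route is written as the list of the vertices that it visits. -/
noncomputable def unfairnessMinimisation : MinProblem where
  Inst := TreePlan
  Sol I := I.Route
  cost _ w := TreePlan.unfairness w.1
  encInst I := I.encode
  encSol _ w := encList (fun v => encUnary v.val) w.1.support

/-! The plan of a necklace with `m` beads is a star with centre `0` whose leaves are, in cyclic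
order, an extra leaf `1`, the depot `2` and the beads `3, …, m + 2`. Let `ell` be the length of the
code of the necklace and `B = 2 ^ ell`. A bead of colour `r` has length `k * B ^ (r + 1)`, and the
extra leaf has length `load`, the sum over `r` of the number of beads of colour `r` times `B ^ (r +
1)`. So all leaves except the depot together weigh `(k + 1) * load`.

A tour is the part of a route between consecutive visits to the depot. If its leaves have total
weight `t`, its length is `2 * (depotLen + t)`, while the capacity allows `2 * (depotLen + load +
1)`. As all weights are even, this means `t ≤ load`. The frequency bound of the depot edge allows at
most `k + 1` tours, hence there are exactly `k + 1` tours, each of weight exactly `load`. The extra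
leaf fills one of them alone. In every other tour, comparing digits in base `B` shows that `k` times
the number of its beads of colour `r` is the number of all beads of colour `r`. So these tours are
the parts of a splitting (`Visits.exists_tours`); conversely, every such family of tours is a route
(`Tours.exists_route`).

Complaints are counted at the boundaries between cyclically consecutive leaves `p`, `q`. If `q` is
visited before `p`, then `p` has a backward complaint; if `p` is visited first, then `q` has a
forward complaint unless it is visited directly after `p` (`fwd_or_bwd`). Hence each cut costs a
complaint. Two more are unavoidable: one between the last bead and the extra leaf, and one on one of
the two sides of the depot. This gives `size_add_two_le`. Conversely, the route that serves the
extra leaf first and then each part in one tour, its beads in their order on the necklace, has no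
other complaints and at most one at each of these boundaries (`fwd_partTours`, `bwd_partTours`,
`exists_route_of_splitting`). For a route of minimal index the boundaries with complaints are
therefore exactly the unavoidable ones (`isCut_of_complaint`).

Polynomial time is proved with a small loop language whose programs compile to Turing machines with
an explicit polynomial time bound (`LoopProg.polyTime`). The lengths are chosen so that their binary
digits can be written without arithmetic: blocks of `ell` zeros, the digits of the colour counts,
and the complement of the digits of the load. -/

/-! ### Loop programs

A small imperative language: finitely many work stacks, a write-only output stack, loops over the
(read-only) input and passes of a finite transducer over a work stack. Every program runs in
polynomial time on a Turing machine. -/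

namespace LoopProg

open Turing Function

/-- The state of a loop program. -/
structure St (W σ A : Type) where
  v : σ
  wk : W → List A
  out : List A

/-- Loop programs with work stacks `W`, control states `σ`, input alphabet `AI` and work and output
alphabet `A`. -/
inductive Cmd (W σ AI A : Type) : Type
  | push (k : W) (f : σ → A)
  | emit (f : σ → A)
  | pop (k : W) (f : σ → Option A → σ)
  | load (f : σ → σ)
  | seq (a b : Cmd W σ AI A)
  | ite (p : σ → Bool) (a b : Cmd W σ AI A)
  | forIn (i : Bool) (f : σ → AI → σ) (b : Cmd W σ AI A)
  | drain (k k₁ k₂ : W) (f : σ → A → σ) (g : σ → A → Option (Bool × A)) (e : σ → A → Option A)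

variable {W σ AI A : Type}

namespace Cmd

/-- The loop indices in use. -/
def uses : Cmd W σ AI A → Bool → Prop
  | seq a b, j => a.uses j ∨ b.uses j
  | ite _ a b, j => a.uses j ∨ b.uses j
  | forIn i _ b, j => j = i ∨ b.uses j
  | _, _ => False

/-- Nested loops have different indices, and a pass does not write on the stack it reads. -/
def WF : Cmd W σ AI A → Prop
  | seq a b => a.WF ∧ b.WF
  | ite _ a b => a.WF ∧ b.WF
  | forIn i _ b => ¬ b.uses i ∧ b.WF
  | drain k k₁ k₂ _ _ _ => k₁ ≠ k ∧ k₂ ≠ k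
  | _ => True

variable [DecidableEq W]

/-- One step of a pass. -/
def drainStep (k₁ k₂ : W) (f : σ → A → σ) (g : σ → A → Option (Bool × A)) (e : σ → A → Option A)
    (s : St W σ A) (a : A) : St W σ A where
  v := f s.v a
  wk := match g s.v a with
    | none => s.wk
    | some p => update s.wk (bif p.1 then k₁ else k₂) (p.2 :: s.wk (bif p.1 then k₁ else k₂))
  out := match e s.v a with
    | none => s.out
    | some x => x :: s.out

/-- The effect of a program on the state, for the input `w`. -/
def den (w : List AI) : Cmd W σ AI A → St W σ A → St W σ A
  | push k f, s => { s with wk := update s.wk k (f s.v :: s.wk k) }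
  | emit f, s => { s with out := f s.v :: s.out }
  | pop k f, s => { s with v := f s.v (s.wk k).head?, wk := update s.wk k (s.wk k).tail }
  | load f, s => { s with v := f s.v }
  | seq a b, s => b.den w (a.den w s)
  | ite p a b, s => bif p s.v then a.den w s else b.den w s
  | forIn _ f b, s => w.foldl (fun s a => b.den w { s with v := f s.v a }) s
  | drain k k₁ k₂ f g e, s =>
    (s.wk k).foldl (drainStep k₁ k₂ f g e) { s with wk := update s.wk k [] }

open Polynomial

/-- A bound for the growth of the work stacks. -/
noncomputable def grow : Cmd W σ AI A → ℕ[X]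
  | push _ _ => 1
  | seq a b => a.grow + b.grow
  | ite _ a b => a.grow + b.grow
  | forIn _ _ b => X * b.grow
  | _ => 0

/-- The part of the time bound that depends on the size of the work stacks. -/
noncomputable def rate : Cmd W σ AI A → ℕ[X]
  | seq a b => a.rate + b.rate
  | ite _ a b => a.rate + b.rate
  | forIn _ _ b => X * b.rate
  | drain _ _ _ _ _ _ => 1
  | _ => 0

/-- The part of the time bound that does not depend on the size of the work stacks. -/
noncomputable def base : Cmd W σ AI A → ℕ[X]
  | seq a b => a.base + b.base + b.rate * a.grow
  | ite _ a b => 1 + a.base + b.base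
  -- Each symbol is read once and put back once, and both phases end with a failing pop. In each of
  -- the `X` rounds the stacks exceed their initial size by at most `X * b.grow`.
  | forIn _ _ b => 2 * X + 2 + X * (b.base + b.rate * (X * b.grow))
  | _ => 1

end Cmd

/-- The total size of the work stacks. -/
def size [Fintype W] (s : W → List A) : ℕ := ∑ k, (s k).length

/-! ### Bounds for the work stacks and the output -/

section size
variable [Fintype W] [DecidableEq W]

theorem size_update (s : W → List A) (k : W) (l : List A) :
    size (update s k l) + (s k).length = size s + l.length := by
  unfold size
  rw [← Finset.add_sum_erase _ _ (Finset.mem_univ k), ← Finset.add_sum_erase _ _ (Finset.mem_univ k)]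
  have : ∑ x ∈ Finset.univ.erase k, (update s k l x).length =
      ∑ x ∈ Finset.univ.erase k, (s x).length :=
    Finset.sum_congr rfl fun x hx => by rw [update_of_ne (Finset.ne_of_mem_erase hx)]
  rw [this, update_self]; omega

theorem length_le_size (s : W → List A) (k : W) : (s k).length ≤ size s :=
  Finset.single_le_sum (f := fun k => (s k).length) (fun _ _ => Nat.zero_le _) (Finset.mem_univ k)

theorem size_push (s : W → List A) (k : W) (a : A) : size (update s k (a :: s k)) = size s + 1 := by
  have := size_update s k (a :: s k)
  simp only [List.length_cons] at this; omega

theorem size_drainStep (k₁ k₂ : W) (f : σ → A → σ) (g : σ → A → Option (Bool × A)) (e : σ → A → Option A)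
    (s : St W σ A) (a : A) :
    size (Cmd.drainStep k₁ k₂ f g e s a).wk ≤ size s.wk + 1 := by
  unfold Cmd.drainStep
  dsimp only
  split
  · omega
  · rw [size_push]

theorem size_foldl_drainStep (k₁ k₂ : W) (f : σ → A → σ) (g : σ → A → Option (Bool × A))
    (e : σ → A → Option A) (l : List A) (s : St W σ A) :
    size (l.foldl (Cmd.drainStep k₁ k₂ f g e) s).wk ≤ size s.wk + l.length := by
  induction l generalizing s with
  | nil => simp
  | cons a l ih =>
    have := size_drainStep k₁ k₂ f g e s a
    have := ih (Cmd.drainStep k₁ k₂ f g e s a)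
    simp only [List.foldl_cons, List.length_cons]; omega

theorem size_foldl {w : List AI} {F : St W σ A → AI → St W σ A} {c : ℕ}
    (h : ∀ s a, size (F s a).wk ≤ size s.wk + c) (s : St W σ A) :
    size (w.foldl F s).wk ≤ size s.wk + w.length * c := by
  induction w generalizing s with
  | nil => simp
  | cons a w ih =>
    have := ih (F s a)
    have := h s a
    simp only [List.foldl_cons, List.length_cons, Nat.add_mul, one_mul]; omega

/-- Only `push` adds a symbol; a pass moves each symbol to at most one stack, and the number of
rounds of a loop is the length of the fixed input. So the growth is additive, whatever the stacks
contain, and loops cannot double the data. -/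
theorem Cmd.size_den (w : List AI) (c : Cmd W σ AI A) (s : St W σ A) :
    size (c.den w s).wk ≤ size s.wk + c.grow.eval w.length := by
  induction c generalizing s with
  | push k f => simp [den, size_push, grow]
  | emit f => simp [den, grow]
  | load f => simp [den, grow]
  | pop k f =>
    have := size_update s.wk k (s.wk k).tail
    simp only [den, grow, Polynomial.eval_zero, List.length_tail] at *; omega
  | seq a b iha ihb =>
    have h1 := iha s
    have h2 := ihb (a.den w s)
    simp only [den, grow, Polynomial.eval_add]; omega
  | ite p a b iha ihb =>
    have h1 := iha s
    have h2 := ihb s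
    simp only [den, grow, Polynomial.eval_add]
    cases p s.v <;> simp only [cond_true, cond_false] <;> omega
  | forIn i f b ih =>
    simp only [den, grow, Polynomial.eval_mul, Polynomial.eval_X]
    exact size_foldl (fun s a => ih { s with v := f s.v a }) s
  | drain k k₁ k₂ f g e =>
    -- What the pass writes elsewhere is paid for by the stack that it empties.
    have h1 := size_foldl_drainStep k₁ k₂ f g e (s.wk k) { s with wk := update s.wk k [] }
    have h2 := size_update s.wk k []
    simp only [den, grow, Polynomial.eval_zero, List.length_nil] at *; omega

theorem length_out_foldl_drainStep (k₁ k₂ : W) (f : σ → A → σ) (g : σ → A → Option (Bool × A))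
    (e : σ → A → Option A) (l : List A) (s : St W σ A) :
    (l.foldl (Cmd.drainStep k₁ k₂ f g e) s).out.length ≤ s.out.length + l.length := by
  induction l generalizing s with
  | nil => simp
  | cons a l ih =>
    have h : (Cmd.drainStep k₁ k₂ f g e s a).out.length ≤ s.out.length + 1 := by
      unfold Cmd.drainStep
      dsimp only
      split <;> simp
    have := ih (Cmd.drainStep k₁ k₂ f g e s a)
    simp only [List.foldl_cons, List.length_cons]; omega

/-- Needed because the machine finally moves the output to another stack, at the cost of one step
per symbol. -/
theorem Cmd.length_out_den (w : List AI) (c : Cmd W σ AI A) (s : St W σ A) :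
    (c.den w s).out.length ≤
      s.out.length + (c.base.eval w.length + c.rate.eval w.length * size s.wk) := by
  induction c generalizing s with
  | push k f => simp [den]
  | emit f => simp [den, base]
  | load f => simp [den]
  | pop k f => simp [den]
  | seq a b iha ihb =>
    have h1 := iha s
    have h2 := ihb (a.den w s)
    have h3 := Nat.mul_le_mul_left (b.rate.eval w.length) (a.size_den w s)
    simp only [den, base, rate, Polynomial.eval_add, Polynomial.eval_mul]
    linarith
  | ite p a b iha ihb =>
    have h1 := iha s
    have h2 := ihb s
    simp only [den, base, rate, Polynomial.eval_add, Polynomial.eval_one, add_mul]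
    cases p s.v <;> simp only [cond_true, cond_false] <;> omega
  | forIn i f b ih =>
    -- The number `m` bounds the stacks in all rounds that remain, so that every round has the same
    -- cost.
    have key : ∀ (u : List AI) (s : St W σ A) (m : ℕ),
        size s.wk + u.length * b.grow.eval w.length ≤ m →
        (u.foldl (fun s a => b.den w { s with v := f s.v a }) s).out.length ≤ s.out.length +
          u.length * (b.base.eval w.length + b.rate.eval w.length * m) := by
      intro u
      induction u with
      | nil => simp
      | cons a u ihu =>
        intro s m hm
        have h1 := ih { s with v := f s.v a }
        have h2 := b.size_den w { s with v := f s.v a }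
        simp only [List.length_cons, add_mul, one_mul] at hm
        have h3 := ihu (b.den w { s with v := f s.v a }) m (by dsimp only at *; omega)
        have h4 : b.rate.eval w.length * size s.wk ≤ b.rate.eval w.length * m :=
          Nat.mul_le_mul_left _ (by omega)
        simp only [List.foldl_cons, List.length_cons, add_mul, one_mul]
        dsimp only at *
        omega
    have := key w s _ le_rfl
    simp only [den, base, rate, Polynomial.eval_add, Polynomial.eval_mul, Polynomial.eval_X,
      Polynomial.eval_ofNat]
    refine this.trans ?_
    have e : w.length * (b.base.eval w.length + b.rate.eval w.length *
        (size s.wk + w.length * b.grow.eval w.length)) =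
      w.length * (b.base.eval w.length + b.rate.eval w.length * (w.length * b.grow.eval w.length))
        + w.length * b.rate.eval w.length * size s.wk := by ring
    omega
  | drain k k₁ k₂ f g e =>
    have h1 := length_out_foldl_drainStep k₁ k₂ f g e (s.wk k) { s with wk := update s.wk k [] }
    have h2 := length_le_size s.wk k
    simp only [den, base, rate, Polynomial.eval_one, one_mul] at *; omega

end size

/-! ### Compilation -/

/-- The stacks of the machine: the two copies of the input, their shadows, the work stacks, the
output under construction and the final output. -/
abbrev Stk (W : Type) : Type := (Bool × Bool) ⊕ (W ⊕ Bool)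

/-- The alphabets of the stacks. -/
abbrev Alph (W AI A : Type) : Stk W → Type := Sum.elim (fun _ => AI) (fun _ => A)

/-- The control state of the machine: two registers are added. -/
abbrev Var (σ AI A : Type) : Type := σ × Option AI × Option A

/-- The contents of all stacks. -/
def stks (inp sh : Bool → List AI) (wk : W → List A) (out fin : List A) :
    ∀ k : Stk W, List (Alph W AI A k)
  | Sum.inl (i, false) => inp i
  | Sum.inl (i, true) => sh i
  | Sum.inr (Sum.inl k) => wk k
  | Sum.inr (Sum.inr false) => out
  | Sum.inr (Sum.inr true) => fin

/-- A name of the stack, usable as an index. -/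
abbrev sInp (i : Bool) : Stk W := Sum.inl (i, false)
/-- The shadow of a copy of the input. -/
abbrev sSh (i : Bool) : Stk W := Sum.inl (i, true)
/-- A work stack. -/
abbrev sWk (k : W) : Stk W := Sum.inr (Sum.inl k)
/-- The stack on which the output is constructed. -/
abbrev sOut : Stk W := Sum.inr (Sum.inr false)
/-- The stack of the final output. -/
abbrev sFin : Stk W := Sum.inr (Sum.inr true)

section stackUpdates
variable [DecidableEq W] (inp sh : Bool → List AI) (wk : W → List A) (out fin : List A)

theorem update_inp (i : Bool) (l : List AI) :
    update (stks inp sh wk out fin) (sInp i) l = stks (update inp i l) sh wk out fin := by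
  funext k
  by_cases h : k = sInp i
  · subst h
    exact (update_self _ _ _).trans (update_self i l inp).symm
  · refine (update_of_ne h _ _).trans ?_
    rcases k with ⟨j, _ | _⟩ | k | _ | _ <;> try rfl
    exact (update_of_ne (fun e : j = i => h (by rw [e])) _ _).symm

theorem update_sh (i : Bool) (l : List AI) :
    update (stks inp sh wk out fin) (sSh i) l = stks inp (update sh i l) wk out fin := by
  funext k
  by_cases h : k = sSh i
  · subst h
    exact (update_self _ _ _).trans (update_self i l sh).symm
  · refine (update_of_ne h _ _).trans ?_
    rcases k with ⟨j, _ | _⟩ | k | _ | _ <;> try rfl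
    exact (update_of_ne (fun e : j = i => h (by rw [e])) _ _).symm

theorem update_wk (i : W) (l : List A) :
    update (stks inp sh wk out fin) (sWk i) l = stks inp sh (update wk i l) out fin := by
  funext k
  by_cases h : k = sWk i
  · subst h
    exact (update_self _ _ _).trans (update_self i l wk).symm
  · refine (update_of_ne h _ _).trans ?_
    rcases k with ⟨j, _ | _⟩ | k | _ | _ <;> try rfl
    exact (update_of_ne (fun e : k = i => h (by rw [e])) _ _).symm

theorem update_out (l : List A) :
    update (stks inp sh wk out fin) sOut l = stks inp sh wk l fin := by
  funext k
  by_cases h : k = sOut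
  · subst h
    exact update_self _ _ _
  · refine (update_of_ne h _ _).trans ?_
    rcases k with ⟨j, _ | _⟩ | k | _ | _ <;> first | rfl | exact absurd rfl h

theorem update_fin (l : List A) :
    update (stks inp sh wk out fin) sFin l = stks inp sh wk out l := by
  funext k
  by_cases h : k = sFin
  · subst h
    exact update_self _ _ _
  · refine (update_of_ne h _ _).trans ?_
    rcases k with ⟨j, _ | _⟩ | k | _ | _ <;> first | rfl | exact absurd rfl h

end stackUpdates

section statements
variable {Λ : Type}

/-- Push on a copy of the input. -/
def pushInp (i : Bool) (f : Var σ AI A → AI) (q : TM2.Stmt (Alph W AI A) Λ (Var σ AI A)) :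
    TM2.Stmt (Alph W AI A) Λ (Var σ AI A) := .push (sInp i) f q

/-- Push on the shadow of a copy of the input. -/
def pushSh (i : Bool) (f : Var σ AI A → AI) (q : TM2.Stmt (Alph W AI A) Λ (Var σ AI A)) :
    TM2.Stmt (Alph W AI A) Λ (Var σ AI A) := .push (sSh i) f q

/-- Push on a work stack. -/
def pushWk (k : W) (f : Var σ AI A → A) (q : TM2.Stmt (Alph W AI A) Λ (Var σ AI A)) :
    TM2.Stmt (Alph W AI A) Λ (Var σ AI A) := .push (sWk k) f q

/-- Push on the stack under construction. -/
def pushOut (f : Var σ AI A → A) (q : TM2.Stmt (Alph W AI A) Λ (Var σ AI A)) :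
    TM2.Stmt (Alph W AI A) Λ (Var σ AI A) := .push sOut f q

/-- Push on the final output. -/
def pushFin (f : Var σ AI A → A) (q : TM2.Stmt (Alph W AI A) Λ (Var σ AI A)) :
    TM2.Stmt (Alph W AI A) Λ (Var σ AI A) := .push sFin f q

/-- Pop from a copy of the input. -/
def popInp (i : Bool) (f : Var σ AI A → Option AI → Var σ AI A)
    (q : TM2.Stmt (Alph W AI A) Λ (Var σ AI A)) :
    TM2.Stmt (Alph W AI A) Λ (Var σ AI A) := .pop (sInp i) f q

/-- Pop from the shadow of a copy of the input. -/
def popSh (i : Bool) (f : Var σ AI A → Option AI → Var σ AI A)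
    (q : TM2.Stmt (Alph W AI A) Λ (Var σ AI A)) :
    TM2.Stmt (Alph W AI A) Λ (Var σ AI A) := .pop (sSh i) f q

/-- Pop from a work stack. -/
def popWk (k : W) (f : Var σ AI A → Option A → Var σ AI A)
    (q : TM2.Stmt (Alph W AI A) Λ (Var σ AI A)) :
    TM2.Stmt (Alph W AI A) Λ (Var σ AI A) := .pop (sWk k) f q

/-- Pop from the stack under construction. -/
def popOut (f : Var σ AI A → Option A → Var σ AI A)
    (q : TM2.Stmt (Alph W AI A) Λ (Var σ AI A)) :
    TM2.Stmt (Alph W AI A) Λ (Var σ AI A) := .pop sOut f q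

end statements

namespace Cmd

/-- The labels of the compiled program. -/
def Lab : Cmd W σ AI A → Type
  | seq a b => a.Lab ⊕ b.Lab
  | ite _ a b => Unit ⊕ (a.Lab ⊕ b.Lab)
  | forIn _ _ b => Bool ⊕ b.Lab
  | _ => Unit

instance fintypeLab : (c : Cmd W σ AI A) → Fintype c.Lab
  | seq a b => @instFintypeSum _ _ (fintypeLab a) (fintypeLab b)
  | ite _ a b => @instFintypeSum _ _ inferInstance (@instFintypeSum _ _ (fintypeLab a) (fintypeLab b))
  | forIn _ _ b => @instFintypeSum _ _ inferInstance (fintypeLab b)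
  | push _ _ => inferInstanceAs (Fintype Unit)
  | emit _ => inferInstanceAs (Fintype Unit)
  | pop _ _ => inferInstanceAs (Fintype Unit)
  | load _ => inferInstanceAs (Fintype Unit)
  | drain _ _ _ _ _ _ => inferInstanceAs (Fintype Unit)

/-- The label at which the compiled program starts. -/
def entry : (c : Cmd W σ AI A) → c.Lab
  | seq a _ => Sum.inl a.entry
  | ite _ _ _ => Sum.inl ()
  | forIn _ _ _ => Sum.inl true
  | push _ _ => ()
  | emit _ => ()
  | pop _ _ => ()
  | load _ => ()
  | drain _ _ _ _ _ _ => ()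

variable [Inhabited AI] [Inhabited A]

open TM2 (Stmt)

/-- The compiled program: `emb` embeds its labels into those of the machine, and it ends with a jump
to the label `exit`. -/
def code {Λ : Type} : (c : Cmd W σ AI A) → (emb : c.Lab → Λ) → (exit : Λ) → c.Lab →
    Stmt (Alph W AI A) Λ (Var σ AI A)
  | push k f, _, exit, _ => pushWk k (fun v => f v.1) <| .goto fun _ => exit
  | emit f, _, exit, _ => pushOut (fun v => f v.1) <| .goto fun _ => exit
  | pop k f, _, exit, _ =>
    popWk k (fun v o => (f v.1 o, none, none)) <| .goto fun _ => exit
  | load f, _, exit, _ => .load (fun v => (f v.1, none, none)) <| .goto fun _ => exit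
  | seq a b, emb, _, Sum.inl l =>
    a.code (fun l => emb (Sum.inl l)) (emb (Sum.inr b.entry)) l
  | seq _ b, emb, exit, Sum.inr l => b.code (fun l => emb (Sum.inr l)) exit l
  | ite p a b, emb, _, Sum.inl _ =>
    .branch (fun v => p v.1) (.goto fun _ => emb (Sum.inr (Sum.inl a.entry)))
      (.goto fun _ => emb (Sum.inr (Sum.inr b.entry)))
  | ite _ a _, emb, exit, Sum.inr (Sum.inl l) =>
    a.code (fun l => emb (Sum.inr (Sum.inl l))) exit l
  | ite _ _ b, emb, exit, Sum.inr (Sum.inr l) =>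
    b.code (fun l => emb (Sum.inr (Sum.inr l))) exit l
  | forIn i f b, emb, _, Sum.inl true =>
    popInp i (fun v o => (v.1, o, none)) <|
      .branch (fun v => v.2.1.isSome)
        (pushSh i (fun v => v.2.1.getD default) <|
          .load (fun v => (f v.1 (v.2.1.getD default), none, none)) <|
          .goto fun _ => emb (Sum.inr b.entry))
        (.goto fun _ => emb (Sum.inl false))
  | forIn i _ _, emb, exit, Sum.inl false =>
    popSh i (fun v o => (v.1, o, none)) <|
      .branch (fun v => v.2.1.isSome)
        (pushInp i (fun v => v.2.1.getD default) <|
          .load (fun v => (v.1, none, none)) <|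
          .goto fun _ => emb (Sum.inl false))
        (.goto fun _ => exit)
  | forIn _ _ b, emb, _, Sum.inr l => b.code (fun l => emb (Sum.inr l)) (emb (Sum.inl true)) l
  | drain k k₁ k₂ f g e, emb, exit, _ =>
    let back : Stmt (Alph W AI A) Λ (Var σ AI A) :=
      .load (fun v => (f v.1 (v.2.2.getD default), none, none)) <| .goto fun _ => emb ()
    let store : Stmt (Alph W AI A) Λ (Var σ AI A) :=
      .branch (fun v => (g v.1 (v.2.2.getD default)).isSome)
        (.branch (fun v => ((g v.1 (v.2.2.getD default)).getD default).1)
          (pushWk k₁ (fun v => ((g v.1 (v.2.2.getD default)).getD default).2) back)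
          (pushWk k₂ (fun v => ((g v.1 (v.2.2.getD default)).getD default).2) back))
        back
    popWk k (fun v o => (v.1, none, o)) <|
      .branch (fun v => v.2.2.isSome)
        (.branch (fun v => (e v.1 (v.2.2.getD default)).isSome)
          (pushOut (fun v => (e v.1 (v.2.2.getD default)).getD default) store) store)
        (.goto fun _ => exit)

end Cmd

/-- The machine goes from `c` to `c'` in exactly `t` steps. -/
def RunsIn [DecidableEq W] {Λ : Type} (M : Λ → TM2.Stmt (Alph W AI A) Λ (Var σ AI A)) (t : ℕ)
    (c c' : TM2.Cfg (Alph W AI A) Λ (Var σ AI A)) : Prop :=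
  (flip bind (TM2.step M))^[t] (some c) = some c'

/-- The machine goes from `c` to `c'` in at most `t` steps. -/
def RunsWithin [DecidableEq W] {Λ : Type} (M : Λ → TM2.Stmt (Alph W AI A) Λ (Var σ AI A)) (t : ℕ)
    (c c' : TM2.Cfg (Alph W AI A) Λ (Var σ AI A)) : Prop :=
  ∃ t' ≤ t, RunsIn M t' c c'

section run
variable [DecidableEq W] {Λ : Type} {M : Λ → TM2.Stmt (Alph W AI A) Λ (Var σ AI A)}
  {c c' c'' : TM2.Cfg (Alph W AI A) Λ (Var σ AI A)} {t t' : ℕ}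

theorem RunsWithin.trans (h : RunsWithin M t c c') (h' : RunsWithin M t' c' c'') :
    RunsWithin M (t + t') c c'' := by
  obtain ⟨a, ha, ha'⟩ := h
  obtain ⟨b, hb, hb'⟩ := h'
  refine ⟨b + a, by omega, ?_⟩
  unfold RunsIn at *
  rw [Function.iterate_add_apply, ha', hb']

theorem RunsWithin.mono (h : RunsWithin M t c c') (ht : t ≤ t') : RunsWithin M t' c c' :=
  let ⟨a, ha, ha'⟩ := h
  ⟨a, ha.trans ht, ha'⟩

theorem RunsWithin.step {l : Λ} {q : TM2.Stmt (Alph W AI A) Λ (Var σ AI A)} {v : Var σ AI A}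
    {S : ∀ k, List (Alph W AI A k)} (hq : M l = q) (h : TM2.stepAux q v S = c') :
    RunsWithin M 1 ⟨some l, v, S⟩ c' :=
  ⟨1, le_rfl, by subst hq; subst h; rfl⟩

end run

section stepAux
variable [DecidableEq W] {Λ : Type} (inp sh : Bool → List AI) (wk : W → List A) (out fin : List A)
  (q : TM2.Stmt (Alph W AI A) Λ (Var σ AI A)) (v : Var σ AI A)

/-- These rules execute a statement symbolically and keep the stacks in the form `stks …`, so that a
machine step is verified by rewriting. -/
theorem stepAux_push_inp (i : Bool) (f : Var σ AI A → AI) :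
    TM2.stepAux (pushInp i f q) v (stks inp sh wk out fin) =
      TM2.stepAux q v (stks (update inp i (f v :: inp i)) sh wk out fin) :=
  congrArg (TM2.stepAux q v) (update_inp inp sh wk out fin i _)

theorem stepAux_push_sh (i : Bool) (f : Var σ AI A → AI) :
    TM2.stepAux (pushSh i f q) v (stks inp sh wk out fin) =
      TM2.stepAux q v (stks inp (update sh i (f v :: sh i)) wk out fin) :=
  congrArg (TM2.stepAux q v) (update_sh inp sh wk out fin i _)

theorem stepAux_push_wk (k : W) (f : Var σ AI A → A) :
    TM2.stepAux (pushWk k f q) v (stks inp sh wk out fin) =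
      TM2.stepAux q v (stks inp sh (update wk k (f v :: wk k)) out fin) :=
  congrArg (TM2.stepAux q v) (update_wk inp sh wk out fin k _)

theorem stepAux_push_out (f : Var σ AI A → A) :
    TM2.stepAux (pushOut f q) v (stks inp sh wk out fin) =
      TM2.stepAux q v (stks inp sh wk (f v :: out) fin) :=
  congrArg (TM2.stepAux q v) (update_out inp sh wk out fin _)

theorem stepAux_push_fin (f : Var σ AI A → A) :
    TM2.stepAux (pushFin f q) v (stks inp sh wk out fin) =
      TM2.stepAux q v (stks inp sh wk out (f v :: fin)) :=
  congrArg (TM2.stepAux q v) (update_fin inp sh wk out fin _)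

theorem stepAux_pop_inp (i : Bool) (f : Var σ AI A → Option AI → Var σ AI A) :
    TM2.stepAux (popInp i f q) v (stks inp sh wk out fin) =
      TM2.stepAux q (f v (inp i).head?) (stks (update inp i (inp i).tail) sh wk out fin) :=
  congrArg (TM2.stepAux q (f v (inp i).head?)) (update_inp inp sh wk out fin i _)

theorem stepAux_pop_sh (i : Bool) (f : Var σ AI A → Option AI → Var σ AI A) :
    TM2.stepAux (popSh i f q) v (stks inp sh wk out fin) =
      TM2.stepAux q (f v (sh i).head?) (stks inp (update sh i (sh i).tail) wk out fin) :=
  congrArg (TM2.stepAux q (f v (sh i).head?)) (update_sh inp sh wk out fin i _)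

theorem stepAux_pop_wk (k : W) (f : Var σ AI A → Option A → Var σ AI A) :
    TM2.stepAux (popWk k f q) v (stks inp sh wk out fin) =
      TM2.stepAux q (f v (wk k).head?) (stks inp sh (update wk k (wk k).tail) out fin) :=
  congrArg (TM2.stepAux q (f v (wk k).head?)) (update_wk inp sh wk out fin k _)

theorem stepAux_pop_out (f : Var σ AI A → Option A → Var σ AI A) :
    TM2.stepAux (popOut f q) v (stks inp sh wk out fin) =
      TM2.stepAux q (f v out.head?) (stks inp sh wk out.tail fin) :=
  congrArg (TM2.stepAux q (f v out.head?)) (update_out inp sh wk out fin _)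

theorem stepAux_branch (p : Var σ AI A → Bool) (q₁ q₂ : TM2.Stmt (Alph W AI A) Λ (Var σ AI A))
    (S : ∀ k, List (Alph W AI A k)) :
    TM2.stepAux (.branch p q₁ q₂) v S = bif p v then TM2.stepAux q₁ v S else TM2.stepAux q₂ v S :=
  rfl

theorem stepAux_load (f : Var σ AI A → Var σ AI A) (S : ∀ k, List (Alph W AI A k)) :
    TM2.stepAux (.load f q) v S = TM2.stepAux q (f v) S := rfl

theorem stepAux_goto (l : Λ) (S : ∀ k, List (Alph W AI A k)) :
    TM2.stepAux (.goto fun _ => l) v S = (⟨some l, v, S⟩ : TM2.Cfg (Alph W AI A) Λ (Var σ AI A)) :=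
  rfl

end stepAux

/-- The configuration of the machine that corresponds to a state of the program. -/
def conf {Λ : Type} (l : Option Λ) (s : St W σ A) (inp sh : Bool → List AI) (fin : List A) :
    TM2.Cfg (Alph W AI A) Λ (Var σ AI A) :=
  ⟨l, (s.v, none, none), stks inp sh s.wk s.out fin⟩

end LoopProg

/-! ### Correctness and running time of compiled programs -/

namespace LoopProg

open Turing Function

variable {W σ AI A : Type} [DecidableEq W] [Inhabited AI] [Inhabited A]
  {Λ : Type} {M : Λ → TM2.Stmt (Alph W AI A) Λ (Var σ AI A)}

/-- Where `k₁`, `k₂` differ from `k`, emptying the stack `k` commutes with a step of a pass. -/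
theorem Cmd.drainStep_clear {k k₁ k₂ : W} (h₁ : k₁ ≠ k) (h₂ : k₂ ≠ k) (f : σ → A → σ)
    (g : σ → A → Option (Bool × A)) (e : σ → A → Option A) (s : St W σ A) (l : List A) (a : A) :
    drainStep k₁ k₂ f g e { s with wk := update s.wk k l } a =
      { drainStep k₁ k₂ f g e s a with
        wk := update (drainStep k₁ k₂ f g e s a).wk k l } := by
  unfold drainStep
  dsimp only
  congr 1
  cases g s.v a with
  | none => rfl
  | some p =>
    obtain ⟨b, x⟩ := p
    cases b
    · simp only [cond_false]
      rw [update_of_ne h₂, update_comm h₂]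
    · simp only [cond_true]
      rw [update_of_ne h₁, update_comm h₁]

theorem Cmd.drainStep_apply {k k₁ k₂ : W} (h₁ : k₁ ≠ k) (h₂ : k₂ ≠ k) (f : σ → A → σ)
    (g : σ → A → Option (Bool × A)) (e : σ → A → Option A) (s : St W σ A) (a : A) :
    (drainStep k₁ k₂ f g e s a).wk k = s.wk k := by
  unfold drainStep
  dsimp only
  cases g s.v a with
  | none => rfl
  | some p =>
    obtain ⟨b, x⟩ := p
    cases b
    · exact update_of_ne h₂.symm _ _
    · exact update_of_ne h₁.symm _ _

/-- The machine empties the stack `k` symbol by symbol, the program at once. `drainStep_clear`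
reconciles the two, since the pass never writes on `k`. -/
theorem runsWithin_drain {k k₁ k₂ : W} {f : σ → A → σ} {g : σ → A → Option (Bool × A)}
    {e : σ → A → Option A} (h₁ : k₁ ≠ k) (h₂ : k₂ ≠ k)
    {emb : Unit → Λ} {exit : Λ}
    (hM : ∀ l, M (emb l) = Cmd.code (.drain k k₁ k₂ f g e) emb exit l)
    (inp sh : Bool → List AI) (fin : List A) (l : List A) (s : St W σ A) (hs : s.wk k = l) :
    RunsWithin M (1 + l.length) (conf (some (emb ())) s inp sh fin)
      (conf (some exit) (l.foldl (Cmd.drainStep k₁ k₂ f g e) { s with wk := update s.wk k [] })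
        inp sh fin) := by
  induction l generalizing s with
  | nil =>
    refine RunsWithin.step (hM ()) ?_
    simp only [Cmd.code, stepAux_pop_wk, stepAux_branch, stepAux_goto, hs, List.head?_nil,
      Option.isSome_none, cond_false, List.tail_nil]
    rfl
  | cons a l ih =>
    have key : RunsWithin M 1 (conf (some (emb ())) s inp sh fin)
        (conf (some (emb ()))
          (Cmd.drainStep k₁ k₂ f g e { s with wk := update s.wk k l } a) inp sh fin) := by
      refine RunsWithin.step (hM ()) ?_
      simp only [Cmd.code, stepAux_pop_wk, stepAux_branch, stepAux_goto, stepAux_load,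
        stepAux_push_out, stepAux_push_wk, hs, List.head?_cons, Option.isSome_some,
        cond_true, List.tail_cons, Option.getD_some]
      unfold Cmd.drainStep conf
      dsimp only
      rcases he : e s.v a with _ | y <;> rcases hg : g s.v a with _ | ⟨_ | _, x⟩ <;>
        simp [he, hg]
    have h3 := ih (Cmd.drainStep k₁ k₂ f g e { s with wk := update s.wk k l } a)
      ((Cmd.drainStep_apply h₁ h₂ f g e _ a).trans (update_self _ _ _))
    rw [← Cmd.drainStep_clear h₁ h₂] at h3
    simp only [update_idem] at h3
    rw [List.length_cons]
    exact (key.trans h3).mono (by omega)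

/-- A loop leaves the input in reverse order on the shadow; popping it from there restores the
order, and the copy is ready for the next loop with this index. -/
theorem runsWithin_restore {i : Bool} {f : σ → AI → σ} {b : Cmd W σ AI A}
    {emb : (Cmd.forIn i f b).Lab → Λ} {exit : Λ}
    (hM : ∀ l, M (emb l) = Cmd.code (.forIn i f b) emb exit l)
    (inp sh : Bool → List AI) (fin : List A) (s : St W σ A) (u : List AI) (hu : sh i = u) :
    RunsWithin M (1 + u.length) (conf (some (emb (Sum.inl false))) s inp sh fin)
      (conf (some exit) s (update inp i (u.reverse ++ inp i)) (update sh i []) fin) := by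
  induction u generalizing inp sh with
  | nil =>
    refine RunsWithin.step (hM (Sum.inl false)) ?_
    simp only [Cmd.code, stepAux_pop_sh, stepAux_branch, stepAux_goto, hu, List.head?_nil, Option.isSome_none, cond_false,
      List.tail_nil, List.reverse_nil, List.nil_append, update_eq_self]
    rfl
  | cons a u ih =>
    have key : RunsWithin M 1 (conf (some (emb (Sum.inl false))) s inp sh fin)
        (conf (some (emb (Sum.inl false))) s (update inp i (a :: inp i)) (update sh i u) fin) := by
      refine RunsWithin.step (hM (Sum.inl false)) ?_
      simp only [Cmd.code, stepAux_pop_sh, stepAux_branch, stepAux_goto, stepAux_load,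
        stepAux_push_inp, hu, List.head?_cons,
        Option.isSome_some, cond_true, List.tail_cons, Option.getD_some]
      rfl
    have h3 := ih (update inp i (a :: inp i)) (update sh i u) (update_self _ _ _)
    simp only [update_self, update_idem] at h3
    rw [List.length_cons, List.reverse_cons, List.append_assoc]
    exact (key.trans h3).mono (by omega)

-- Induction on the program. The copies of the input that a program uses must be complete and their
-- shadows empty (`hinp`). This survives nesting because the body of a loop never uses the index of
-- that loop, whose copy is half read.
open Polynomial in
theorem Cmd.runsWithin [Fintype W] (c : Cmd W σ AI A) (hc : c.WF)
    {emb : c.Lab → Λ} {exit : Λ} (hM : ∀ l, M (emb l) = c.code emb exit l) (w : List AI)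
    (inp sh : Bool → List AI) (fin : List A)
    (hinp : ∀ i, c.uses i → inp i = w ∧ sh i = []) (s : St W σ A) :
    RunsWithin M (c.base.eval w.length + c.rate.eval w.length * size s.wk)
      (conf (some (emb c.entry)) s inp sh fin) (conf (some exit) (c.den w s) inp sh fin) := by
  induction c generalizing inp sh exit s with
  | push k f =>
    refine (RunsWithin.step (hM ()) ?_).mono (t := 1) (by simp [base])
    simp only [code, stepAux_push_wk, stepAux_goto]
    rfl
  | emit f =>
    refine (RunsWithin.step (hM ()) ?_).mono (t := 1) (by simp [base])
    simp only [code, stepAux_push_out, stepAux_goto]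
    rfl
  | pop k f =>
    refine (RunsWithin.step (hM ()) ?_).mono (t := 1) (by simp [base])
    simp only [code, stepAux_pop_wk, stepAux_goto]
    rfl
  | load f =>
    refine (RunsWithin.step (hM ()) ?_).mono (t := 1) (by simp [base])
    simp only [code, TM2.stepAux]
    rfl
  | seq a b iha ihb =>
    have h1 := iha hc.1 (emb := fun l => emb (Sum.inl l)) (exit := emb (Sum.inr b.entry))
      (fun l => hM (Sum.inl l)) inp sh (fun i hi => hinp i (Or.inl hi)) s
    have h2 := ihb hc.2 (emb := fun l => emb (Sum.inr l)) (exit := exit)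
      (fun l => hM (Sum.inr l)) inp sh (fun i hi => hinp i (Or.inr hi)) (a.den w s)
    refine (h1.trans h2).mono ?_
    have h3 := Nat.mul_le_mul_left (b.rate.eval w.length) (a.size_den w s)
    simp only [base, rate, Polynomial.eval_add, Polynomial.eval_mul]
    linarith
  | ite p a b iha ihb =>
    have h1 := iha hc.1 (emb := fun l => emb (Sum.inr (Sum.inl l))) (exit := exit)
      (fun l => hM (Sum.inr (Sum.inl l))) inp sh (fun i hi => hinp i (Or.inl hi)) s
    have h2 := ihb hc.2 (emb := fun l => emb (Sum.inr (Sum.inr l))) (exit := exit)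
      (fun l => hM (Sum.inr (Sum.inr l))) inp sh (fun i hi => hinp i (Or.inr hi)) s
    have key : RunsWithin M 1 (conf (some (emb (Sum.inl ()))) s inp sh fin)
        (bif p s.v then conf (some (emb (Sum.inr (Sum.inl a.entry)))) s inp sh fin else
          conf (some (emb (Sum.inr (Sum.inr b.entry)))) s inp sh fin) := by
      refine RunsWithin.step (hM (Sum.inl ())) ?_
      simp only [code, stepAux_branch, stepAux_goto]
      rfl
    simp only [den, base, rate, Polynomial.eval_add, Polynomial.eval_one, add_mul]
    cases h : p s.v
    · simp only [h, cond_false] at key ⊢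
      exact (key.trans h2).mono (by omega)
    · simp only [h, cond_true] at key ⊢
      exact (key.trans h1).mono (by omega)
  | forIn i f b ih =>
    obtain ⟨hi, hb⟩ := hc
    obtain ⟨h0, h0'⟩ := hinp i (Or.inl rfl)
    have key : ∀ (u : List AI) (s : St W σ A) (inp sh : Bool → List AI) (m : ℕ), inp i = u →
        (∀ j, b.uses j → inp j = w ∧ sh j = []) →
        size s.wk + u.length * b.grow.eval w.length ≤ m →
        RunsWithin M
          (1 + u.length * (1 + b.base.eval w.length + b.rate.eval w.length * m))
          (conf (some (emb (Sum.inl true))) s inp sh fin)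
          (conf (some (emb (Sum.inl false)))
            (u.foldl (fun s a => b.den w { s with v := f s.v a }) s)
            (update inp i []) (update sh i (u.reverse ++ sh i)) fin) := by
      intro u
      induction u with
      | nil =>
        intro s inp sh m h1 _ _
        refine (RunsWithin.step (hM (Sum.inl true)) ?_).mono (t := 1) (by simp)
        simp only [code, stepAux_pop_inp, stepAux_branch, stepAux_goto, h1, List.head?_nil, Option.isSome_none,
          cond_false, List.tail_nil, List.reverse_nil, List.nil_append, update_eq_self]
        rfl
      | cons a u ihu =>
        intro s inp sh m h1 h2 hm
        have step1 : RunsWithin M 1 (conf (some (emb (Sum.inl true))) s inp sh fin)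
            (conf (some (emb (Sum.inr b.entry))) { s with v := f s.v a }
              (update inp i u) (update sh i (a :: sh i)) fin) := by
          refine RunsWithin.step (hM (Sum.inl true)) ?_
          simp only [code, stepAux_pop_inp, stepAux_branch, stepAux_goto, stepAux_load,
            stepAux_push_sh, h1, List.head?_cons,
            Option.isSome_some, cond_true, List.tail_cons, Option.getD_some]
          rfl
        have hne : ∀ j, b.uses j → j ≠ i := fun j hj e => hi (e ▸ hj)
        have h2' : ∀ j, b.uses j →
            update inp i u j = w ∧ update sh i (a :: sh i) j = [] := fun j hj => by
          rw [update_of_ne (hne j hj), update_of_ne (hne j hj)]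
          exact h2 j hj
        have step2 := ih hb (emb := fun l => emb (Sum.inr l)) (exit := emb (Sum.inl true))
          (fun l => hM (Sum.inr l)) (update inp i u) (update sh i (a :: sh i)) h2'
          { s with v := f s.v a }
        have h3 := b.size_den w { s with v := f s.v a }
        simp only [List.length_cons, add_mul, one_mul] at hm
        have step3 := ihu (b.den w { s with v := f s.v a }) (update inp i u)
          (update sh i (a :: sh i)) m (update_self _ _ _) h2' (by dsimp only at *; omega)
        simp only [update_self, update_idem] at step3
        have h4 : b.rate.eval w.length * size s.wk ≤ b.rate.eval w.length * m :=
          Nat.mul_le_mul_left _ (by omega)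
        rw [List.reverse_cons, List.append_assoc]
        refine ((step1.trans step2).trans step3).mono ?_
        simp only [List.length_cons, add_mul, one_mul] at *
        omega
    have h1 := key w s inp sh _ h0 (fun j hj => hinp j (Or.inr hj)) le_rfl
    have h2 := runsWithin_restore hM (update inp i []) (update sh i (w.reverse ++ sh i)) fin
      (w.foldl (fun s a => b.den w { s with v := f s.v a }) s) _ (update_self _ _ _)
    rw [h0'] at h1 h2
    simp only [update_self, update_idem, List.append_nil, List.reverse_reverse] at h1 h2
    have e1 : update inp i w = inp := by rw [← h0, update_eq_self]
    have e2 : update sh i [] = sh := by rw [← h0', update_eq_self]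
    rw [e1, e2] at h2
    refine (h1.trans h2).mono ?_
    simp only [base, rate, Polynomial.eval_add, Polynomial.eval_mul, Polynomial.eval_X,
      Polynomial.eval_ofNat, List.length_reverse]
    apply le_of_eq
    ring
  | drain k k₁ k₂ f g e =>
    refine (runsWithin_drain hc.1 hc.2 hM inp sh fin (s.wk k) s rfl).mono ?_
    have := length_le_size s.wk k
    simp only [base, rate, Polynomial.eval_one]
    omega

end LoopProg

/-! ### The complete machine -/

namespace LoopProg

open Turing Function

variable {W σ AI A : Type} [DecidableEq W]

namespace Cmd

/-- Empty the work stack `k`. -/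
noncomputable def clear [Nontrivial W] (k : W) : Cmd W σ AI A :=
  drain k (exists_ne k).choose (exists_ne k).choose (fun v _ => v) (fun _ _ => none) (fun _ _ => none)

/-- Empty several work stacks. -/
noncomputable def clearAll [Nontrivial W] : List W → Cmd W σ AI A
  | [] => load id
  | k :: l => seq (clear k) (clearAll l)

theorem wf_clearAll [Nontrivial W] (l : List W) : (clearAll l : Cmd W σ AI A).WF := by
  induction l with
  | nil => trivial
  | cons k l ih => exact ⟨⟨(exists_ne k).choose_spec, (exists_ne k).choose_spec⟩, ih⟩

theorem den_clear [Nontrivial W] (w : List AI) (k : W) (s : St W σ A) :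
    (clear k).den w s = { s with wk := update s.wk k [] } := by
  have (l : List A) (s : St W σ A) : l.foldl (drainStep (exists_ne k).choose (exists_ne k).choose
      (fun v _ => v) (fun _ _ => none) (fun _ _ => none)) s = s := by
    induction l generalizing s with
    | nil => rfl
    | cons a l ih => rw [List.foldl_cons, ih]; rfl
  exact this _ _

theorem den_clearAll [Nontrivial W] (w : List AI) (l : List W) (s : St W σ A) :
    ((clearAll l).den w s).out = s.out ∧
      ∀ k, ((clearAll l).den w s).wk k = if k ∈ l then [] else s.wk k := by
  induction l generalizing s with
  | nil => simp [clearAll, den]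
  | cons j l ih =>
    simp only [clearAll, den, den_clear]
    refine ⟨(ih _).1, fun k => ?_⟩
    rw [(ih _).2]
    by_cases h : k = j
    · subst h; simp
    · simp [h]

end Cmd

section machine
variable [Inhabited AI] [Inhabited A]

/-- The machine of a program: it copies the input, runs the program, moves the output to the output
stack and erases the input. -/
def machineCode (c : Cmd W σ AI A) (v₀ : σ) :
    c.Lab ⊕ Fin 5 → TM2.Stmt (Alph W AI A) (c.Lab ⊕ Fin 5) (Var σ AI A)
  | Sum.inl l => c.code Sum.inl (Sum.inr 2) l
  | Sum.inr 0 =>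
    popInp false (fun v o => (v.1, o, none)) <|
      .branch (fun v => v.2.1.isSome)
        (pushSh false (fun v => v.2.1.getD default) <| .goto fun _ => Sum.inr 0)
        (.goto fun _ => Sum.inr 1)
  | Sum.inr 1 =>
    popSh false (fun v o => (v.1, o, none)) <|
      .branch (fun v => v.2.1.isSome)
        (pushInp false (fun v => v.2.1.getD default) <|
          pushInp true (fun v => v.2.1.getD default) <| .goto fun _ => Sum.inr 1)
        (.goto fun _ => Sum.inl c.entry)
  | Sum.inr 2 =>
    popOut (fun v o => (v.1, none, o)) <|
      .branch (fun v => v.2.2.isSome)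
        (pushFin (fun v => v.2.2.getD default) <| .goto fun _ => Sum.inr 2)
        (.goto fun _ => Sum.inr 3)
  | Sum.inr 3 =>
    popInp false (fun v o => (v.1, o, none)) <|
      .branch (fun v => v.2.1.isSome) (.goto fun _ => Sum.inr 3) (.goto fun _ => Sum.inr 4)
  | Sum.inr 4 =>
    popInp true (fun v o => (v.1, o, none)) <|
      .branch (fun v => v.2.1.isSome) (.goto fun _ => Sum.inr 4)
        (.load (fun _ => (v₀, none, none)) .halt)

/-- The machine of a program. -/
def machine [Fintype W] [Fintype σ] [Fintype AI] [Fintype A] (c : Cmd W σ AI A) (v₀ : σ) :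
    FinTM2 where
  K := Stk W
  k₀ := sInp false
  k₁ := sFin
  Γ := Alph W AI A
  Λ := c.Lab ⊕ Fin 5
  main := Sum.inr 0
  ΛFin := @instFintypeSum _ _ (Cmd.fintypeLab c) inferInstance
  σ := Var σ AI A
  initialState := (v₀, none, none)
  Γk₀Fin := inferInstanceAs (Fintype AI)
  m := machineCode c v₀

variable (c : Cmd W σ AI A) (v₀ : σ)

/-- The two copies of the input. -/
def copies (u v : List AI) : Bool → List AI := fun i => bif i then v else u

theorem update_copies_false (u v x : List AI) : update (copies u v) false x = copies x v := by
  funext i; cases i <;> rfl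

theorem update_copies_true (u v x : List AI) : update (copies u v) true x = copies u x := by
  funext i; cases i <;> rfl

/-- The input is first turned over onto the shadow, from where `runs_copy` puts it in the right
order on both copies. -/
theorem runs_read (u y : List AI) (o : Option AI) (wk : W → List A) (out fin : List A) :
    RunsWithin (machineCode c v₀) (u.length + 1)
      ⟨some (Sum.inr 0), (v₀, o, none), stks (copies u []) (copies y []) wk out fin⟩
      ⟨some (Sum.inr 1), (v₀, none, none), stks (copies [] []) (copies (u.reverse ++ y) []) wk
        out fin⟩ := by
  induction u generalizing y o with
  | nil =>
    refine RunsWithin.step rfl ?_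
    simp only [machineCode, stepAux_pop_inp, stepAux_branch, stepAux_goto, update_copies_false]
    rfl
  | cons a u ih =>
    have h1 : RunsWithin (machineCode c v₀) 1
        ⟨some (Sum.inr 0), (v₀, o, none), stks (copies (a :: u) []) (copies y []) wk out fin⟩
        ⟨some (Sum.inr 0), (v₀, some a, none), stks (copies u []) (copies (a :: y) []) wk out fin⟩ := by
      refine RunsWithin.step rfl ?_
      simp only [machineCode, stepAux_pop_inp, stepAux_branch, stepAux_goto, stepAux_push_sh,
        update_copies_false]
      rfl
    rw [List.reverse_cons, List.append_assoc, List.length_cons]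
    exact (h1.trans (ih (a :: y) (some a))).mono (by omega)

theorem runs_copy (u y : List AI) (o : Option AI) (wk : W → List A) (out fin : List A) :
    RunsWithin (machineCode c v₀) (u.length + 1)
      ⟨some (Sum.inr 1), (v₀, o, none), stks (copies y y) (copies u []) wk out fin⟩
      ⟨some (Sum.inl c.entry), (v₀, none, none),
        stks (copies (u.reverse ++ y) (u.reverse ++ y)) (copies [] []) wk out fin⟩ := by
  induction u generalizing y o with
  | nil =>
    refine RunsWithin.step rfl ?_
    simp only [machineCode, stepAux_pop_sh, stepAux_branch, stepAux_goto, update_copies_false]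
    rfl
  | cons a u ih =>
    have h1 : RunsWithin (machineCode c v₀) 1
        ⟨some (Sum.inr 1), (v₀, o, none), stks (copies y y) (copies (a :: u) []) wk out fin⟩
        ⟨some (Sum.inr 1), (v₀, some a, none), stks (copies (a :: y) (a :: y)) (copies u []) wk
          out fin⟩ := by
      refine RunsWithin.step rfl ?_
      simp only [machineCode, stepAux_pop_sh, stepAux_branch, stepAux_goto, stepAux_push_inp,
        update_copies_false, update_copies_true]
      rfl
    rw [List.reverse_cons, List.append_assoc, List.length_cons]
    exact (h1.trans (ih (a :: y) (some a))).mono (by omega)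

theorem runs_write (v : σ) (u y : List A) (o : Option A) (inp sh : Bool → List AI)
    (wk : W → List A) :
    RunsWithin (machineCode c v₀) (u.length + 1)
      ⟨some (Sum.inr 2), (v, none, o), stks inp sh wk u y⟩
      ⟨some (Sum.inr 3), (v, none, none), stks inp sh wk [] (u.reverse ++ y)⟩ := by
  induction u generalizing y o with
  | nil =>
    refine RunsWithin.step rfl ?_
    simp only [machineCode, stepAux_pop_out, stepAux_branch, stepAux_goto]
    rfl
  | cons a u ih =>
    have h1 : RunsWithin (machineCode c v₀) 1
        ⟨some (Sum.inr 2), (v, none, o), stks inp sh wk (a :: u) y⟩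
        ⟨some (Sum.inr 2), (v, none, some a), stks inp sh wk u (a :: y)⟩ := by
      refine RunsWithin.step rfl ?_
      simp only [machineCode, stepAux_pop_out, stepAux_branch, stepAux_goto, stepAux_push_fin]
      rfl
    rw [List.reverse_cons, List.append_assoc, List.length_cons]
    exact (h1.trans (ih (a :: y) (some a))).mono (by omega)

theorem runs_erase (v : σ) (u y : List AI) (o : Option AI) (sh : Bool → List AI)
    (wk : W → List A) (out fin : List A) :
    RunsWithin (machineCode c v₀) (u.length + 1)
      ⟨some (Sum.inr 3), (v, o, none), stks (copies u y) sh wk out fin⟩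
      ⟨some (Sum.inr 4), (v, none, none), stks (copies [] y) sh wk out fin⟩ := by
  induction u generalizing o with
  | nil =>
    refine RunsWithin.step rfl ?_
    simp only [machineCode, stepAux_pop_inp, stepAux_branch, stepAux_goto, update_copies_false]
    rfl
  | cons a u ih =>
    have h1 : RunsWithin (machineCode c v₀) 1
        ⟨some (Sum.inr 3), (v, o, none), stks (copies (a :: u) y) sh wk out fin⟩
        ⟨some (Sum.inr 3), (v, some a, none), stks (copies u y) sh wk out fin⟩ := by
      refine RunsWithin.step rfl ?_
      simp only [machineCode, stepAux_pop_inp, stepAux_branch, stepAux_goto, update_copies_false]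
      rfl
    rw [List.length_cons]
    exact (h1.trans (ih (some a))).mono (by omega)

theorem runs_finish (v : σ) (u : List AI) (o : Option AI) (sh : Bool → List AI)
    (wk : W → List A) (out fin : List A) :
    RunsWithin (machineCode c v₀) (u.length + 1)
      ⟨some (Sum.inr 4), (v, o, none), stks (copies [] u) sh wk out fin⟩
      ⟨none, (v₀, none, none), stks (copies [] []) sh wk out fin⟩ := by
  induction u generalizing o with
  | nil =>
    refine RunsWithin.step rfl ?_
    simp only [machineCode, stepAux_pop_inp, stepAux_branch, stepAux_goto, update_copies_true]
    rfl
  | cons a u ih =>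
    have h1 : RunsWithin (machineCode c v₀) 1
        ⟨some (Sum.inr 4), (v, o, none), stks (copies [] (a :: u)) sh wk out fin⟩
        ⟨some (Sum.inr 4), (v, some a, none), stks (copies [] u) sh wk out fin⟩ := by
      refine RunsWithin.step rfl ?_
      simp only [machineCode, stepAux_pop_inp, stepAux_branch, stepAux_goto, update_copies_true]
      rfl
    rw [List.length_cons]
    exact (h1.trans (ih (some a))).mono (by omega)

/-- Four passes over the input, one run of the program and one pass over the output, which is no
longer than `c.base` allows. The term with `c.rate` vanishes because the work stacks are empty at
the start. -/
theorem runs_machine [Fintype W] (hc : c.WF) (w : List AI)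
    (h : ∀ k, (c.den w ⟨v₀, fun _ => [], []⟩).wk k = []) :
    RunsWithin (machineCode c v₀) (5 * w.length + 5 + 2 * c.base.eval w.length)
      ⟨some (Sum.inr 0), (v₀, none, none),
        stks (copies w []) (copies [] []) (fun _ => []) [] []⟩
      ⟨none, (v₀, none, none), stks (copies [] []) (copies [] []) (fun _ => []) []
        (c.den w ⟨v₀, fun _ => [], []⟩).out.reverse⟩ := by
  have h1 := runs_read c v₀ w [] none (fun _ => []) [] []
  have h2 := runs_copy c v₀ (w.reverse ++ []) [] none (fun _ => []) [] []
  have h3 := c.runsWithin hc (M := machineCode c v₀) (emb := Sum.inl) (exit := Sum.inr 2)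
    (fun l => rfl) w (copies w w) (copies [] []) [] (fun i _ => by cases i <;> exact ⟨rfl, rfl⟩)
    ⟨v₀, fun _ => [], []⟩
  have h4 := runs_write c v₀ (c.den w ⟨v₀, fun _ => [], []⟩).v
    (c.den w ⟨v₀, fun _ => [], []⟩).out [] none (copies w w) (copies [] [])
    (c.den w ⟨v₀, fun _ => [], []⟩).wk
  have h5 := runs_erase c v₀ (c.den w ⟨v₀, fun _ => [], []⟩).v w w none (copies [] [])
    (c.den w ⟨v₀, fun _ => [], []⟩).wk []
    ((c.den w ⟨v₀, fun _ => [], []⟩).out.reverse ++ [])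
  have h6 := runs_finish c v₀ (c.den w ⟨v₀, fun _ => [], []⟩).v w none (copies [] [])
    (c.den w ⟨v₀, fun _ => [], []⟩).wk []
    ((c.den w ⟨v₀, fun _ => [], []⟩).out.reverse ++ [])
  have h7 := c.length_out_den w ⟨v₀, fun _ => [], []⟩
  have h0 : (c.den w ⟨v₀, fun _ => [], []⟩).wk = fun _ => [] := funext h
  simp only [List.append_nil, List.reverse_reverse] at h1 h2 h4 h5 h6
  rw [h0] at h4 h5 h6
  unfold conf at h3
  rw [h0] at h3
  refine (((((h1.trans h2).trans h3).trans h4).trans h5).trans h6).mono ?_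
  simp only [List.length_reverse, size, List.length_nil, Finset.sum_const_zero, mul_zero,
    add_zero, zero_add] at h7 ⊢
  omega

end machine

/-- What a loop program computes is computable in polynomial time. -/
theorem polyTime [Fintype W] [Nontrivial W] [Fintype σ] [Fintype AI] [Fintype A] [Inhabited AI]
    [Inhabited A] {α β : Type} (ea : α → List AI) (eb : β → List A) (F : α → β)
    (c : Cmd W σ AI A) (hc : c.WF) (v₀ : σ)
    (h : ∀ a, (c.den (ea a) ⟨v₀, fun _ => [], []⟩).out = (eb (F a)).reverse) :
    Nonempty (TM2ComputableInPolyTime ea eb F) := by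
  -- A machine has to halt with all stacks empty except for the output.
  let d : Cmd W σ AI A := .seq c (.clearAll Finset.univ.toList)
  refine ⟨{ tm := machine d v₀, inputAlphabet := Equiv.refl _, outputAlphabet := Equiv.refl _,
            time := 5 * Polynomial.X + 5 + 2 * d.base, outputsFun := fun a => ?_ }⟩
  have hd : d.WF := ⟨hc, Cmd.wf_clearAll _⟩
  have hout : (d.den (ea a) ⟨v₀, fun _ => [], []⟩).out = (eb (F a)).reverse := by
    rw [← h a]
    exact (Cmd.den_clearAll _ _ _).1
  have hwk : ∀ k, (d.den (ea a) ⟨v₀, fun _ => [], []⟩).wk k = [] := fun k => by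
    refine ((Cmd.den_clearAll _ _ _).2 k).trans ?_
    simp
  have key := runs_machine d v₀ hd (ea a) hwk
  rw [hout, List.reverse_reverse] at key
  have e1 : initList (machine d v₀) (List.map (Equiv.refl _).invFun (ea a)) =
      ⟨some (Sum.inr 0), (v₀, none, none),
        stks (copies (ea a) []) (copies [] []) (fun _ => []) [] []⟩ := by
    unfold initList
    congr 1
    funext k
    rcases k with ⟨_ | _, _ | _⟩ | k | _ | _ <;> first | rfl | exact List.map_id _
  have e2 : haltList (machine d v₀) (List.map (Equiv.refl _).invFun (eb (F a))) =
      ⟨none, (v₀, none, none),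
        stks (copies [] []) (copies [] []) (fun _ => []) [] (eb (F a))⟩ := by
    unfold haltList
    congr 1
    funext k
    rcases k with ⟨_ | _, _ | _⟩ | k | _ | _ <;> first | rfl | exact List.map_id _
  refine Classical.choice ?_
  obtain ⟨t, ht, hrun⟩ := key
  refine ⟨⟨⟨t, ?_⟩, ?_⟩⟩
  · exact (congrArg (fun x => (flip bind (TM2.step (machineCode d v₀)))^[t] (some x)) e1).trans
      (hrun.trans (congrArg some e2.symm))
  · simpa using ht

end LoopProg

/-! ### The plan of a necklace and its code -/

namespace Necklace

variable (N : Necklace)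

/-- The string that represents the necklace. -/
def code : List Γ' := encUnary N.k ++ encList encUnary N.beads

/-- The length of the string that represents the necklace. -/
def ell : ℕ := N.code.length

theorem length_encUnary (n : ℕ) : (encUnary n).length = n + 1 := by simp [encUnary]

theorem ell_eq : N.ell = N.k + N.beads.sum + N.beads.length + 3 := by
  have h (l : List ℕ) : (l.flatMap encUnary).length = l.sum + l.length := by
    induction l with
    | nil => rfl
    | cons a l ih =>
      simp only [List.flatMap_cons, List.length_append, ih, length_encUnary, List.sum_cons,
        List.length_cons]
      omega
  simp only [ell, code, encList, List.length_append, List.length_cons, length_encUnary, h,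
    List.length_nil]
  omega

/-- As the input is written in unary, the colours, the number of beads and `k + 1` are all below
`ell`. Hence `ell` rounds reach every colour and `ell` binary digits hold every count. -/
theorem color_lt_ell {c : ℕ} (h : c ∈ N.beads) : c < N.ell := by
  have := List.le_sum_of_mem h
  rw [ell_eq]; omega

theorem length_lt_ell : N.beads.length < N.ell := by rw [ell_eq]; omega

theorem k_lt_ell : N.k + 1 < N.ell := by rw [ell_eq]; omega

/-- The length of the edge of a bead of colour `r`. -/
def edgeLen (r : ℕ) : ℕ := N.k * 2 ^ (N.ell * (r + 1))

/-- The load of a tour: the total length of the edges of the beads of one part. -/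
def load : ℕ := ∑ r ∈ Finset.range N.ell, N.beads.count r * 2 ^ (N.ell * (r + 1))

/-- The number of binary digits of the depot distance. -/
def width : ℕ := N.ell * (N.ell + 1) + 1

/-- The length of the depot edge. -/
def depotLen : ℕ := 2 ^ N.width - 1 - N.load

/-- The sum is the numeral in base `2 ^ B` with lowest digit `0` and then the digits `a 0, …, a (n -
1)`, so it lies below the place value of the next digit. -/
theorem sum_blocks_lt {B : ℕ} (a : ℕ → ℕ) (n : ℕ) (h : ∀ r < n, a r < 2 ^ B) :
    ∑ r ∈ Finset.range n, a r * 2 ^ (B * (r + 1)) < 2 ^ (B * (n + 1)) := by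
  induction n with
  | zero => simp
  | succ n ih =>
    rw [Finset.sum_range_succ]
    have h1 := ih fun r hr => h r (by omega)
    have h2 : (a n + 1) * 2 ^ (B * (n + 1)) ≤ 2 ^ B * 2 ^ (B * (n + 1)) :=
      Nat.mul_le_mul_right _ (h n (by omega))
    have h3 : 2 ^ (B * (n + 1 + 1)) = 2 ^ B * 2 ^ (B * (n + 1)) := by
      rw [← pow_add]; congr 1; ring
    rw [h3]
    rw [add_mul, one_mul] at h2
    omega

theorem count_lt (r : ℕ) : N.beads.count r < 2 ^ N.ell :=
  (List.count_le_length.trans_lt N.length_lt_ell).trans Nat.lt_two_pow_self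

theorem load_lt : N.load < 2 ^ (N.width - 1) :=
  sum_blocks_lt _ _ fun r _ => N.count_lt r

/-- This makes `2 ^ (width + 1)`, the bound for a tour, equal to `2 * (depotLen + load + 1)`: the
length of a tour of weight `load` and a slack of `2`, which parity renders harmless. The slack buys
a depot distance that is a mere binary complement. -/
theorem depotLen_add : N.depotLen + N.load + 1 = 2 ^ N.width := by
  have h1 := N.load_lt
  have h2 : 2 ^ (N.width - 1) < 2 ^ N.width :=
    Nat.pow_lt_pow_right (by norm_num) (by unfold width; omega)
  unfold depotLen; omega

theorem depotLen_pos : 0 < N.depotLen := by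
  have h1 := N.load_lt
  have h2 := N.depotLen_add
  have h3 : 2 ^ N.width = 2 * 2 ^ (N.width - 1) := by
    rw [← pow_succ']; congr 1
  have : 0 < 2 ^ (N.width - 1) := by positivity
  omega

theorem edgeLen_pos (r : ℕ) : 0 < N.edgeLen r := Nat.mul_pos N.k_pos (by positivity)

theorem load_pos : 0 < N.load := by
  obtain ⟨c, l, hcl⟩ := List.exists_cons_of_ne_nil N.nonempty
  have hc : c ∈ N.beads := by rw [hcl]; simp
  refine Finset.sum_pos' (fun _ _ => Nat.zero_le _) ⟨c, Finset.mem_range.2 (N.color_lt_ell hc), ?_⟩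
  exact Nat.mul_pos (List.count_pos_iff.2 hc) (by positivity)

/-! The vertices of the star: `0` is the centre, `1` the leaf of length `load`, `2` the depot and
`i + 3` the `i`-th bead. -/

/-- The length of the edge of a leaf. -/
def weight : ℕ → ℕ
  | 0 => 0
  | 1 => N.load
  | 2 => N.depotLen
  | i + 3 => N.edgeLen (N.beads.getD i 0)

/-- The frequency bound of the edge of a leaf. -/
def freqs : ℕ → ℕ
  | 0 => 0
  -- There are at most `k + 1` tours.
  | 2 => N.k + 1
  | _ => 1

/-- The plan of a necklace. -/
def plan : TreePlan where
  n := N.beads.length + 3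
  graph := SimpleGraph.starGraph 0
  isTree := SimpleGraph.isTree_starGraph 0
  depot := 2
  order v := if v = 0 then (List.finRange (N.beads.length + 2)).map Fin.succ else [0]
  order_nodup v := by
    split
    · exact (List.nodup_finRange _).map (Fin.succ_injective _)
    · simp
  mem_order v u := by
    rw [SimpleGraph.starGraph_adj]
    split_ifs with h
    · subst h
      simp only [List.mem_map, List.mem_finRange, true_and, true_or, and_true]
      rw [Fin.exists_succ_eq]
      exact ne_comm
    · simp only [List.mem_singleton]
      constructor
      · rintro rfl; exact ⟨h, Or.inr rfl⟩
      · rintro ⟨_, h' | h'⟩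
        · exact absurd h' h
        · exact h'
  depot_degree := by
    rw [if_neg]
    · rfl
    · intro h
      have := congrArg Fin.val h
      simp [Nat.mod_eq_of_lt] at this
  -- The centre has weight `0`, so the sum is the weight of the leaf.
  len := Sym2.lift ⟨fun a b => N.weight a + N.weight b, fun a b => add_comm _ _⟩
  len_pos e he := by
    have key (u : Fin (N.beads.length + 3)) (hu : u ≠ 0) : 0 < N.weight u := by
      obtain ⟨u, h⟩ := u
      match u, h with
      | 0, _ => exact absurd rfl hu
      | 1, _ => exact N.load_pos
      | 2, _ => exact N.depotLen_pos
      | i + 3, _ => exact N.edgeLen_pos _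
    induction e with
    | _ a b =>
      rw [SimpleGraph.mem_edgeSet, SimpleGraph.starGraph_adj] at he
      simp only [Sym2.lift_mk]
      by_cases ha : a = 0
      · have := key b (fun hb => he.1 (ha.trans hb.symm)); omega
      · have := key a ha; omega
  limits := [[1]]
  limits_ne := by simp
  limits_pos := by simp
  prio _ := 0
  prio_lt := by simp
  freq := Sym2.lift ⟨fun a b => N.freqs a + N.freqs b, fun a b => add_comm _ _⟩
  freq_pos e he := by
    have key (u : Fin (N.beads.length + 3)) (hu : u ≠ 0) : 0 < N.freqs u := by
      obtain ⟨u, h⟩ := u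
      match u, h with
      | 0, _ => exact absurd rfl hu
      | 1, _ => exact Nat.one_pos
      | 2, _ => exact Nat.succ_pos _
      | i + 3, _ => exact Nat.one_pos
    induction e with
    | _ a b =>
      rw [SimpleGraph.mem_edgeSet, SimpleGraph.starGraph_adj] at he
      simp only [Sym2.lift_mk]
      by_cases ha : a = 0
      · have := key b (fun hb => he.1 (ha.trans hb.symm)); omega
      · have := key a ha; omega
  -- Room for `k + 1` tours, each of length `c * L = 2 ^ (width + 1)`.
  L := (N.k + 1) * 2 ^ (N.width + 1)
  c := 1 / (N.k + 1)
  c_pos := by positivity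
  c_le_one := by
    rw [div_le_one (by positivity)]
    have : (0 : ℚ) ≤ N.k := Nat.cast_nonneg _
    linarith

/-- Up to the common factor `k`, a numeral whose digits are all `n < 2 ^ ell` is compared with the
next place value. -/
theorem sum_edgeLen_lt (r : ℕ) : N.n * ∑ q ∈ Finset.range r, N.edgeLen q < N.edgeLen r := by
  have hn : N.n < 2 ^ N.ell :=
    ((Nat.div_le_self _ _).trans_lt N.length_lt_ell).trans Nat.lt_two_pow_self
  have h := sum_blocks_lt (B := N.ell) (fun _ => N.n) r fun _ _ => hn
  rcases Nat.eq_zero_or_pos N.n with h0 | h0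
  · rw [h0, zero_mul]; exact N.edgeLen_pos r
  · unfold edgeLen
    rw [← Finset.mul_sum, Finset.mul_sum, Finset.mul_sum] at *
    refine lt_of_eq_of_lt ?_ (Nat.mul_lt_mul_of_pos_left h N.k_pos)
    rw [Finset.mul_sum]
    exact Finset.sum_congr rfl fun q _ => by ring

/-! ### The representation of the plan -/

/-- The end of the entry of a bead in the list of the neighbours of a vertex. -/
def entryTail (c : ℕ) : List Γ' :=
  encBinary (N.edgeLen c) ++ [Γ'.comma, Γ'.bit true, Γ'.comma]

/-- Passes from the enumeration of the beads by index to a recursion over the list of colours, which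
is how the writing program meets them. -/
theorem flatMap_finRange_getD {α : Type} (F : ℕ → ℕ → List α) (l : List ℕ) :
    (List.finRange l.length).flatMap (fun i => F i.val (l.getD i.val 0)) = (l.mapIdx F).flatten := by
  induction l generalizing F with
  | nil => rfl
  | cons a l ih =>
    rw [List.mapIdx_cons, List.flatten_cons, ← ih]
    simp only [List.length_cons, List.finRange_succ, List.flatMap_cons, List.flatMap_map]
    rfl

theorem encBinary_one : encBinary 1 = [Γ'.bit true, Γ'.comma] := rfl

theorem encRat_inv_succ (k : ℕ) :
    encRat (1 / ((k : ℚ) + 1)) = [Γ'.bit true, Γ'.comma] ++ encBinary (k + 1) := by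
  have h : (1 / ((k : ℚ) + 1)) = ((k + 1 : ℕ) : ℚ)⁻¹ := by push_cast; rw [one_div]
  unfold encRat
  rw [h, Rat.inv_natCast_num_of_pos (Nat.succ_pos k), Rat.inv_natCast_den_of_pos (Nat.succ_pos k)]
  rfl

theorem encRat_one : encRat 1 = [Γ'.bit true, Γ'.comma, Γ'.bit true, Γ'.comma] := rfl

/-- The entry of a neighbour `u` of the vertex `v`. -/
def entry (v u : ℕ) : List Γ' :=
  encUnary u ++ encBinary (N.weight v + N.weight u) ++ [Γ'.comma] ++
    encBinary (N.freqs v + N.freqs u)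

theorem order_zero : N.plan.order (0 : Fin (N.beads.length + 3)) =
    (List.finRange (N.beads.length + 2)).map Fin.succ :=
  if_pos (c := (0 : Fin (N.beads.length + 3)) = 0) (e := [0]) rfl

theorem order_succ (v : Fin (N.beads.length + 2)) :
    N.plan.order (v.succ : Fin (N.beads.length + 3)) = [(0 : Fin (N.beads.length + 3))] :=
  if_neg (c := (v.succ : Fin (N.beads.length + 3)) = 0)
    (t := (List.finRange (N.beads.length + 2)).map Fin.succ) (Fin.succ_ne_zero v)

theorem encode_eq_entries : N.plan.encode =
    encUnary 2 ++ encList (fun v : Fin (N.beads.length + 3) =>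
      encList (fun u : Fin (N.beads.length + 3) => N.entry v u) (N.plan.order v))
      (List.finRange (N.beads.length + 3)) ++
    encList (encList encRat) [[1]] ++ encBinary ((N.k + 1) * 2 ^ (N.width + 1)) ++
    encRat (1 / ((N.k : ℚ) + 1)) := by
  have h2 : (2 : Fin (N.beads.length + 3)).val = 2 := by
    exact Nat.mod_eq_of_lt (show 2 < N.beads.length + 3 by omega)
  have h0 : N.plan.depot.val = 2 := h2
  unfold TreePlan.encode
  rw [h0]
  rfl

/-- The code is spelled out as constant strings, a few binary numbers and two blocks per bead, one
from the list of the centre and one from that of the leaf. `den_writePlan` matches the output of the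
program with this form. -/
theorem encode_plan : N.plan.encode =
    encUnary 2 ++ [Γ'.bra] ++
      ([Γ'.bra] ++ (encUnary 1 ++ (encBinary N.load ++ [Γ'.comma, Γ'.bit true, Γ'.comma])) ++
        (encUnary 2 ++ (encBinary N.depotLen ++ [Γ'.comma] ++ encBinary (N.k + 1))) ++
        (N.beads.mapIdx fun i c => encUnary (i + 3) ++ N.entryTail c).flatten ++ [Γ'.ket]) ++
      ([Γ'.bra, Γ'.comma] ++ encBinary N.load ++ [Γ'.comma, Γ'.bit true, Γ'.comma, Γ'.ket]) ++
      ([Γ'.bra, Γ'.comma] ++ encBinary N.depotLen ++ [Γ'.comma] ++ encBinary (N.k + 1) ++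
        [Γ'.ket]) ++
      (N.beads.mapIdx fun _ c => [Γ'.bra, Γ'.comma] ++ N.entryTail c ++ [Γ'.ket]).flatten ++
      [Γ'.ket] ++
      [Γ'.bra, Γ'.bra, Γ'.bit true, Γ'.comma, Γ'.bit true, Γ'.comma, Γ'.ket, Γ'.ket] ++
      encBinary ((N.k + 1) * 2 ^ (N.width + 1)) ++
      [Γ'.bit true, Γ'.comma] ++ encBinary (N.k + 1) := by
  have e1 : N.weight 0 = 0 := rfl
  have e2 : N.freqs 0 = 0 := rfl
  have e3 : N.weight 1 = N.load := rfl
  have e4 : N.freqs 1 = 1 := rfl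
  have e5 : N.weight 2 = N.depotLen := rfl
  have e6 : N.freqs 2 = N.k + 1 := rfl
  have e7 (i : ℕ) : N.weight (i + 3) = N.edgeLen (N.beads.getD i 0) := rfl
  have e8 (i : ℕ) : N.freqs (i + 3) = 1 := rfl
  have e9 : encUnary 0 = [Γ'.comma] := rfl
  have key1 := flatMap_finRange_getD (fun i c => encUnary (i + 3) ++ N.entryTail c) N.beads
  have key2 := flatMap_finRange_getD
    (fun _ c => [Γ'.bra, Γ'.comma] ++ N.entryTail c ++ [Γ'.ket]) N.beads
  rw [← key1, ← key2, encode_eq_entries, encRat_inv_succ, encList, encList, List.finRange_succ,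
    List.flatMap_cons, List.flatMap_map]
  simp only [order_succ, order_zero]
  rw [encList, List.flatMap_map, List.finRange_succ, List.finRange_succ]
  simp only [List.flatMap_cons, List.flatMap_map, encList, entry, Fin.val_zero, Fin.val_succ, e1, e2,
    List.flatMap_nil, encRat_one, zero_add, e3, e4, e5, e6, e7, e8, e9, List.append_nil, add_zero,
    encBinary_one, entryTail, List.append_assoc, List.cons_append, List.nil_append, Nat.reduceAdd,
    add_assoc]

end Necklace

/-! ### Binary digits -/

/-- The `n` lowest binary digits of `v`, the lowest first. -/
def digits : ℕ → ℕ → List Bool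
  | 0, _ => []
  | n + 1, v => decide (v % 2 = 1) :: digits n (v / 2)

theorem digits_zero (n : ℕ) : digits n 0 = List.replicate n false := by
  induction n with
  | zero => rfl
  | succ n ih => simp [digits, ih, List.replicate_succ]

theorem digits_add_mul (n v u : ℕ) : digits n (v + 2 ^ n * u) = digits n v := by
  induction n generalizing v with
  | zero => rfl
  | succ n ih =>
    have h1 : (v + 2 ^ (n + 1) * u) % 2 = v % 2 := by
      rw [pow_succ', mul_assoc, Nat.add_mul_mod_self_left]
    have h2 : (v + 2 ^ (n + 1) * u) / 2 = v / 2 + 2 ^ n * u := by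
      rw [pow_succ', mul_assoc, Nat.add_mul_div_left _ _ (by norm_num)]
    simp only [digits, h1, h2, ih]

theorem digits_add (n m v : ℕ) : digits (n + m) v = digits n v ++ digits m (v / 2 ^ n) := by
  induction n generalizing v with
  | zero => simp [digits]
  | succ n ih =>
    have h : n + 1 + m = (n + m) + 1 := by omega
    rw [h, digits, digits, ih, List.cons_append, Nat.div_div_eq_div_mul, pow_succ']

theorem digits_append {n v : ℕ} (h : v < 2 ^ n) (m u : ℕ) :
    digits n v ++ digits m u = digits (n + m) (v + 2 ^ n * u) := by
  rw [digits_add, digits_add_mul, Nat.add_mul_div_left _ _ (by positivity), Nat.div_eq_of_lt h,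
    zero_add]

/-- All `n` digits of `2 ^ n - 1` are ones, so the subtraction never borrows. -/
theorem digits_compl {n v : ℕ} (h : v < 2 ^ n) :
    digits n (2 ^ n - 1 - v) = (digits n v).map not := by
  induction n generalizing v with
  | zero => rfl
  | succ n ih =>
    rw [pow_succ'] at *
    have h1 := ih (v := v / 2) (by omega)
    have h2 : (2 * 2 ^ n - 1 - v) / 2 = 2 ^ n - 1 - v / 2 := by omega
    rw [digits, digits, h2, h1, List.map_cons]
    congr 1
    have h3 : (2 * 2 ^ n - 1 - v) % 2 = 1 ↔ ¬ v % 2 = 1 := by omega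
    simp only [h3, decide_not]

/-- The excluded case is the number `0`, whose code is empty. -/
theorem encodeNat_bit (b : Bool) (v : ℕ) (h : b = true ∨ v ≠ 0) :
    encodeNat (Nat.bit b v) = b :: encodeNat v := by
  unfold encodeNat
  rw [← Num.ofNat'_eq, ← Num.ofNat'_eq, Num.ofNat'_bit]
  have h0 : v ≠ 0 → Num.ofNat' v ≠ 0 := by
    intro hv h
    apply hv
    rw [Num.ofNat'_eq] at h
    exact_mod_cast congrArg (fun x : Num => (x : ℕ)) h
  cases hv : Num.ofNat' v with
  | zero =>
    have : v = 0 := by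
      by_contra hne
      exact h0 hne hv
    have hb : b = true := h.resolve_right (fun h' => h' this)
    subst hb
    rfl
  | pos p => cases b <;> rfl

/-- `encodeNat` lists the lowest digit first, so leading zeros stand at the end of the list. -/
theorem encodeNat_eq_rdropWhile {n v : ℕ} (h : v < 2 ^ n) :
    encodeNat v = (digits n v).rdropWhile (fun b => !b) := by
  induction n generalizing v with
  | zero =>
    have : v = 0 := by simpa using h
    subst this; rfl
  | succ n ih =>
    rw [pow_succ'] at h
    have h1 := ih (v := v / 2) (by omega)
    unfold List.rdropWhile at *
    rw [digits, List.reverse_cons, List.dropWhile_append]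
    rcases Nat.eq_zero_or_pos v with hv | hv
    · subst hv
      have h2 : encodeNat (0 / 2) = [] := rfl
      rw [h2] at h1
      have h3 := List.reverse_eq_nil_iff.1 h1.symm
      rw [h3]; rfl
    · have hb : v = Nat.bit (decide (v % 2 = 1)) (v / 2) := by
        rw [Nat.bit_val]
        by_cases hm : v % 2 = 1 <;> simp only [hm, decide_true, decide_false, Bool.toNat_true, Bool.toNat_false] <;> omega
      have hne : decide (v % 2 = 1) = true ∨ v / 2 ≠ 0 := by
        rw [decide_eq_true_iff]; omega
      conv_lhs => rw [hb]
      rw [encodeNat_bit _ _ hne, h1]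
      by_cases h4 : List.dropWhile (fun b => !b) (digits n (v / 2)).reverse = []
      · rw [h4] at h1 ⊢
        have : v / 2 = 0 := by
          by_contra hv2
          have h5 : encodeNat (v / 2) ≠ [] := by
            intro h6
            have := congrArg decodeNat h6
            rw [decode_encodeNat] at this
            exact hv2 this
          exact h5 h1
        have hm : v % 2 = 1 := by omega
        simp [hm]
      · rw [if_neg (by simpa using h4)]
        simp

theorem encodeNat_eq_digits {n v : ℕ} (h : v < 2 ^ (n + 1)) (h' : 2 ^ n ≤ v) :
    encodeNat v = digits (n + 1) v := by
  have h1 : v / 2 ^ n = 1 := by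
    rw [Nat.div_eq_iff (by positivity)]
    rw [pow_succ] at h
    omega
  have h2 : digits 1 (v / 2 ^ n) = [true] := by rw [h1]; rfl
  rw [encodeNat_eq_rdropWhile h, digits_add, h2, List.rdropWhile_concat_neg _ _ _ (by simp)]

theorem encodeNat_mul_two_pow {v : ℕ} (h : 0 < v) (p : ℕ) :
    encodeNat (v * 2 ^ p) = List.replicate p false ++ encodeNat v := by
  induction p with
  | zero => simp
  | succ p ih =>
    have : v * 2 ^ (p + 1) = Nat.bit false (v * 2 ^ p) := by
      rw [Nat.bit_val]; simp only [Bool.toNat_false]; ring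
    rw [this, encodeNat_bit _ _ (Or.inr (by positivity)), ih, List.replicate_succ, List.cons_append]

/-! ### Binary digits of the load and of the depot distance -/

namespace Necklace

variable (N : Necklace)

/-- The part of the load that is due to the colours below `j`. -/
def partialLoad (j : ℕ) : ℕ := ∑ r ∈ Finset.range j, N.beads.count r * 2 ^ (N.ell * (r + 1))

/-- There are no carries: colour `j` contributes a separate block of `ell` digits. One round of the
loop over the colours in `prepare` writes this block. -/
theorem digits_partialLoad_succ (j : ℕ) :
    digits (N.ell * (j + 2)) (N.partialLoad (j + 1)) =
      digits (N.ell * (j + 1)) (N.partialLoad j) ++ digits N.ell (N.beads.count j) := by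
  unfold partialLoad
  rw [Finset.sum_range_succ, mul_comm (N.beads.count j),
    digits_append (sum_blocks_lt _ _ fun r _ => N.count_lt r)]
  rfl

/-- The additional digit provided by `width` is `0` in the load and hence `1` in the complement, so
no leading zeros have to be removed. -/
theorem encodeNat_depotLen :
    encodeNat N.depotLen = (digits (N.width - 1) N.load).map not ++ [true] := by
  have h1 := N.load_lt
  have h3 : 2 ^ N.width = 2 * 2 ^ (N.width - 1) := by
    rw [← pow_succ']; congr 1
  have h4 : 2 ^ (N.width - 1) ≤ N.depotLen := by unfold depotLen; omega
  have h5 : N.depotLen < 2 ^ (N.width - 1 + 1) := by unfold depotLen; rw [pow_succ']; omega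
  have h6 : N.width = N.width - 1 + 1 := rfl
  rw [encodeNat_eq_digits h5 h4]
  unfold depotLen
  rw [show digits (N.width - 1 + 1) (2 ^ N.width - 1 - N.load) =
    (digits (N.width - 1 + 1) N.load).map not from digits_compl (by omega), digits_add,
    Nat.div_eq_of_lt h1]
  simp [digits]

end Necklace

/-! ### The program that writes the plan of a necklace -/

namespace LoopProg

open Function

namespace Cmd

variable {W σ AI A : Type} [DecidableEq W]

/-- Move the contents of `k` to `k'`, in reverse order. -/
def move (k k' : W) : Cmd W σ AI A :=
  drain k k' k' (fun v _ => v) (fun _ a => some (true, a)) (fun _ _ => none)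

/-- Move the contents of `k` to `k'`, in reverse order, and write them. -/
def moveOut (k k' : W) : Cmd W σ AI A :=
  drain k k' k' (fun v _ => v) (fun _ a => some (true, a)) (fun _ a => some a)

/-- Write the contents of `k`, with the help of the empty stack `k'`. -/
def print (k k' : W) : Cmd W σ AI A := seq (moveOut k k') (move k' k)

/-- Write a string. -/
def emits : List A → Cmd W σ AI A
  | [] => load id
  | a :: l => seq (emit fun _ => a) (emits l)

theorem den_move (w : List AI) {k k' : W} (s : St W σ A) :
    (move k k').den w s =
      { s with wk := update (update s.wk k []) k' ((s.wk k).reverse ++ update s.wk k [] k') } := by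
  have h (l : List A) (s : St W σ A) : l.foldl (drainStep k' k' (fun v _ => v)
      (fun _ a => some (true, a)) (fun _ _ => none)) s =
      { s with wk := update s.wk k' (l.reverse ++ s.wk k') } := by
    induction l generalizing s with
    | nil => simp
    | cons a l ih => rw [List.foldl_cons, ih]; simp [drainStep]
  exact h _ _

theorem den_moveOut (w : List AI) {k k' : W} (s : St W σ A) :
    (moveOut k k').den w s =
      { s with
        wk := update (update s.wk k []) k' ((s.wk k).reverse ++ update s.wk k [] k')
        out := (s.wk k).reverse ++ s.out } := by
  have h (l : List A) (s : St W σ A) : l.foldl (drainStep k' k' (fun v _ => v)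
      (fun _ a => some (true, a)) (fun _ a => some a)) s =
      { s with
        wk := update s.wk k' (l.reverse ++ s.wk k')
        out := l.reverse ++ s.out } := by
    induction l generalizing s with
    | nil => simp
    | cons a l ih => rw [List.foldl_cons, ih]; simp [drainStep]
  exact h _ _

/-- The second move undoes the reversal of the first, so a number can be printed repeatedly. -/
theorem den_print (w : List AI) {k k' : W} (hk : k' ≠ k) (s : St W σ A) (hs : s.wk k' = []) :
    (print k k').den w s = { s with out := (s.wk k).reverse ++ s.out } := by
  simp only [print, den, den_moveOut, den_move]
  congr 1
  funext j
  by_cases h1 : j = k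
  · subst h1; simp [hk, hk.symm, hs]
  · by_cases h2 : j = k'
    · subst h2; simp [h1, hs]
    · simp [h1, h2]

theorem den_emits (w : List AI) (l : List A) (s : St W σ A) :
    (emits l).den w s = { s with out := l.reverse ++ s.out } := by
  induction l generalizing s with
  | nil => rfl
  | cons a l ih => simp [emits, den, ih]

theorem wf_emits (l : List A) : (emits l : Cmd W σ AI A).WF := by
  induction l with
  | nil => trivial
  | cons a l ih => exact ⟨trivial, ih⟩

theorem not_uses_emits (l : List A) (i : Bool) : ¬ (emits l : Cmd W σ AI A).uses i := by
  induction l with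
  | nil => exact id
  | cons a l ih => rintro (h | h); exacts [h, ih h]

/-- Repeat a command once for every symbol of the input. -/
def rep (i : Bool) (c : Cmd W σ AI A) : Cmd W σ AI A := forIn i (fun v _ => v) c

theorem den_rep (w : List AI) (i : Bool) (c : Cmd W σ AI A) (s : St W σ A) :
    (rep i c).den w s = (c.den w)^[w.length] s := List.foldl_const _ _ _

end Cmd

end LoopProg

namespace PlanWriter

open LoopProg LoopProg.Cmd Function

/-- The work stacks: the numbers `k` and `k + 1` in unary (`kt`, `k1`), a unary counter `ct`, an
auxiliary stack `tm`, the beads (`bw`, `b2`), binary digits under construction (`wd`, `dd`), and the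
binary numbers `k`, `k + 1`, the load and the depot distance (`kb`, `k1b`, `wb`, `db`), and the
number of the next bead in unary (`ix`). -/
inductive Name
  | kt | k1 | ct | tm | bw | b2 | wd | dd | kb | k1b | wb | db | ix
  deriving DecidableEq

instance : Fintype Name :=
  ⟨{.kt, .k1, .ct, .tm, .bw, .b2, .wd, .dd, .kb, .k1b, .wb, .db, .ix}, fun x => by
    cases x <;> decide⟩

instance : Nontrivial Name := ⟨.kt, .k1, by decide⟩

/-- The contents of the work stacks. -/
structure Stacks where
  kt : List Γ' := []
  k1 : List Γ' := []
  ct : List Γ' := []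
  tm : List Γ' := []
  bw : List Γ' := []
  b2 : List Γ' := []
  wd : List Γ' := []
  dd : List Γ' := []
  kb : List Γ' := []
  k1b : List Γ' := []
  wb : List Γ' := []
  db : List Γ' := []
  ix : List Γ' := []

/-- The contents of a work stack. -/
def Stacks.get (S : Stacks) : Name → List Γ'
  | .kt => S.kt | .k1 => S.k1 | .ct => S.ct | .tm => S.tm | .bw => S.bw | .b2 => S.b2
  | .wd => S.wd | .dd => S.dd | .kb => S.kb | .k1b => S.k1b | .wb => S.wb | .db => S.db
  | .ix => S.ix

/-- Change the contents of a work stack. -/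
def Stacks.set (S : Stacks) (l : List Γ') : Name → Stacks
  | .kt => { S with kt := l } | .k1 => { S with k1 := l } | .ct => { S with ct := l }
  | .tm => { S with tm := l } | .bw => { S with bw := l } | .b2 => { S with b2 := l }
  | .wd => { S with wd := l } | .dd => { S with dd := l } | .kb => { S with kb := l }
  | .k1b => { S with k1b := l } | .wb => { S with wb := l } | .db => { S with db := l }
  | .ix => { S with ix := l }

/-- Function updates become updates of record fields, which `simp` evaluates. -/
theorem update_get (S : Stacks) (k : Name) (l : List Γ') : update S.get k l = (S.set l k).get := by
  funext j
  by_cases h : j = k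
  · subst h; rw [update_self]; cases j <;> rfl
  · rw [update_of_ne h]; cases k <;> cases j <;> first | rfl | exact absurd rfl h

/-- The control states: a phase, a flag and a symbol. -/
abbrev Ctl : Type := Fin 4 × Bool × Γ'

/-- The programs of this section. -/
abbrev Prog : Type := Cmd Name Ctl Γ' Γ'

/-- The state with given contents of the work stacks and given output. -/
def mk (v : Ctl) (S : Stacks) (X : List Γ') : St Name Ctl Γ' := ⟨v, S.get, X.reverse⟩

variable (w : List Γ') (v : Ctl) (S : Stacks) (X : List Γ')

theorem den_seq (a b : Prog) (s : St Name Ctl Γ') : (seq a b).den w s = b.den w (a.den w s) := rfl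

theorem den_push (k : Name) (f : Ctl → Γ') :
    (push k f : Prog).den w (mk v S X) = mk v (S.set (f v :: S.get k) k) X := by
  simp [den, mk, update_get]

theorem den_load (f : Ctl → Ctl) : (load f : Prog).den w (mk v S X) = mk (f v) S X := rfl

theorem den_emits (l : List Γ') : (emits l : Prog).den w (mk v S X) = mk v S (X ++ l) := by
  simp [Cmd.den_emits, mk]

theorem den_emit (f : Ctl → Γ') : (emit f : Prog).den w (mk v S X) = mk v S (X ++ [f v]) := by
  simp [den, mk]

theorem den_move (k k' : Name) :
    (move k k' : Prog).den w (mk v S X) =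
      mk v ((S.set [] k).set ((S.get k).reverse ++ (S.set [] k).get k') k') X := by
  simp [Cmd.den_move, mk, update_get]

theorem den_print (k : Name) (hk : .tm ≠ k) (h : S.tm = []) :
    (print k .tm : Prog).den w (mk v S X) = mk v S (X ++ S.get k) := by
  rw [Cmd.den_print w hk _ h]
  simp [mk]

theorem den_drain (k k₁ k₂ : Name) (f : Ctl → Γ' → Ctl) (g : Ctl → Γ' → Option (Bool × Γ'))
    (e : Ctl → Γ' → Option Γ') :
    (drain k k₁ k₂ f g e : Prog).den w (mk v S X) =
      (S.get k).foldl (drainStep k₁ k₂ f g e) (mk v (S.set [] k) X) := by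
  simp [den, mk, update_get]

/-- The tick of unary numbers. -/
abbrev one : Γ' := Γ'.bit true

/-- Halve the unary counter; the flag becomes its parity. -/
def halve : Prog :=
  seq (drain .ct .tm .tm (fun v _ => (v.1, !v.2.1, v.2.2))
    (fun v _ => if v.2.1 then some (true, one) else none) (fun _ _ => none)) (move .tm .ct)

/-- A tick is kept whenever it completes a pair; the flag, toggled by each tick, ends as the parity.
-/
theorem den_halve (n : ℕ) (hc : S.ct = List.replicate n one) (ht : S.tm = []) (ph : Fin 4)
    (y : Γ') :
    halve.den w (mk (ph, false, y) S X) =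
      mk (ph, decide (n % 2 = 1), y) { S with ct := List.replicate (n / 2) one } X := by
  have key (n : ℕ) (b : Bool) (S : Stacks) (j : ℕ) (hj : S.tm = List.replicate j one) :
      (List.replicate n one).foldl (drainStep .tm .tm (fun v _ => (v.1, !v.2.1, v.2.2))
        (fun v _ => if v.2.1 then some (true, one) else none) (fun _ _ => none))
        (mk (ph, b, y) S X) =
      mk (ph, xor b (decide (n % 2 = 1)), y)
        { S with tm := List.replicate (j + (n + b.toNat) / 2) one } X := by
    induction n generalizing b S j with
    | zero => cases b <;> simp [← hj]
    | succ n ih =>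
      rw [List.replicate_succ, List.foldl_cons]
      cases b
      · have e : drainStep .tm .tm (fun v _ => (v.1, !v.2.1, v.2.2))
            (fun v _ => if v.2.1 then some (true, one) else none) (fun _ _ => none)
            (mk (ph, false, y) S X) one = mk (ph, true, y) S X := by simp [drainStep, mk]
        rw [e, ih true S j hj]
        have h2 : (true ^^ decide (n % 2 = 1)) = (false ^^ decide ((n + 1) % 2 = 1)) := by
          rcases Nat.mod_two_eq_zero_or_one n with h | h <;> simp [h, Nat.add_mod]
        rw [h2]; simp
      · have e : drainStep .tm .tm (fun v _ => (v.1, !v.2.1, v.2.2))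
            (fun v _ => if v.2.1 then some (true, one) else none) (fun _ _ => none)
            (mk (ph, true, y) S X) one =
              mk (ph, false, y) { S with tm := one :: S.tm } X := by
          simp [drainStep, mk, update_get, Stacks.set, Stacks.get]
        rw [e, ih false _ (j + 1) (by simp [hj, List.replicate_succ])]
        have h2 : (false ^^ decide (n % 2 = 1)) = (true ^^ decide ((n + 1) % 2 = 1)) := by
          rcases Nat.mod_two_eq_zero_or_one n with h | h <;> simp [h, Nat.add_mod]
        rw [h2]
        have h3 : j + 1 + (n + false.toNat) / 2 = j + (n + 1 + true.toNat) / 2 := by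
          simp only [Bool.toNat_false, Bool.toNat_true, add_zero]
          omega
        rw [h3]
  have h1 := key n false { S with ct := [] } 0 ht
  have e : S.get .ct = List.replicate n one := hc
  unfold halve
  rw [den, den_drain, e]
  simp only [Stacks.set]
  rw [h1, den_move]
  simp [Stacks.set, Stacks.get, ht]

/-- Convert the unary counter into binary digits, on `wd`; the complement is stored on `dd`. -/
def binarize : Prog :=
  rep false <| seq halve <| seq (push .wd fun v => Γ'.bit v.2.1) <|
    seq (push .dd fun v => Γ'.bit !v.2.1) <| load fun v => (v.1, false, v.2.2)

/-- Each round splits off the lowest digit. The number of rounds is the length of the input, so all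
numbers get equally many digits, with the highest one on top of the stack. -/
theorem den_binarize (n : ℕ) (hc : S.ct = List.replicate n one) (ht : S.tm = []) (ph : Fin 4)
    (y : Γ') :
    binarize.den w (mk (ph, false, y) S X) =
      mk (ph, false, y) { S with
        ct := List.replicate (n / 2 ^ w.length) one
        wd := ((digits w.length n).map Γ'.bit).reverse ++ S.wd
        dd := ((digits w.length n).map fun b => Γ'.bit !b).reverse ++ S.dd } X := by
  unfold binarize
  rw [den_rep]
  generalize w.length = l
  induction l generalizing n S with
  | zero => simp [digits, ← hc]
  | succ l ih =>
    rw [iterate_succ_apply]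
    simp only [den_seq]
    rw [den_halve w S X n hc ht]
    simp only [den_push, den_load, Stacks.set, Stacks.get]
    rw [ih _ (n / 2)]
    · simp [digits, Nat.div_div_eq_div_mul, pow_succ']
    · rfl
    · exact ht

/-- Move the digits on `k` to `k'` and omit the leading zeros. -/
def strip (k k' : Name) : Prog :=
  seq (drain k k' k' (fun v a => (v.1, v.2.1 || decide (a = one), v.2.2))
    (fun v a => if v.2.1 || decide (a = one) then some (true, a) else none) (fun _ _ => none)) <|
    load fun v => (v.1, false, v.2.2)

/-- The pass meets the highest digits first, and the flag records that a `1` has been seen. Moving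
turns the rest over, which puts the lowest digit on top, as in `encodeNat`. -/
theorem den_strip (k k' : Name) (hk : k' ≠ k) (l : List Bool) (hl : S.get k = l.map Γ'.bit)
    (h' : S.get k' = []) (ph : Fin 4) (y : Γ') :
    (strip k k').den w (mk (ph, false, y) S X) =
      mk (ph, false, y) ((S.set [] k).set ((l.dropWhile (fun b => !b)).map Γ'.bit).reverse k') X := by
  have key (l : List Bool) (b : Bool) (s : Name → List Γ') :
      (l.map Γ'.bit).foldl (drainStep k' k' (fun v a => (v.1, v.2.1 || decide (a = one), v.2.2))
        (fun v a => if v.2.1 || decide (a = one) then some (true, a) else none)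
        (fun _ _ => none)) ⟨((ph, b, y) : Ctl), s, X.reverse⟩ =
      ⟨(ph, b || l.any id, y), update s k'
        (((if b then l else l.dropWhile (fun b => !b)).map Γ'.bit).reverse ++ s k'), X.reverse⟩ := by
    induction l generalizing b s with
    | nil => cases b <;> simp
    | cons a l ih =>
      have e : drainStep k' k' (fun v a => (v.1, v.2.1 || decide (a = one), v.2.2))
          (fun v a => if v.2.1 || decide (a = one) then some (true, a) else none)
          (fun _ _ => none) ⟨((ph, b, y) : Ctl), s, X.reverse⟩ (Γ'.bit a) =
          ⟨(ph, b || a, y), if b || a then update s k' (Γ'.bit a :: s k') else s, X.reverse⟩ := by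
        cases b <;> cases a <;> simp [drainStep]
      rw [List.map_cons, List.foldl_cons, e, ih]
      cases b <;> cases a <;> simp
  have e : (S.set [] k).get k' = [] := by
    rw [← update_get, update_of_ne hk, h']
  have h1 := key l false (S.set [] k).get
  unfold strip
  rw [den_seq, den_drain, hl]
  unfold mk
  rw [h1, e, List.append_nil, update_get]
  rfl

/-- The string of the colours. -/
def colours (l : List ℕ) : List Γ' := l.flatMap encUnary

/-- Remove the beads of colour `0` and decrease all other colours by one. -/
def lower (l : List ℕ) : List ℕ := (l.filter (· ≠ 0)).map (· - 1)

theorem count_lower (l : List ℕ) (j : ℕ) : (lower l).count j = l.count (j + 1) := by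
  induction l with
  | nil => rfl
  | cons a l ih =>
    cases a with
    | zero => simpa [lower] using ih
    | succ a => simpa [lower, List.count_cons] using ih

/-- It lets a program that counts and removes colour `0` treat all colours in turn. -/
theorem count_iterate_lower (l : List ℕ) (r : ℕ) : (lower^[r] l).count 0 = l.count r := by
  induction r generalizing l with
  | zero => rfl
  | succ r ih => rw [iterate_succ_apply, ih, count_lower]

/-- Remove the beads of colour `0` from the string on `bw`, count them on `ct`, and decrease all
other colours by one. -/
def lowerAll : Prog :=
  seq (load fun v => (v.1, true, v.2.2)) <|
    seq (drain .bw .b2 .ct (fun v a => (v.1, decide (a = Γ'.comma), v.2.2))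
      (fun v a => if v.2.1 then (if a = Γ'.comma then some (false, one) else none) else some (true, a))
      (fun _ _ => none)) <|
    seq (load fun v => (v.1, false, v.2.2)) <| move .b2 .bw

/-- The flag marks the beginning of a colour. A comma found there is a bead of colour `0` and
becomes a tick of the counter; a tick found there is dropped, which lowers the colour. -/
theorem den_lowerAll (l : List ℕ) (hl : S.bw = colours l) (hc : S.ct = []) (hb : S.b2 = [])
    (ph : Fin 4) (b : Bool) (y : Γ') :
    lowerAll.den w (mk (ph, b, y) S X) =
      mk (ph, false, y) { S with
        bw := colours (lower l)
        ct := List.replicate (l.count 0) one } X := by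
  have key1 (c : ℕ) (S : Stacks) :
      (encUnary c).foldl (drainStep .b2 .ct (fun v a => (v.1, decide (a = Γ'.comma), v.2.2))
        (fun v a => if v.2.1 then (if a = Γ'.comma then some (false, one) else none) else some (true, a))
        (fun _ _ => none)) (mk (ph, false, y) S X) =
      mk (ph, true, y) { S with b2 := (encUnary c).reverse ++ S.b2 } X := by
    induction c generalizing S with
    | zero => simp [encUnary, drainStep, mk, update_get, Stacks.get, Stacks.set]
    | succ c ih =>
      have e : encUnary (c + 1) = one :: encUnary c := rfl
      have e' : drainStep .b2 .ct (fun v a => (v.1, decide (a = Γ'.comma), v.2.2))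
        (fun v a => if v.2.1 then (if a = Γ'.comma then some (false, one) else none) else some (true, a))
        (fun _ _ => none) (mk (ph, false, y) S X) one =
        mk (ph, false, y) { S with b2 := one :: S.b2 } X := by
        simp [drainStep, mk, update_get, Stacks.get, Stacks.set]
      rw [e, List.foldl_cons, e', ih]
      simp
  have key2 (l : List ℕ) (S : Stacks) (n : ℕ) (hn : S.ct = List.replicate n one) :
      (colours l).foldl (drainStep .b2 .ct (fun v a => (v.1, decide (a = Γ'.comma), v.2.2))
        (fun v a => if v.2.1 then (if a = Γ'.comma then some (false, one) else none) else some (true, a))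
        (fun _ _ => none)) (mk (ph, true, y) S X) =
      mk (ph, true, y) { S with
        b2 := (colours (lower l)).reverse ++ S.b2
        ct := List.replicate (l.count 0 + n) one } X := by
    induction l generalizing S n with
    | nil => simp [colours, lower, ← hn]
    | cons c l ih =>
      have e : colours (c :: l) = encUnary c ++ colours l := rfl
      rw [e, List.foldl_append]
      cases c with
      | zero =>
        have e1 : encUnary 0 = [Γ'.comma] := rfl
        have e2 : drainStep .b2 .ct (fun v a => (v.1, decide (a = Γ'.comma), v.2.2))
          (fun v a => if v.2.1 then (if a = Γ'.comma then some (false, one) else none) else some (true, a))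
          (fun _ _ => none) (mk (ph, true, y) S X) Γ'.comma =
          mk (ph, true, y) { S with ct := one :: S.ct } X := by
          simp [drainStep, mk, update_get, Stacks.get, Stacks.set]
        rw [e1, List.foldl_cons, List.foldl_nil, e2, ih _ (n + 1) (by simp [hn, List.replicate_succ])]
        have e3 : lower (0 :: l) = lower l := by simp [lower]
        rw [e3, List.count_cons_self, add_assoc, add_comm 1 n]
      | succ c =>
        have e1 : encUnary (c + 1) = one :: encUnary c := rfl
        have e2 : drainStep .b2 .ct (fun v a => (v.1, decide (a = Γ'.comma), v.2.2))
          (fun v a => if v.2.1 then (if a = Γ'.comma then some (false, one) else none) else some (true, a))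
          (fun _ _ => none) (mk (ph, true, y) S X) one = mk (ph, false, y) S X := by
          simp [drainStep, mk]
        rw [e1, List.foldl_cons, e2, key1, ih _ n (by exact hn)]
        have e3 : lower ((c + 1) :: l) = c :: lower l := by simp [lower]
        rw [e3]
        simp [colours]
  unfold lowerAll
  simp only [den_seq, den_load]
  have e : S.get .bw = colours l := hl
  rw [den_drain, e, key2 l _ 0 (by exact hc)]
  simp [den_move, den_load, Stacks.set, Stacks.get, hb]

/-- Write as many zeros as the input has symbols. -/
def zeros (i : Bool) : Prog := rep i (emit fun _ => Γ'.bit false)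

theorem iterate_mk (f : St Name Ctl Γ' → St Name Ctl Γ') (l : List Γ')
    (hf : ∀ X, f (mk v S X) = mk v S (X ++ l)) (n : ℕ) :
    f^[n] (mk v S X) = mk v S (X ++ (List.replicate n l).flatten) := by
  induction n generalizing X with
  | zero => simp
  | succ n ih => rw [iterate_succ_apply, hf, ih, List.replicate_succ]; simp

theorem den_zeros (i : Bool) :
    (zeros i).den w (mk v S X) = mk v S (X ++ List.replicate w.length (Γ'.bit false)) := by
  unfold zeros
  rw [den_rep, iterate_mk v S X _ [Γ'.bit false] (fun X => den_emit w v S X _)]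
  simp [List.flatten_replicate_singleton]

end PlanWriter

/-! ### Reading the necklace and computing the numbers of the plan -/

namespace PlanWriter

open LoopProg LoopProg.Cmd Function

/-- The phase of the control state while the input is read: `0` in the number `k`, `1` at the comma
that closes it, `2` in the list of the beads and `3` behind it. -/
def nextPhase (p : Fin 4) : Γ' → Fin 4
  | Γ'.comma => if p = 0 then 1 else p
  | Γ'.bra => 2
  | Γ'.ket => 3
  | _ => p

/-- Read a symbol. -/
def rd (v : Ctl) (a : Γ') : Ctl := (nextPhase v.1 a, v.2.1, a)

/-- Do nothing. -/
def skip : Prog := load id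

variable (w : List Γ') (v : Ctl) (S : Stacks) (X : List Γ')

/-- Run the body of a loop over the input. -/
def pass (c : Prog) (l : List Γ') (s : St Name Ctl Γ') : St Name Ctl Γ' :=
  l.foldl (fun s a => c.den w { s with v := rd s.v a }) s

theorem den_forIn (i : Bool) (c : Prog) (s : St Name Ctl Γ') :
    (forIn i rd c).den w s = pass w c w s := rfl

theorem pass_cons (c : Prog) (a : Γ') (l : List Γ') :
    pass w c (a :: l) (mk v S X) = pass w c l (c.den w (mk (rd v a) S X)) := rfl

theorem pass_nil (c : Prog) (s : St Name Ctl Γ') : pass w c [] s = s := rfl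

theorem pass_append (c : Prog) (l l' : List Γ') (s : St Name Ctl Γ') :
    pass w c (l ++ l') s = pass w c l' (pass w c l s) := List.foldl_append ..

theorem den_ite (p : Ctl → Bool) (a b : Prog) :
    (ite p a b).den w (mk v S X) = bif p v then a.den w (mk v S X) else b.den w (mk v S X) := rfl

theorem den_clear (k : Name) : (clear k : Prog).den w (mk v S X) = mk v (S.set [] k) X := by
  rw [Cmd.den_clear]; simp [mk, update_get]

theorem code_eq (N : Necklace) :
    N.code = List.replicate N.k one ++ (Γ'.comma :: Γ'.bra :: (colours N.beads ++ [Γ'.ket])) := by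
  simp [Necklace.code, encUnary, encList, colours]

theorem colours_cons (c : ℕ) (l : List ℕ) : colours (c :: l) = encUnary c ++ colours l := rfl

/-- The body of the loop that reads the input. -/
def parseBody : Prog :=
  ite (fun v => decide (v.1 = 0)) (seq (push .kt fun _ => one) (push .k1 fun _ => one)) <|
  ite (fun v => decide (v.1 = 1)) (push .k1 fun _ => one) <|
  ite (fun v => decide (v.1 = 2) && decide (v.2.2 ≠ Γ'.bra)) (push .b2 fun v => v.2.2) skip

/-- Store the numbers `k` and `k + 1` and the beads. -/
def parse : Prog :=
  seq (forIn false rd parseBody) <| seq (load fun _ => (0, false, Γ'.blank)) <| move .b2 .bw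

/-- The comma that closes `k` supplies the additional tick of `k + 1`. The beads are turned over
twice and so keep their order. -/
theorem den_parse (N : Necklace) :
    parse.den N.code (mk (0, false, Γ'.blank) {} X) =
      mk (0, false, Γ'.blank)
        { kt := List.replicate N.k one, k1 := List.replicate (N.k + 1) one, bw := colours N.beads } X := by
  have key1 (n j : ℕ) (y : Γ') : pass N.code parseBody (List.replicate n one) (mk (0, false, y)
      { kt := List.replicate j one, k1 := List.replicate j one } X) =
      mk (0, false, if n = 0 then y else one)
        { kt := List.replicate (n + j) one, k1 := List.replicate (n + j) one } X := by
    induction n generalizing j y with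
    | zero => simp [pass_nil]
    | succ n ih =>
      rw [List.replicate_succ, pass_cons]
      have e : parseBody.den N.code (mk (rd (0, false, y) one)
          { kt := List.replicate j one, k1 := List.replicate j one } X) =
          mk (0, false, one)
          { kt := List.replicate (j + 1) one, k1 := List.replicate (j + 1) one } X := by
        simp [parseBody, den_ite, den_seq, den_push, rd, nextPhase, Stacks.set, Stacks.get,
          List.replicate_succ]
      rw [e, ih]
      have : n + (j + 1) = n + 1 + j := by omega
      simp [this]
  have key2 (l : List Γ') (hl : ∀ a ∈ l, a = one ∨ a = Γ'.comma) (S : Stacks) (y : Γ') :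
      ∃ y', pass N.code parseBody l (mk (2, false, y) S X) =
        mk (2, false, y') { S with b2 := l.reverse ++ S.b2 } X := by
    induction l generalizing S y with
    | nil => exact ⟨y, rfl⟩
    | cons a l ih =>
      have e : parseBody.den N.code (mk (rd (2, false, y) a) S X) =
          mk (2, false, a) { S with b2 := a :: S.b2 } X := by
        rcases hl a (by simp) with rfl | rfl <;>
          simp [parseBody, den_ite, den_push, rd, nextPhase, Stacks.set, Stacks.get]
      rw [pass_cons, e]
      obtain ⟨y', hy'⟩ := ih (fun b hb => hl b (by simp [hb])) { S with b2 := a :: S.b2 } a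
      exact ⟨y', by rw [hy']; simp⟩
  have hcol : ∀ a ∈ colours N.beads, a = one ∨ a = Γ'.comma := by
    intro a ha
    simp only [colours, List.mem_flatMap, encUnary, List.mem_append, List.mem_replicate,
      List.mem_singleton] at ha
    obtain ⟨_, _, h | h⟩ := ha
    · exact Or.inl h.2
    · exact Or.inr h
  have h1 := key1 N.k 0 Γ'.blank
  unfold parse
  rw [den_seq, den_forIn]
  conv_lhs => rw [show pass N.code parseBody N.code = pass N.code parseBody
    (List.replicate N.k one ++ (Γ'.comma :: Γ'.bra :: (colours N.beads ++ [Γ'.ket])))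
    from congrArg _ (code_eq N)]
  simp only [List.replicate_zero] at h1
  have e0 : ({} : Stacks) = { kt := [], k1 := [] } := rfl
  rw [pass_append, h1, pass_cons]
  have e1 (S : Stacks) (y : Γ') : parseBody.den N.code (mk (rd (0, false, y) Γ'.comma) S X) =
      mk (1, false, Γ'.comma) { S with k1 := one :: S.k1 } X := by
    simp [parseBody, den_ite, den_push, rd, nextPhase, Stacks.set, Stacks.get]
  have e2 (S : Stacks) (v : Ctl) : parseBody.den N.code (mk (rd v Γ'.bra) S X) =
      mk (2, v.2.1, Γ'.bra) S X := by
    simp [parseBody, den_ite, rd, nextPhase, skip, den_load]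
  have e3 (S : Stacks) (v : Ctl) : parseBody.den N.code (mk (rd v Γ'.ket) S X) =
      mk (3, v.2.1, Γ'.ket) S X := by
    simp [parseBody, den_ite, rd, nextPhase, skip, den_load]
  rw [e1, pass_cons, e2, pass_append]
  obtain ⟨y', hy'⟩ := key2 _ hcol { kt := List.replicate N.k one, k1 := List.replicate (N.k + 1) one } Γ'.bra
  simp only [List.replicate_succ] at hy'
  simp only [add_zero]
  rw [hy', pass_cons, e3, pass_nil, den_seq, den_load, den_move]
  simp [Stacks.set, Stacks.get, List.replicate_succ]

/-- Compute the binary numbers that occur in the plan. -/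
noncomputable def prepare : Prog :=
  seq parse <|
  seq (move .kt .ct) <| seq binarize <| seq (strip .wd .kb) <| seq (clear .dd) <|
  seq (move .k1 .ct) <| seq binarize <| seq (strip .wd .k1b) <| seq (clear .dd) <|
  seq (rep false (seq (push .wd fun _ => Γ'.bit false) (push .dd fun _ => Γ'.bit true))) <|
  seq (rep true (seq lowerAll binarize)) <|
  seq (push .dd fun _ => Γ'.bit true) <| seq (strip .wd .wb) <| move .dd .db

/-- The digits of a number. -/
def bits (n : ℕ) : List Γ' := (encodeNat n).map Γ'.bit

theorem strip_digits {l n : ℕ} (h : n < 2 ^ l) :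
    (List.map Γ'.bit ((digits l n).reverse.dropWhile fun b => !b)).reverse = bits n := by
  rw [← List.map_reverse, bits, encodeNat_eq_rdropWhile h]
  rfl

/-- The work stacks after the preparation. -/
def prepared (N : Necklace) : Stacks where
  bw := colours (lower^[N.ell] N.beads)
  kb := bits N.k
  k1b := bits (N.k + 1)
  wb := bits N.load
  db := bits N.depotLen

/-- The digits of the load are assembled from the lowest block upwards, one block per colour, while
their complements gather on `dd`; a final `1` on `dd` is the top digit of the depot distance. -/
theorem den_prepare (N : Necklace) :
    prepare.den N.code (mk (0, false, Γ'.blank) {} X) =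
      mk (0, false, Γ'.blank) (prepared N) X := by
  have hk : N.k < 2 ^ N.code.length :=
    (Nat.lt_of_succ_lt N.k_lt_ell).trans Nat.lt_two_pow_self
  have hk1 : N.k + 1 < 2 ^ N.code.length := N.k_lt_ell.trans Nat.lt_two_pow_self
  -- The lowest block of the load is zero, as the exponents start at `ell`.
  have hrep (S : Stacks) (n : ℕ) : ((seq (push .wd fun _ => Γ'.bit false)
      (push .dd fun _ => Γ'.bit true) : Prog).den N.code)^[n] (mk (0, false, Γ'.blank) S X) =
      mk (0, false, Γ'.blank) { S with
        wd := List.replicate n (Γ'.bit false) ++ S.wd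
        dd := List.replicate n (Γ'.bit true) ++ S.dd } X := by
    induction n generalizing S with
    | zero => rfl
    | succ n ih =>
      rw [iterate_succ_apply, den_seq, den_push, den_push, ih]
      simp [Stacks.set, Stacks.get, List.replicate_succ']
  have hlow (S : Stacks) (h1 : S.bw = colours N.beads) (h2 : S.ct = []) (h3 : S.b2 = [])
      (h4 : S.tm = []) (h5 : S.wd = List.replicate N.ell (Γ'.bit false))
      (h6 : S.dd = List.replicate N.ell (Γ'.bit true)) (j : ℕ) :
      ((seq lowerAll binarize).den N.code)^[j] (mk (0, false, Γ'.blank) S X) =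
      mk (0, false, Γ'.blank) { S with
        bw := colours (lower^[j] N.beads)
        wd := ((digits (N.ell * (j + 1)) (N.partialLoad j)).map Γ'.bit).reverse
        dd := ((digits (N.ell * (j + 1)) (N.partialLoad j)).map fun b => Γ'.bit !b).reverse } X := by
    induction j with
    | zero =>
      cases S
      simp_all [Necklace.partialLoad, digits_zero]
    | succ j ih =>
      rw [iterate_succ_apply', ih, den_seq, den_lowerAll _ _ _ (lower^[j] N.beads) (by exact rfl) (by exact h2) (by exact h3),
        den_binarize _ _ _ _ (by exact rfl) (by exact h4), count_iterate_lower,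
        Nat.div_eq_of_lt (show _ < 2 ^ N.code.length from N.count_lt j), iterate_succ_apply',
        show j + 1 + 1 = j + 2 from rfl, N.digits_partialLoad_succ]
      simp [h2, Necklace.ell]
  unfold prepare
  simp only [den_seq, den_parse, den_move, Stacks.set, Stacks.get]
  rw [den_binarize _ _ _ N.k (by simp) rfl, Nat.div_eq_of_lt hk,
    den_strip _ _ _ .wd .kb (by decide) (digits N.code.length N.k).reverse
      (by simp [Stacks.get]) rfl, strip_digits hk]
  simp only [den_move, den_clear, Stacks.set, Stacks.get]
  rw [den_binarize _ _ _ (N.k + 1) (by simp) rfl, Nat.div_eq_of_lt hk1,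
    den_strip _ _ _ .wd .k1b (by decide) (digits N.code.length (N.k + 1)).reverse
      (by simp [Stacks.get]) rfl, strip_digits hk1]
  simp only [den_clear, Stacks.set, den_rep, hrep]
  rw [hlow]
  · simp only [den_push, Stacks.set, Stacks.get]
    rw [den_strip _ _ _ .wd .wb (by decide)
      (digits (N.code.length * (N.code.length + 1)) (N.partialLoad N.code.length)).reverse
      (by simp [Stacks.get, Necklace.ell]) rfl, den_move]
    have h1 := strip_digits (l := N.code.length * (N.code.length + 1)) N.load_lt
    have h2 : N.partialLoad N.code.length = N.load := rfl
    rw [h2, h1]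
    simp only [Stacks.set, Stacks.get, prepared]
    have h3 := N.encodeNat_depotLen
    have h4 : bits N.depotLen = ((digits (N.width - 1) N.load).map fun b => Γ'.bit !b) ++ [Γ'.bit true] := by
      rw [bits, h3]; simp
    rw [h4]
    simp [Necklace.ell, Necklace.width]
  all_goals simp [Necklace.ell]

end PlanWriter

/-! ### Writing the plan -/

namespace PlanWriter

open LoopProg LoopProg.Cmd Function

variable (w : List Γ') (v : Ctl) (S : Stacks) (X : List Γ')

/-- The body of the loop that writes the entries of the beads: `hd` writes the beginning of an
entry and `ft` its end. -/
def beadBody (hd : Prog) (ft : List Γ') : Prog :=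
  ite (fun v => decide (v.1 = 2) && decide (v.2.2 ≠ Γ'.bra))
    (seq (ite (fun v => v.2.1) hd skip) <| seq (zeros false) <|
      ite (fun v => decide (v.2.2 = Γ'.comma))
        (seq (print .kb .tm) <| seq (emits ft) <| load fun v => (v.1, true, v.2.2))
        (load fun v => (v.1, false, v.2.2)))
    skip

/-- Write the entries of the beads. -/
def beadLoop (hd : Prog) (ft : List Γ') : Prog :=
  seq (load fun _ => (0, true, Γ'.blank)) <| seq (forIn true rd (beadBody hd ft)) <|
    load fun _ => (0, false, Γ'.blank)

/-- The entry of a bead without its beginning. -/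
def entryEnd (w : List Γ') (kb ft : List Γ') (c : ℕ) : List Γ' :=
  List.replicate (w.length * (c + 1)) (Γ'.bit false) ++ kb ++ ft

/-- Each of the `c + 1` symbols of a colour in unary is replaced by as many zeros as the input has
symbols. With the digits of `k` behind them these form the binary code of the edge length, so powers
of two need no computation. -/
theorem pass_encUnary_false (hd : Prog) (ft : List Γ') (c : ℕ) (y : Γ') (ht : S.tm = []) :
    pass w (beadBody hd ft) (encUnary c) (mk (2, false, y) S X) =
      mk (2, true, Γ'.comma) S (X ++ entryEnd w S.kb ft c) := by
  induction c generalizing X y with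
  | zero =>
    rw [show encUnary 0 = [Γ'.comma] from rfl, pass_cons, pass_nil]
    simp [beadBody, den_ite, rd, nextPhase, den_seq, skip, den_load, den_zeros, den_print, ht,
      den_emits, entryEnd, Stacks.get]
  | succ c ih =>
    rw [show encUnary (c + 1) = one :: encUnary c from rfl, pass_cons]
    have e : (beadBody hd ft).den w (mk (rd (2, false, y) one) S X) =
        mk (2, false, one) S (X ++ List.replicate w.length (Γ'.bit false)) := by
      simp [beadBody, den_ite, rd, nextPhase, den_seq, skip, den_load, den_zeros]
    rw [e, ih]
    have h : w.length * (c + 1 + 1) = w.length + w.length * (c + 1) := by ring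
    rw [entryEnd, entryEnd, h, List.replicate_add]
    simp only [List.append_assoc]

theorem pass_encUnary_true (hd : Prog) (ft : List Γ') (c : ℕ) (y : Γ') (S' : Stacks) (x : List Γ')
    (hhd : ∀ v X, hd.den w (mk v S X) = mk v S' (X ++ x)) (ht : S'.tm = []) :
    pass w (beadBody hd ft) (encUnary c) (mk (2, true, y) S X) =
      mk (2, true, Γ'.comma) S' (X ++ (x ++ entryEnd w S'.kb ft c)) := by
  cases c with
  | zero =>
    rw [show encUnary 0 = [Γ'.comma] from rfl, pass_cons, pass_nil]
    simp [beadBody, den_ite, rd, nextPhase, den_seq, skip, den_load, hhd, den_zeros, den_print, ht,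
      den_emits, entryEnd, Stacks.get]
  | succ c =>
    rw [show encUnary (c + 1) = one :: encUnary c from rfl, pass_cons]
    have e : (beadBody hd ft).den w (mk (rd (2, true, y) one) S X) =
        mk (2, false, one) S' (X ++ x ++ List.replicate w.length (Γ'.bit false)) := by
      simp [beadBody, den_ite, rd, nextPhase, den_seq, den_load, den_zeros, hhd]
    rw [e, pass_encUnary_false w S' _ _ _ _ _ ht]
    have h : w.length * (c + 1 + 1) = w.length + w.length * (c + 1) := by ring
    rw [entryEnd, entryEnd, h, List.replicate_add]
    simp only [List.append_assoc]

/-- `T i` describes the stacks before bead `i`: in the loop for the centre the index stack gains a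
tick with every bead, in the loop for the leaves nothing changes. -/
theorem pass_colours (hd : Prog) (ft kb : List Γ') (l : List ℕ) (y : Γ') (T : ℕ → Stacks)
    (x : ℕ → List Γ') (hhd : ∀ i v X, hd.den w (mk v (T i) X) = mk v (T (i + 1)) (X ++ x i))
    (ht : ∀ i, (T i).tm = []) (hkb : ∀ i, (T i).kb = kb) :
    ∃ y', pass w (beadBody hd ft) (colours l) (mk (2, true, y) (T 0) X) =
      mk (2, true, y') (T l.length)
        (X ++ (l.mapIdx fun i c => x i ++ entryEnd w kb ft c).flatten) := by
  induction l generalizing X y T x with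
  | nil => exact ⟨y, by simp [colours, pass_nil]⟩
  | cons c l ih =>
    obtain ⟨y', hy'⟩ := ih (X ++ (x 0 ++ entryEnd w kb ft c)) Γ'.comma (fun i => T (i + 1))
      (fun i => x (i + 1)) (fun i => hhd (i + 1)) (fun i => ht (i + 1)) (fun i => hkb (i + 1))
    refine ⟨y', ?_⟩
    rw [colours_cons, pass_append, pass_encUnary_true w (T 0) X hd ft c y (T 1) (x 0)
      (hhd 0) (ht 1), hkb]
    refine hy'.trans ?_
    simp [List.mapIdx_cons]

theorem den_beadLoop (N : Necklace) (hd : Prog) (ft kb : List Γ') (T : ℕ → Stacks)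
    (x : ℕ → List Γ') (hhd : ∀ i v X, hd.den N.code (mk v (T i) X) = mk v (T (i + 1)) (X ++ x i))
    (ht : ∀ i, (T i).tm = []) (hkb : ∀ i, (T i).kb = kb) :
    (beadLoop hd ft).den N.code (mk v (T 0) X) =
      mk (0, false, Γ'.blank) (T N.beads.length)
        (X ++ (N.beads.mapIdx fun i c => x i ++ entryEnd N.code kb ft c).flatten) := by
  -- Outside the list of beads and at its opening bracket the body does nothing.
  have h0 (v : Ctl) (hv : v.1 ≠ 2 ∨ v.2.2 = Γ'.bra) (S : Stacks) (X : List Γ') :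
      (beadBody hd ft).den N.code (mk v S X) = mk v S X := by
    simp only [beadBody, den_ite, skip, den_load, id]
    rcases hv with hv | hv <;> simp [hv]
  have h1 (n : ℕ) (y : Γ') (S : Stacks) : ∃ y', pass N.code (beadBody hd ft)
      (List.replicate n one) (mk (0, true, y) S X) = mk (0, true, y') S X := by
    induction n generalizing y with
    | zero => exact ⟨y, rfl⟩
    | succ n ih =>
      obtain ⟨y', hy'⟩ := ih one
      refine ⟨y', ?_⟩
      rw [List.replicate_succ, pass_cons, h0 _ (Or.inl (by simp [rd, nextPhase]))]
      exact hy'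
  unfold beadLoop
  rw [den_seq, den_load, den_seq, den_forIn]
  conv_lhs => rw [show pass N.code (beadBody hd ft) N.code = pass N.code (beadBody hd ft)
    (List.replicate N.k one ++ (Γ'.comma :: Γ'.bra :: (colours N.beads ++ [Γ'.ket])))
    from congrArg _ (code_eq N)]
  obtain ⟨y, hy⟩ := h1 N.k Γ'.blank (T 0)
  obtain ⟨y', hy'⟩ := pass_colours N.code X hd ft kb N.beads Γ'.bra T x hhd ht hkb
  rw [pass_append, hy, pass_cons, h0 _ (Or.inl (by simp [rd, nextPhase])), pass_cons,
    h0 _ (Or.inr rfl), pass_append]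
  refine (congrArg (fun s => den N.code (load fun _ => (0, false, Γ'.blank))
    (pass N.code (beadBody hd ft) [Γ'.ket] s)) hy').trans ?_
  rw [pass_cons, h0 _ (Or.inl (by simp [rd, nextPhase]))]
  rfl

/-- Write the number of the next bead. -/
def writeIndex : Prog :=
  seq (print .ix .tm) <| seq (push .ix fun _ => one) <| emits [Γ'.comma]

theorem den_writeIndex (N : Necklace) (i : ℕ) :
    writeIndex.den w (mk v { prepared N with ix := List.replicate (i + 3) one } X) =
      mk v { prepared N with ix := List.replicate (i + 1 + 3) one } (X ++ encUnary (i + 3)) := by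
  unfold writeIndex
  rw [den_seq, den_print _ _ _ _ _ (by decide) rfl, den_seq, den_push, den_emits]
  simp [Stacks.set, Stacks.get, encUnary, List.replicate_succ]

/-- Write the plan up to the entries of the beads at the centre. -/
def writeStart : Prog :=
  seq (emits ([one, one, Γ'.comma, Γ'.bra] ++ [Γ'.bra, one, Γ'.comma])) <| seq (print .wb .tm) <|
  seq (emits ([Γ'.comma, Γ'.comma, one, Γ'.comma] ++ [one, one, Γ'.comma])) <|
  seq (print .db .tm) <| seq (emits [Γ'.comma, Γ'.comma]) <| seq (print .k1b .tm) <|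
  seq (emits [Γ'.comma]) <|
  -- The first bead is the vertex `3`.
  seq (push .ix fun _ => one) <| seq (push .ix fun _ => one) <| push .ix fun _ => one

theorem den_writeStart (h : S.tm = []) :
    writeStart.den w (mk v S X) = mk v { S with ix := one :: one :: one :: S.ix }
      (X ++ ([one, one, Γ'.comma, Γ'.bra] ++ [Γ'.bra, one, Γ'.comma] ++ S.wb ++
        [Γ'.comma, Γ'.comma, one, Γ'.comma] ++ [one, one, Γ'.comma] ++ S.db ++
        [Γ'.comma, Γ'.comma] ++ S.k1b ++ [Γ'.comma])) := by
  simp [writeStart, den_seq, den_emits, den_print, den_push, h, Stacks.get, Stacks.set]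

/-- Write the entries of the two leaves that are not beads. -/
def writeMiddle : Prog :=
  seq (emits ([Γ'.ket] ++ [Γ'.bra, Γ'.comma])) <| seq (print .wb .tm) <|
  seq (emits ([Γ'.comma, Γ'.comma, one, Γ'.comma, Γ'.ket] ++ [Γ'.bra, Γ'.comma])) <|
  seq (print .db .tm) <| seq (emits [Γ'.comma, Γ'.comma]) <| seq (print .k1b .tm) <|
  emits [Γ'.comma, Γ'.ket]

theorem den_writeMiddle (h : S.tm = []) :
    writeMiddle.den w (mk v S X) = mk v S
      (X ++ ([Γ'.ket] ++ [Γ'.bra, Γ'.comma] ++ S.wb ++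
        [Γ'.comma, Γ'.comma, one, Γ'.comma, Γ'.ket] ++ [Γ'.bra, Γ'.comma] ++ S.db ++
        [Γ'.comma, Γ'.comma] ++ S.k1b ++ [Γ'.comma, Γ'.ket])) := by
  simp [writeMiddle, den_seq, den_emits, den_print, h, Stacks.get]

/-- Write what follows the lists of neighbours. -/
def writeEnd : Prog :=
  seq (emits ([Γ'.ket] ++ [Γ'.bra, Γ'.bra, one, Γ'.comma, one, Γ'.comma, Γ'.ket, Γ'.ket])) <|
  -- These `ell * (ell + 1)` zeros and the next two make up the exponent `width + 1` in `L`.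
  seq (rep true (seq (zeros false) (emit fun _ => Γ'.bit false))) <|
  seq (emits [Γ'.bit false, Γ'.bit false]) <| seq (print .k1b .tm) <|
  seq (emits ([Γ'.comma] ++ [one, Γ'.comma])) <| seq (print .k1b .tm) <| emits [Γ'.comma]

theorem den_writeEnd (h : S.tm = []) :
    writeEnd.den w (mk v S X) = mk v S
      (X ++ ([Γ'.ket] ++ [Γ'.bra, Γ'.bra, one, Γ'.comma, one, Γ'.comma, Γ'.ket, Γ'.ket] ++
        List.replicate (w.length * (w.length + 1)) (Γ'.bit false) ++ [Γ'.bit false, Γ'.bit false] ++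
        S.k1b ++ [Γ'.comma] ++ [one, Γ'.comma] ++ S.k1b ++ [Γ'.comma])) := by
  have h3 (X : List Γ') :
      (rep true (seq (zeros false) (emit fun _ => Γ'.bit false)) : Prog).den w (mk v S X) =
      mk v S (X ++ List.replicate (w.length * (w.length + 1)) (Γ'.bit false)) := by
    rw [den_rep, iterate_mk v S X _ (List.replicate (w.length + 1) (Γ'.bit false))
      (fun X => by rw [den_seq, den_zeros, den_emit]; simp [List.replicate_succ'])]
    simp [List.flatten_replicate_replicate]
  simp [writeEnd, den_seq, den_emits, den_print, h, h3, Stacks.get]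

/-- Write the plan, after the preparation. -/
def writePlan : Prog :=
  seq writeStart <| seq (beadLoop writeIndex [Γ'.comma, Γ'.comma, one, Γ'.comma]) <|
  seq writeMiddle <|
  seq (beadLoop (emits [Γ'.bra, Γ'.comma]) [Γ'.comma, Γ'.comma, one, Γ'.comma, Γ'.ket]) writeEnd

theorem encBinary_eq (n : ℕ) : encBinary n = bits n ++ [Γ'.comma] := rfl

theorem bits_mul_two_pow {n : ℕ} (h : 0 < n) (p : ℕ) :
    bits (n * 2 ^ p) = List.replicate p (Γ'.bit false) ++ bits n := by
  simp [bits, encodeNat_mul_two_pow h]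

theorem entryEnd_eq (N : Necklace) (l : List Γ') (c : ℕ) :
    entryEnd N.code (bits N.k) ([Γ'.comma, Γ'.comma, one, Γ'.comma] ++ l) c = N.entryTail c ++ l := by
  rw [Necklace.entryTail, Necklace.edgeLen, encBinary_eq, bits_mul_two_pow N.k_pos]
  simp [entryEnd, Necklace.ell]

theorem den_writePlan (N : Necklace) :
    (writePlan.den N.code (mk (0, false, Γ'.blank) (prepared N) [])).out =
      N.plan.encode.reverse := by
  -- The empty tail gives both loops the form required by `entryEnd_eq`.
  have h1 := fun v X => den_beadLoop v X N writeIndex ([Γ'.comma, Γ'.comma, one, Γ'.comma] ++ [])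
    (bits N.k) (fun i => { prepared N with ix := List.replicate (i + 3) one })
    (fun i => encUnary (i + 3))
    (fun i v X => den_writeIndex _ v X N i) (fun _ => rfl) (fun _ => rfl)
  have h2 := fun v X => den_beadLoop v X N (emits [Γ'.bra, Γ'.comma])
    ([Γ'.comma, Γ'.comma, one, Γ'.comma] ++ [Γ'.ket]) (bits N.k)
    (fun _ => { prepared N with ix := List.replicate (N.beads.length + 3) one })
    (fun _ => [Γ'.bra, Γ'.comma])
    (fun i v X => den_emits _ v _ X _) (fun _ => rfl) (fun _ => rfl)
  have e0 := entryEnd_eq N []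
  simp only [entryEnd_eq] at h1 h2
  unfold writePlan
  rw [den_seq, den_writeStart _ _ _ _ rfl, den_seq]
  refine (congrArg (fun s => (den N.code _ s).out) (h1 _ _)).trans ?_
  rw [den_seq, den_writeMiddle _ _ _ _ rfl, den_seq]
  refine (congrArg (fun s => (den N.code _ s).out) (h2 _ _)).trans ?_
  rw [den_writeEnd _ _ _ _ rfl, N.encode_plan]
  have e1 : (N.width + 1) = N.code.length * (N.code.length + 1) + 2 := rfl
  rw [encBinary_eq ((N.k + 1) * _), bits_mul_two_pow (Nat.succ_pos _), e1]
  simp only [mk, encBinary_eq, prepared, List.replicate_add, List.append_assoc, encUnary]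
  simp

/-- The program that computes the plan of a necklace. -/
noncomputable def program : Prog := seq prepare writePlan

theorem out_program (N : Necklace) :
    (program.den N.code ⟨(0, false, Γ'.blank), fun _ => [], []⟩).out = N.plan.encode.reverse := by
  have e : (⟨(0, false, Γ'.blank), fun _ => [], []⟩ : St Name Ctl Γ') =
      mk (0, false, Γ'.blank) {} [] := by
    unfold mk
    congr 1
    funext k; cases k <;> rfl
  rw [e, program, den_seq, den_prepare, den_writePlan]

theorem wf_clear (k : Name) : (clear k : Prog).WF :=
  ⟨(exists_ne k).choose_spec, (exists_ne k).choose_spec⟩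

theorem wf_program : program.WF := by
  simp [program, prepare, WF, parse, parseBody, skip, Cmd.move, binarize, halve, rep, strip,
    wf_clear, lowerAll, writePlan, writeStart, writeMiddle, writeEnd, beadLoop, beadBody, writeIndex,
    wf_emits, Cmd.print, moveOut, zeros, uses, not_uses_emits]

/-- The plan of a necklace is computable in polynomial time. -/
theorem polyTime_plan : Nonempty (Turing.TM2ComputableInPolyTime necklaceSplitting.encInst
    unfairnessMinimisation.encInst Necklace.plan) :=
  LoopProg.polyTime necklaceSplitting.encInst unfairnessMinimisation.encInst Necklace.plan program
    wf_program (0, false, Γ'.blank) out_program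

end PlanWriter

/-! ### Walks in a star -/

namespace StarWalk

/-- The arcs of the walk in the star with centre `0` that visits the leaf `u` and then the leaves
of the list. -/
def pairs : ℕ → List ℕ → List (ℕ × ℕ)
  | _, [] => []
  | u, a :: l => (u, 0) :: (0, a) :: pairs a l

theorem length_pairs (u : ℕ) (l : List ℕ) : (pairs u l).length = 2 * l.length := by
  induction l generalizing u with
  | nil => rfl
  | cons a l ih => simp only [pairs, List.length_cons, ih]; ring

theorem pairs_append (u : ℕ) (l l' : List ℕ) :
    pairs u (l ++ l') = pairs u l ++ pairs (l.getLastD u) l' := by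
  induction l generalizing u with
  | nil => rfl
  | cons a l ih => simp only [pairs, List.cons_append, ih, List.getLastD_cons]

theorem take_pairs (u : ℕ) (l : List ℕ) (j : ℕ) :
    (pairs u l).take (2 * j) = pairs u (l.take j) := by
  induction l generalizing u j with
  | nil => simp [pairs]
  | cons a l ih =>
    cases j with
    | zero => rfl
    | succ j =>
      rw [show 2 * (j + 1) = 2 * j + 1 + 1 by ring]
      simp only [pairs, List.take_succ_cons, ih]

theorem map_snd_pairs (u : ℕ) (l : List ℕ) :
    (pairs u l).map Prod.snd = l.flatMap fun a => [0, a] := by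
  induction l generalizing u with
  | nil => rfl
  | cons a l ih => simp only [pairs, List.map_cons, ih]; rfl

theorem count_pairs_zero {a : ℕ} (ha : a ≠ 0) (u : ℕ) (l : List ℕ) :
    (pairs u l).count (0, a) = l.count a := by
  induction l generalizing u with
  | nil => rfl
  | cons b l ih =>
    simp only [pairs, List.count_cons, ih, beq_iff_eq, Prod.mk.injEq]
    simp [ha.symm]

theorem count_pairs {a : ℕ} (ha : a ≠ 0) (u : ℕ) (l : List ℕ) :
    (pairs u l).count (a, 0) = (u :: l).dropLast.count a := by
  induction l generalizing u with
  | nil => rfl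
  | cons b l ih =>
    rw [List.dropLast_cons_cons, List.count_cons, ← ih]
    simp only [pairs, List.count_cons, beq_iff_eq, Prod.mk.injEq]
    simp [ha.symm]

/-- Arcs at even positions run to the centre, those at odd positions away from it. The decomposition
shows the two consecutive leaves that the arc helps to join. -/
theorem getElem?_pairs_even (u : ℕ) (l : List ℕ) (j a b : ℕ)
    (h : (pairs u l)[2 * j]? = some (a, b)) :
    b = 0 ∧ ∃ A c B, u :: l = A ++ a :: c :: B ∧ A.length = j := by
  induction l generalizing u j with
  | nil => simp [pairs] at h
  | cons d l ih =>
    cases j with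
    | zero =>
      simp only [pairs, mul_zero, List.getElem?_cons_zero, Option.some.injEq, Prod.mk.injEq] at h
      exact ⟨h.2.symm, [], d, l, by simp [h.1], rfl⟩
    | succ j =>
      rw [show 2 * (j + 1) = 2 * j + 1 + 1 by ring] at h
      simp only [pairs, List.getElem?_cons_succ] at h
      obtain ⟨h1, A, c, B, h2, h3⟩ := ih _ _ h
      exact ⟨h1, u :: A, c, B, by rw [h2]; rfl, by simp [h3]⟩

theorem getElem?_pairs_odd (u : ℕ) (l : List ℕ) (j a b : ℕ)
    (h : (pairs u l)[2 * j + 1]? = some (a, b)) :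
    a = 0 ∧ ∃ A c B, u :: l = A ++ c :: b :: B ∧ A.length = j := by
  induction l generalizing u j with
  | nil => simp [pairs] at h
  | cons d l ih =>
    cases j with
    | zero =>
      simp only [pairs, mul_zero, zero_add, List.getElem?_cons_succ, List.getElem?_cons_zero,
        Option.some.injEq, Prod.mk.injEq] at h
      exact ⟨h.1.symm, [], u, l, by simp [h.2], rfl⟩
    | succ j =>
      rw [show 2 * (j + 1) + 1 = 2 * j + 1 + 1 + 1 by ring] at h
      simp only [pairs, List.getElem?_cons_succ] at h
      obtain ⟨h1, A, c, B, h2, h3⟩ := ih _ _ h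
      exact ⟨h1, u :: A, c, B, by rw [h2]; rfl, by simp [h3]⟩

theorem getElem?_pairs_of_eq (u : ℕ) (l A B : List ℕ) (a b : ℕ) (h : u :: l = A ++ a :: b :: B) :
    (pairs u l)[2 * A.length]? = some (a, 0) ∧ (pairs u l)[2 * A.length + 1]? = some (0, b) := by
  induction A generalizing u l with
  | nil =>
    obtain ⟨rfl, rfl⟩ : u = a ∧ l = b :: B := by simpa using h
    simp [pairs]
  | cons c A ih =>
    obtain ⟨rfl, h'⟩ : u = c ∧ l = A ++ a :: b :: B := by simpa using h
    cases l with
    | nil => simp at h'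
    | cons d l =>
      rw [List.length_cons, show 2 * (A.length + 1) = 2 * A.length + 1 + 1 by ring]
      simp only [pairs, List.getElem?_cons_succ]
      exact ih _ _ h'

/-- A walk without arcs is excluded because it visits `u` without using the edge of `u`. -/
theorem mem_pairs {a : ℕ} (ha : a ≠ 0) (u : ℕ) (l : List ℕ) (hl : l ≠ []) :
    ((0, a) ∈ pairs u l ∨ (a, 0) ∈ pairs u l) ↔ a ∈ u :: l := by
  have h0 : (0, a) ∈ pairs u l ↔ a ∈ l := by
    rw [← List.count_pos_iff, count_pairs_zero ha, List.count_pos_iff]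
  have h1 : (a, 0) ∈ pairs u l ↔ a ∈ (u :: l).dropLast := by
    rw [← List.count_pos_iff, count_pairs ha, List.count_pos_iff]
  rw [h0, h1]
  obtain ⟨d, l, rfl⟩ := List.exists_cons_of_ne_nil hl
  rw [List.dropLast_cons_cons]
  constructor
  · rintro (h | h)
    · exact List.mem_cons_of_mem _ h
    · rcases List.mem_cons.1 h with h | h
      · simp [h]
      · exact List.mem_cons_of_mem _ (List.mem_of_mem_dropLast h)
  · intro h
    rcases List.mem_cons.1 h with h | h
    · right; simp [h]
    · left; exact h

variable {n : ℕ}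

/-- The names of the ends of an arc. -/
def ends {G : SimpleGraph (Fin n)} (d : G.Dart) : ℕ × ℕ := (d.fst.val, d.snd.val)

theorem ends_injective {G : SimpleGraph (Fin n)} : Function.Injective (ends (G := G)) := by
  intro d e h
  simp only [ends, Prod.mk.injEq] at h
  exact SimpleGraph.Dart.ext _ _ (Prod.ext (Fin.ext h.1) (Fin.ext h.2))

/-- In a star every second vertex of a walk is the centre, so a walk between leaves is determined by
the leaves that it visits. -/
theorem exists_leaves {u v : Fin (n + 1)} (p : (SimpleGraph.starGraph (0 : Fin (n + 1))).Walk u v)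
    (hu : u ≠ 0) (hv : v ≠ 0) : ∃ l : List ℕ, p.darts.map ends = pairs u l ∧
      (∀ a ∈ l, a ≠ 0 ∧ a ≤ n) ∧ l.getLastD u = v := by
  match p with
  | .nil => exact ⟨[], rfl, by simp, rfl⟩
  | .cons h .nil =>
    rw [SimpleGraph.starGraph_adj] at h
    exact absurd h.2 (by simp [hu, hv])
  | .cons (v := b) h (.cons (v := a) h' q) =>
    have hb : b = 0 := by
      rw [SimpleGraph.starGraph_adj] at h
      exact h.2.resolve_left hu
    subst hb
    have ha : a ≠ 0 := h'.ne'
    obtain ⟨l, h1, h2, h3⟩ := exists_leaves q ha hv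
    refine ⟨a :: l, ?_, ?_, ?_⟩
    · simp only [SimpleGraph.Walk.darts_cons, List.map_cons, h1, pairs]
      rfl
    · intro c hc
      rcases List.mem_cons.1 hc with rfl | hc
      · exact ⟨fun h => ha (Fin.ext h), Nat.lt_succ_iff.1 a.isLt⟩
      · exact h2 c hc
    · rw [List.getLastD_cons, h3]
  termination_by p.length

theorem exists_walk {u v : Fin (n + 1)} (l : List ℕ) (hu : u ≠ 0)
    (hl : ∀ a ∈ l, a ≠ 0 ∧ a ≤ n) (hv : l.getLastD u = v) :
    ∃ p : (SimpleGraph.starGraph (0 : Fin (n + 1))).Walk u v, p.darts.map ends = pairs u l := by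
  induction l generalizing u with
  | nil =>
    obtain rfl : u = v := Fin.ext hv
    exact ⟨.nil, rfl⟩
  | cons a l ih =>
    obtain ⟨h1, h2⟩ := hl a (by simp)
    have ha : (⟨a, Nat.lt_succ_iff.2 h2⟩ : Fin (n + 1)) ≠ 0 := fun h => h1 (congrArg Fin.val h)
    obtain ⟨p, hp⟩ := ih (u := ⟨a, Nat.lt_succ_iff.2 h2⟩) ha
      (fun b hb => hl b (List.mem_cons_of_mem _ hb)) (by rwa [List.getLastD_cons] at hv)
    have e1 : (SimpleGraph.starGraph (0 : Fin (n + 1))).Adj u 0 :=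
      SimpleGraph.starGraph_adj.2 ⟨hu, Or.inr rfl⟩
    have e2 : (SimpleGraph.starGraph (0 : Fin (n + 1))).Adj 0 ⟨a, Nat.lt_succ_iff.2 h2⟩ :=
      SimpleGraph.starGraph_adj.2 ⟨ha.symm, Or.inl rfl⟩
    refine ⟨.cons e1 (.cons e2 p), ?_⟩
    simp only [SimpleGraph.Walk.darts_cons, List.map_cons, hp, pairs]
    rfl

end StarWalk

namespace StarWalk

theorem dropLast_append_getLastD (u : ℕ) (l : List ℕ) :
    (u :: l).dropLast ++ [l.getLastD u] = u :: l := by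
  induction l generalizing u with
  | nil => rfl
  | cons a l ih => rw [List.dropLast_cons_cons, List.getLastD_cons, List.cons_append, ih]

/-- In a closed walk the first and the last leaf coincide, so every leaf is entered as often as it
is left and both arcs of an edge have the same frequency. -/
theorem count_dropLast (u a : ℕ) (l : List ℕ) (h : l.getLastD u = u) :
    (u :: l).dropLast.count a = l.count a := by
  have h1 := dropLast_append_getLastD u l
  rw [h] at h1
  have h2 := congrArg (List.count a) h1
  rw [List.count_append, List.count_cons (l := l), List.count_singleton] at h2
  omega

/-- Every part of the sequence of arcs that does not leave the vertex `s` after its first arc has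
length at most `b`. -/
def SegBound (s b : ℕ) (len : List (ℕ × ℕ) → ℕ) (P : List (ℕ × ℕ)) : Prop :=
  ∀ A B C, P = A ++ B ++ C → (∀ q ∈ B.tail, q.1 ≠ s) → len B ≤ b

end StarWalk

/-! ### Vehicle routes as lists of leaves -/

namespace Necklace

open StarWalk

variable (N : Necklace)

/-- The length of a sequence of arcs. -/
def pathLen (P : List (ℕ × ℕ)) : ℕ := (P.map fun q => N.weight q.1 + N.weight q.2).sum

theorem pathLen_append (P Q : List (ℕ × ℕ)) : N.pathLen (P ++ Q) = N.pathLen P + N.pathLen Q := by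
  simp [pathLen]

variable {N}

theorem arcLen_eq (D : List N.plan.Arc) : TreePlan.arcLen D = N.pathLen (D.map ends) := by
  unfold TreePlan.arcLen pathLen
  rw [List.map_map]
  rfl

theorem depot_val : N.plan.depot.val = 2 :=
  Nat.mod_eq_of_lt (show 2 < N.beads.length + 3 by omega)

theorem depot_ne_zero : N.plan.depot ≠ (0 : Fin (N.beads.length + 3)) := fun h => by
  have := congrArg Fin.val h
  rw [depot_val] at this
  exact absurd this (by simp)

/-- The closed walk visits the leaves of the list, after the depot. -/
structure Visits (w : N.plan.ClosedWalk) (l : List ℕ) : Prop where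
  darts : w.darts.map ends = pairs 2 l
  leaf : ∀ a ∈ l, a ≠ 0 ∧ a ≤ N.beads.length + 2
  last : l.getLastD 2 = 2

theorem exists_visits (w : N.plan.ClosedWalk) : ∃ l, Visits w l := by
  obtain ⟨l, h1, h2, h3⟩ := exists_leaves (n := N.beads.length + 2) w depot_ne_zero depot_ne_zero
  rw [depot_val] at h3
  rw [depot_val] at h1
  exact ⟨l, h1, h2, h3⟩

theorem exists_walk_visits (l : List ℕ) (hl : ∀ a ∈ l, a ≠ 0 ∧ a ≤ N.beads.length + 2)
    (h : l.getLastD 2 = 2) : ∃ w : N.plan.ClosedWalk, Visits w l := by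
  obtain ⟨w, hw⟩ := exists_walk (n := N.beads.length + 2) (u := N.plan.depot) (v := N.plan.depot) l
    depot_ne_zero hl (by rw [depot_val]; exact h)
  rw [depot_val] at hw
  exact ⟨w, hw, hl, h⟩

theorem Visits.support {w : N.plan.ClosedWalk} {l : List ℕ} (h : Visits w l) :
    w.support.map Fin.val = 2 :: l.flatMap fun a => [0, a] := by
  rw [← map_snd_pairs 2, ← h.darts, List.map_map, ← SimpleGraph.Walk.cons_map_snd_darts,
    List.map_cons, List.map_map, depot_val]
  rfl

theorem eq_arc (a : N.plan.Arc) : ∃ b : ℕ, b ≠ 0 ∧ b ≤ N.beads.length + 2 ∧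
    (ends a = (0, b) ∨ ends a = (b, 0)) := by
  obtain ⟨⟨u, v⟩, h⟩ := a
  have h' := (SimpleGraph.starGraph_adj (r := (0 : Fin (N.beads.length + 3)))).1 h
  rcases h' with ⟨h1, h2 | h2⟩
  · subst h2
    exact ⟨v.val, fun h => h1 (Fin.ext h.symm), Nat.lt_succ_iff.1 v.isLt, Or.inl rfl⟩
  · subst h2
    exact ⟨u.val, fun h => h1 (Fin.ext h), Nat.lt_succ_iff.1 u.isLt, Or.inr rfl⟩

theorem exists_arc {b : ℕ} (h0 : b ≠ 0) (hb : b ≤ N.beads.length + 2) :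
    ∃ a : N.plan.Arc, ends a = (0, b) := by
  have : (SimpleGraph.starGraph (0 : Fin (N.beads.length + 3))).Adj 0 ⟨b, Nat.lt_succ_iff.2 hb⟩ :=
    SimpleGraph.starGraph_adj.2 ⟨fun h => h0 (congrArg Fin.val h).symm, Or.inl rfl⟩
  exact ⟨⟨(_, _), this⟩, rfl⟩

theorem freq_eq (a : N.plan.Arc) :
    N.plan.freq a.edge = N.freqs (ends a).1 + N.freqs (ends a).2 := rfl

theorem Visits.count_arc {w : N.plan.ClosedWalk} {l : List ℕ} (h : Visits w l) {b : ℕ} (h0 : b ≠ 0)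
    (a : N.plan.Arc) (ha : ends a = (0, b) ∨ ends a = (b, 0)) : w.darts.count a = l.count b := by
  rw [← List.count_map_of_injective w.darts ends ends_injective, h.darts]
  rcases ha with ha | ha <;> rw [ha]
  · exact count_pairs_zero h0 _ _
  · rw [count_pairs h0, count_dropLast _ _ _ h.last]

theorem pathLen_segment {w : N.plan.ClosedWalk} {l : List ℕ} (h : Visits w l) (a b : ℕ) :
    TreePlan.arcLen (TreePlan.segment w a b) = N.pathLen (((pairs 2 l).take b).drop a) := by
  rw [arcLen_eq, TreePlan.segment, List.map_drop, List.map_take, h.darts]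

theorem cap_mul : N.plan.c * N.plan.L = ((2 ^ (N.width + 1) : ℕ) : ℚ) := by
  have h : ((N.k : ℚ) + 1) ≠ 0 := by positivity
  change (1 / ((N.k : ℚ) + 1)) * (((N.k + 1) * 2 ^ (N.width + 1) : ℕ) : ℚ) = _
  push_cast
  field_simp

theorem Visits.getVert_eq_iff {w : N.plan.ClosedWalk} {l : List ℕ} (h : Visits w l) {m : ℕ}
    (hm : m < (pairs 2 l).length) :
    w.getVert m = N.plan.depot ↔ (pairs 2 l)[m].1 = 2 := by
  have hm' : m < w.darts.length := by
    rw [← h.darts, List.length_map] at hm; exact hm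
  have e1 : (pairs 2 l)[m] = ends w.darts[m] := by
    simp only [← h.darts, List.getElem_map]
  rw [e1, ends, SimpleGraph.Walk.darts_getElem_eq_getVert m hm', ← depot_val, Fin.ext_iff]

/-- The inner vertices of a sub-route are the starts of its arcs other than the first. -/
theorem Visits.capacity_iff {w : N.plan.ClosedWalk} {l : List ℕ} (h : Visits w l) :
    (∀ a b : ℕ, a < b → b ≤ w.length → (∀ m, a < m → m < b → w.getVert m ≠ N.plan.depot) →
      (TreePlan.arcLen (TreePlan.segment w a b) : ℚ) ≤ N.plan.c * N.plan.L) ↔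
    SegBound 2 (2 ^ (N.width + 1)) N.pathLen (pairs 2 l) := by
  have hlen : w.length = (pairs 2 l).length := by
    rw [← h.darts, List.length_map, SimpleGraph.Walk.length_darts]
  rw [hlen]
  simp only [pathLen_segment h, cap_mul, Nat.cast_le]
  constructor
  · intro H A B C hP hB
    rcases B with _ | ⟨q, B⟩
    · exact Nat.zero_le _
    have e : ((pairs 2 l).take (A.length + (B.length + 1))).drop A.length = q :: B := by
      rw [hP, List.append_assoc, List.take_length_add_append, List.drop_left]
      simp
    rw [← e]
    apply H _ _ (by omega)
    · rw [hP]; simp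
    · intro m h1 h2
      have hm : m < (pairs 2 l).length := by rw [hP]; simp; omega
      rw [Ne, h.getVert_eq_iff hm]
      apply hB
      have e2 : (pairs 2 l)[m] = B[m - A.length - 1]'(by omega) := by
        simp only [hP]
        rw [List.getElem_append_left (by simp; omega), List.getElem_append_right (by omega)]
        obtain ⟨d, rfl⟩ := Nat.exists_eq_add_of_lt h1
        simp [show A.length + d + 1 - A.length = d + 1 by omega]
      rw [e2]
      exact List.getElem_mem _
  · intro H a b hab hb hm
    apply H ((pairs 2 l).take a) _ ((pairs 2 l).drop b)
    · conv_lhs => rw [← List.take_append_drop b (pairs 2 l), ← List.take_append_drop a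
        (List.take b (pairs 2 l)), List.take_take, min_eq_left hab.le]
    · intro q hq
      rw [List.tail_drop] at hq
      obtain ⟨i, hi, rfl⟩ := List.mem_iff_getElem.1 hq
      rw [List.length_drop, List.length_take] at hi
      rw [List.getElem_drop, List.getElem_take, Ne, ← h.getVert_eq_iff]
      exact hm _ (by omega) (by omega)

/-- The priority limits drop out: they are all `1`, and no part of a route is longer than the whole.
-/
theorem Visits.isVehicleRoute_iff {w : N.plan.ClosedWalk} {l : List ℕ} (h : Visits w l) :
    TreePlan.IsVehicleRoute w ↔
      (∀ b, b ≠ 0 → b ≤ N.beads.length + 2 → 1 ≤ l.count b ∧ l.count b ≤ N.freqs b) ∧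
      N.pathLen (pairs 2 l) ≤ (N.k + 1) * 2 ^ (N.width + 1) ∧
      SegBound 2 (2 ^ (N.width + 1)) N.pathLen (pairs 2 l) := by
  unfold TreePlan.IsVehicleRoute
  rw [h.capacity_iff]
  have f0 : N.freqs 0 = 0 := rfl
  constructor
  · rintro ⟨ha, hb, -, hd⟩
    refine ⟨fun b h0 hb => ?_, ?_, hd⟩
    · obtain ⟨a, h1⟩ := exists_arc h0 hb
      have := ha a
      rw [h.count_arc h0 a (Or.inl h1), freq_eq, h1] at this
      simpa [f0] using this
    · rw [arcLen_eq, h.darts] at hb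
      exact hb
  · rintro ⟨ha, hb, hd⟩
    refine ⟨fun a => ?_, ?_, ?_, hd⟩
    · obtain ⟨b, h0, h1, h2⟩ := eq_arc a
      have := ha b h0 h1
      rw [h.count_arc h0 a h2, freq_eq]
      rcases h2 with h2 | h2 <;> rw [h2] <;> simpa [f0] using this
    · rw [arcLen_eq, h.darts]
      exact hb
    · intro a b e _ _ _ _
      have h1 : N.plan.limit (N.plan.prio e.edge) ((w.darts.take (a + 1)).count e) = 1 := by
        change (([[1]] : List (List ℚ)).getD 0 []).getD _ _ = 1
        generalize (w.darts.take (a + 1)).count e - 1 = i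
        cases i <;> rfl
      rw [h1, one_mul, pathLen_segment h, Nat.cast_le]
      refine le_trans ?_ hb
      have e := N.pathLen_append ((pairs 2 l).take b) ((pairs 2 l).drop b)
      have e' := N.pathLen_append (((pairs 2 l).take b).take a) (((pairs 2 l).take b).drop a)
      rw [List.take_append_drop] at e e'
      omega

end Necklace

/-! ### Complaints in a star -/

namespace StarWalk

/-- The leaf after `a` in the cyclic order of the leaves `1, …, m + 2`. -/
def nx (m a : ℕ) : ℕ := if a = m + 2 then 1 else a + 1

/-- The leaf before `a` in the cyclic order of the leaves `1, …, m + 2`. -/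
def pv (m a : ℕ) : ℕ := if a = 1 then m + 2 else a - 1

/-- The leaf `b` has a forward complaint in a walk that visits the leaves `V`. -/
def Fwd (m : ℕ) (V : List ℕ) (b : ℕ) : Prop :=
  ∃ A a c B, V = A ++ a :: c :: B ∧ nx m a = b ∧ b ∉ A ++ [a, c]

/-- The leaf `b` has a backward complaint in a walk that visits the leaves `V`. -/
def Bwd (m : ℕ) (V : List ℕ) (b : ℕ) : Prop :=
  ∃ A a c B, V = A ++ a :: c :: B ∧ pv m c = b ∧ b ∉ A ++ [a, c]

theorem next_val {m : ℕ} (l : List (Fin (m + 3))) (hl : l = (List.finRange (m + 2)).map Fin.succ)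
    (v : Fin (m + 3)) (h : v ∈ l) : (l.next v h).val = nx m v.val := by
  subst hl
  have hn : ((List.finRange (m + 2)).map Fin.succ).Nodup :=
    (List.nodup_finRange _).map (Fin.succ_injective _)
  obtain ⟨i, hi, rfl⟩ := List.mem_iff_getElem.1 h
  rw [List.next_getElem _ hn]
  simp only [List.length_map, List.length_finRange, List.getElem_map, List.getElem_finRange] at hi ⊢
  simp only [Fin.val_succ, Fin.val_cast, nx]
  split_ifs with h1
  · obtain rfl : i = m + 1 := by omega
    simp
  · rw [Nat.mod_eq_of_lt (by omega)]

theorem prev_val {m : ℕ} (l : List (Fin (m + 3))) (hl : l = (List.finRange (m + 2)).map Fin.succ)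
    (v : Fin (m + 3)) (h : v ∈ l) : (l.prev v h).val = pv m v.val := by
  subst hl
  have hn : ((List.finRange (m + 2)).map Fin.succ).Nodup :=
    (List.nodup_finRange _).map (Fin.succ_injective _)
  obtain ⟨i, hi, rfl⟩ := List.mem_iff_getElem.1 h
  rw [List.prev_getElem _ hn]
  simp only [List.length_map, List.length_finRange, List.getElem_map, List.getElem_finRange] at hi ⊢
  simp only [Fin.val_succ, Fin.val_cast, pv]
  split_ifs with h1
  · obtain rfl : i = 0 := by omega
    rw [Nat.mod_eq_of_lt (by omega)]; omega
  · rw [show i + (m + 2 - 1) = i - 1 + (m + 2) by omega, Nat.add_mod_right,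
      Nat.mod_eq_of_lt (by omega)]
    omega

end StarWalk

namespace Necklace

open StarWalk

variable {N : Necklace}

variable (N) in
/-- The centre of the star. -/
def centre : Fin N.plan.n := (0 : Fin (N.beads.length + 3))

theorem order_of_eq_zero {v : Fin N.plan.n} (h : v = N.centre) :
    N.plan.order v = (List.finRange (N.beads.length + 2)).map Fin.succ := by
  subst h; exact N.order_zero

theorem order_of_ne_zero {v : Fin N.plan.n} (h : v ≠ N.centre) :
    N.plan.order v = [(0 : Fin (N.beads.length + 3))] := by
  obtain ⟨u, rfl⟩ := Fin.exists_succ_eq.2 h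
  exact N.order_succ u

/-- A leaf has only one neighbour, so the edge that follows an arc there is the edge of the arc
itself, which is used already. Hence complaints arise at the centre only. -/
theorem nextEdge_eq_edge (e : N.plan.Arc) (h : (ends e).2 ≠ 0) :
    TreePlan.nextEdge e = e.edge := by
  have hs : e.snd ≠ N.centre := fun h' => h (congrArg Fin.val h')
  have hf : e.fst = N.centre := by
    have := (SimpleGraph.starGraph_adj (r := (0 : Fin (N.beads.length + 3)))).1 e.adj
    exact this.2.resolve_right hs
  have key (l : List (Fin (N.beads.length + 3))) (hl : l = [0]) (v) (h : v ∈ l) :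
      l.next v h = 0 := by subst hl; exact List.next_singleton _ _ _
  unfold TreePlan.nextEdge
  refine (congrArg (fun y => s(e.snd, y)) ((key _ (order_of_ne_zero hs) _ _).trans hf.symm)).trans ?_
  exact Sym2.eq_swap

theorem prevEdge_eq_edge (e : N.plan.Arc) (h : (ends e).1 ≠ 0) :
    TreePlan.prevEdge e = e.edge := by
  have hs : e.fst ≠ N.centre := fun h' => h (congrArg Fin.val h')
  have hf : e.snd = N.centre := by
    have := (SimpleGraph.starGraph_adj (r := (0 : Fin (N.beads.length + 3)))).1 e.adj
    exact this.2.resolve_left hs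
  have key (l : List (Fin (N.beads.length + 3))) (hl : l = [0]) (v) (h : v ∈ l) :
      l.prev v h = 0 := by subst hl; exact List.prev_singleton _ _ _
  unfold TreePlan.prevEdge
  exact congrArg (fun y => s(e.fst, y)) ((key _ (order_of_ne_zero hs) _ _).trans hf.symm)

theorem nextEdge_eq_iff (e : N.plan.Arc) (h : (ends e).2 = 0) (x : Sym2 (Fin N.plan.n)) :
    TreePlan.nextEdge e = x ↔ ∃ y : Fin N.plan.n,
      x = s(N.centre, y) ∧ nx N.beads.length (ends e).1 = y := by
  have hs : e.snd = N.centre := Fin.ext h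
  have h1 := next_val _ (order_of_eq_zero hs) e.fst ((N.plan.mem_order _ _).2 e.adj.symm)
  have h2 : TreePlan.nextEdge e = s(N.centre, (N.plan.order e.snd).next e.fst
      ((N.plan.mem_order _ _).2 e.adj.symm)) := by
    unfold TreePlan.nextEdge
    exact congrArg (fun y => s(y, _)) hs
  rw [h2]
  constructor
  · rintro rfl
    exact ⟨_, rfl, h1.symm⟩
  · rintro ⟨y, rfl, h3⟩
    exact congrArg (fun y => s(N.centre, y)) (Fin.ext (h1.trans h3))

theorem prevEdge_eq_iff (e : N.plan.Arc) (h : (ends e).1 = 0) (x : Sym2 (Fin N.plan.n)) :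
    TreePlan.prevEdge e = x ↔ ∃ y : Fin N.plan.n,
      x = s(N.centre, y) ∧ pv N.beads.length (ends e).2 = y := by
  have hs : e.fst = N.centre := Fin.ext h
  have h1 := prev_val _ (order_of_eq_zero hs) e.snd ((N.plan.mem_order _ _).2 e.adj)
  have h2 : TreePlan.prevEdge e = s(N.centre, (N.plan.order e.fst).prev e.snd
      ((N.plan.mem_order _ _).2 e.adj)) := by
    unfold TreePlan.prevEdge
    exact congrArg (fun y => s(y, _)) hs
  rw [h2]
  constructor
  · rintro rfl
    exact ⟨_, rfl, h1.symm⟩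
  · rintro ⟨y, rfl, h3⟩
    exact congrArg (fun y => s(N.centre, y)) (Fin.ext (h1.trans h3))

theorem edge_eq_iff (e : N.plan.Arc) (y : Fin N.plan.n) :
    e.edge = s(N.centre, y) ↔ ends e = (0, y.val) ∨ ends e = (y.val, 0) := by
  obtain ⟨⟨u, v⟩, h⟩ := e
  have e1 : (SimpleGraph.Dart.edge (G := N.plan.graph) ⟨(u, v), h⟩) = s(u, v) := rfl
  rw [e1]
  refine (Sym2.eq_iff (α := Fin N.plan.n)).trans ?_
  simp only [ends, Prod.mk.injEq]
  constructor <;> rintro (⟨h1, h2⟩ | ⟨h1, h2⟩)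
  · exact Or.inl ⟨congrArg Fin.val h1, congrArg Fin.val h2⟩
  · exact Or.inr ⟨congrArg Fin.val h1, congrArg Fin.val h2⟩
  · exact Or.inl ⟨Fin.ext h1, Fin.ext h2⟩
  · exact Or.inr ⟨Fin.ext h1, Fin.ext h2⟩

variable {w : N.plan.ClosedWalk} {l : List ℕ}

/-- The first `2 * A.length + 2` arcs are those up to the arrival at `c`, and an edge is used as
soon as its leaf is visited. -/
theorem Visits.usedWithin_iff (h : Visits w l) (y : Fin N.plan.n) (hy : y.val ≠ 0)
    {A B : List ℕ} {a c : ℕ} (hl : 2 :: l = A ++ a :: c :: B) :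
    TreePlan.UsedWithin w (2 * A.length + 2) s(N.centre, y) ↔
      y.val ∈ A ++ [a, c] := by
  have e1 : (w.darts.take (2 * A.length + 2)).map ends = pairs 2 (l.take (A.length + 1)) := by
    rw [List.map_take, h.darts, ← take_pairs]; rfl
  have e2 : 2 :: l.take (A.length + 1) = A ++ [a, c] := by
    rw [← List.take_succ_cons, hl, add_assoc, List.take_length_add_append]
    rfl
  have e3 : l.take (A.length + 1) ≠ [] := by
    intro h0
    have := congrArg List.length e2
    rw [h0] at this
    simp at this
  rw [← e2, ← mem_pairs hy _ _ e3, ← e1]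
  unfold TreePlan.UsedWithin
  simp only [List.mem_map, edge_eq_iff]
  constructor
  · rintro ⟨d, h1, h2 | h2⟩
    · exact Or.inl ⟨d, h1, h2⟩
    · exact Or.inr ⟨d, h1, h2⟩
  · rintro (⟨d, h1, h2⟩ | ⟨d, h1, h2⟩)
    · exact ⟨d, h1, Or.inl h2⟩
    · exact ⟨d, h1, Or.inr h2⟩

theorem Visits.getElem?_darts (h : Visits w l) {i : ℕ} (hi : i < w.darts.length) :
    (pairs 2 l)[i]? = some (ends w.darts[i]) := by
  rw [← h.darts, List.getElem?_map, List.getElem?_eq_getElem hi]; rfl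

theorem Visits.length_darts (h : Visits w l) : w.darts.length = 2 * l.length := by
  rw [← length_pairs 2, ← h.darts, List.length_map]

/-- At an even position an arc leads from a leaf `a` to the centre and the walk goes on to a leaf
`c`, which is the pattern in `Fwd`. An arc at an odd position ends in a leaf and causes no
complaint. -/
theorem Visits.forwardComplaint_iff (h : Visits w l) (x : Sym2 (Fin N.plan.n)) :
    TreePlan.ForwardComplaint w x ↔ ∃ y : Fin N.plan.n,
      x = s(N.centre, y) ∧ Fwd N.beads.length (2 :: l) y.val := by
  have nx0 (a : ℕ) : nx N.beads.length a ≠ 0 := by unfold nx; split_ifs <;> omega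
  constructor
  · rintro ⟨i, hi, h1, h2⟩
    have hi' : i < w.darts.length := by omega
    have h3 := h.getElem?_darts hi'
    obtain ⟨j, rfl | rfl⟩ := i.even_or_odd'
    · obtain ⟨h4, A, c, B, h5, rfl⟩ := getElem?_pairs_even _ _ _ _ _ h3
      rw [nextEdge_eq_iff _ h4] at h1
      obtain ⟨y, rfl, h6⟩ := h1
      refine ⟨y, rfl, A, _, c, B, h5, h6, ?_⟩
      rwa [h.usedWithin_iff y (by rw [← h6]; exact nx0 _) h5] at h2
    · obtain ⟨-, A, c, B, h5, -⟩ := getElem?_pairs_odd _ _ _ _ _ h3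
      have h4 : (ends w.darts[2 * j + 1]).2 ≠ 0 := by
        have : (ends w.darts[2 * j + 1]).2 ∈ 2 :: l := by rw [h5]; exact List.mem_append_right _ (by simp [ends])
        rcases List.mem_cons.1 this with h6 | h6
        · rw [h6]; simp
        · exact (h.leaf _ h6).1
      rw [nextEdge_eq_edge _ h4] at h1
      refine absurd ⟨_, ?_, h1⟩ h2
      exact List.mem_take_iff_getElem.2 ⟨2 * j + 1, by omega, rfl⟩
  · rintro ⟨y, rfl, A, a, c, B, h1, h2, h3⟩
    have hlen : 2 * A.length + 1 < w.darts.length := by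
      have := congrArg List.length h1
      rw [h.length_darts]
      simp at this
      omega
    have h4 := (getElem?_pairs_of_eq _ _ _ _ _ _ h1).1
    rw [h.getElem?_darts (by omega), Option.some.injEq] at h4
    refine ⟨2 * A.length, hlen, ?_, ?_⟩
    · rw [nextEdge_eq_iff _ (by rw [h4])]
      exact ⟨y, rfl, by rw [h4]; exact h2⟩
    · rwa [h.usedWithin_iff y (by rw [← h2]; exact nx0 _) h1]

theorem Visits.backwardComplaint_iff (h : Visits w l) (x : Sym2 (Fin N.plan.n)) :
    TreePlan.BackwardComplaint w x ↔ ∃ y : Fin N.plan.n,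
      x = s(N.centre, y) ∧ Bwd N.beads.length (2 :: l) y.val := by
  have pv0 {a : ℕ} (ha : a ∈ 2 :: l) : pv N.beads.length a ≠ 0 := by
    have h0 : a ≠ 0 := by
      rcases List.mem_cons.1 ha with rfl | ha
      · simp
      · exact (h.leaf a ha).1
    unfold pv; split_ifs <;> omega
  constructor
  · rintro ⟨i, hi, h1, h2⟩
    have h3 := h.getElem?_darts hi
    obtain ⟨j, rfl | rfl⟩ := i.even_or_odd'
    · obtain ⟨h4, A, c, B, h5, rfl⟩ := getElem?_pairs_odd _ _ _ _ _ h3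
      rw [prevEdge_eq_iff _ h4] at h1
      obtain ⟨y, rfl, h6⟩ := h1
      refine ⟨y, rfl, A, c, _, B, h5, h6, ?_⟩
      rwa [h.usedWithin_iff y (by rw [← h6]; exact pv0 (by rw [h5]; exact List.mem_append_right _ (by simp [ends]))) h5] at h2
    · obtain ⟨-, A, c, B, h5, -⟩ := getElem?_pairs_even (j := j + 1) _ _ _ _ h3
      have h4 : (ends w.darts[2 * j + 1 + 1]).1 ≠ 0 := by
        have : (ends w.darts[2 * j + 1 + 1]).1 ∈ 2 :: l := by rw [h5]; exact List.mem_append_right _ (by simp [ends])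
        rcases List.mem_cons.1 this with h6 | h6
        · rw [h6]; simp
        · exact (h.leaf _ h6).1
      rw [prevEdge_eq_edge _ h4] at h1
      refine absurd ⟨_, ?_, h1⟩ h2
      exact List.mem_take_iff_getElem.2 ⟨2 * j + 1 + 1, by omega, rfl⟩
  · rintro ⟨y, rfl, A, a, c, B, h1, h2, h3⟩
    have hlen : 2 * A.length + 1 < w.darts.length := by
      have := congrArg List.length h1
      rw [h.length_darts]
      simp at this
      omega
    have h4 := (getElem?_pairs_of_eq _ _ _ _ _ _ h1).2
    rw [h.getElem?_darts (by omega), Option.some.injEq] at h4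
    refine ⟨2 * A.length, hlen, ?_, ?_⟩
    · rw [prevEdge_eq_iff _ (by rw [h4])]
      exact ⟨y, rfl, by rw [h4]; exact h2⟩
    · rwa [h.usedWithin_iff y (by rw [← h2]; exact pv0 (by rw [h1]; simp)) h1]

theorem ncard_edges (P : ℕ → Prop) (hP : ∀ b, P b → b ≤ N.beads.length + 2) :
    {x : Sym2 (Fin N.plan.n) | ∃ y : Fin N.plan.n,
      x = s(N.centre, y) ∧ P y.val}.ncard = {b | P b}.ncard := by
  have e1 : {b | P b} = Fin.val '' {y : Fin N.plan.n | P y.val} := by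
    ext b
    constructor
    · intro h
      exact ⟨⟨b, Nat.lt_succ_iff.2 (hP b h)⟩, h, rfl⟩
    · rintro ⟨y, h, rfl⟩
      exact h
  have e2 : {x : Sym2 (Fin N.plan.n) | ∃ y : Fin N.plan.n,
      x = s(N.centre, y) ∧ P y.val} =
      (fun y => s(N.centre, y)) '' {y | P y.val} := by
    ext x
    constructor
    · rintro ⟨y, rfl, h⟩
      exact ⟨y, h, rfl⟩
    · rintro ⟨y, h, rfl⟩
      exact ⟨y, rfl, h⟩
  rw [e1, e2, Set.ncard_image_of_injective _ Fin.val_injective]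
  exact Set.ncard_image_of_injective _ fun a b h => Sym2.congr_right.1 h

theorem Visits.nx_le (h : Visits w l) {b : ℕ} (hb : Fwd N.beads.length (2 :: l) b) :
    b ≤ N.beads.length + 2 := by
  obtain ⟨A, a, c, B, h1, rfl, -⟩ := hb
  have : a ∈ 2 :: l := by rw [h1]; simp
  have : a ≤ N.beads.length + 2 := by
    rcases List.mem_cons.1 this with h6 | h6
    · omega
    · exact (h.leaf _ h6).2
  unfold nx
  split_ifs <;> omega

theorem Visits.pv_le (h : Visits w l) {b : ℕ} (hb : Bwd N.beads.length (2 :: l) b) :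
    b ≤ N.beads.length + 2 := by
  obtain ⟨A, a, c, B, h1, rfl, -⟩ := hb
  have : c ∈ 2 :: l := by rw [h1]; simp
  have : c ≤ N.beads.length + 2 := by
    rcases List.mem_cons.1 this with h6 | h6
    · omega
    · exact (h.leaf _ h6).2
  unfold pv
  split_ifs <;> omega

theorem Visits.unfairness_eq (h : Visits w l) : TreePlan.unfairness w =
    {b | Fwd N.beads.length (2 :: l) b}.ncard + {b | Bwd N.beads.length (2 :: l) b}.ncard := by
  unfold TreePlan.unfairness
  rw [← ncard_edges _ fun b => h.nx_le, ← ncard_edges _ fun b => h.pv_le]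
  simp only [h.forwardComplaint_iff, h.backwardComplaint_iff]

end Necklace

/-! ### Tours of a route -/

namespace StarWalk

/-- The leaves visited by a sequence of tours, each of which ends in the depot `2`. -/
def leaves (T : List (List ℕ)) : List ℕ := T.flatMap (· ++ [2])

theorem leaves_cons (t : List ℕ) (T : List (List ℕ)) : leaves (t :: T) = t ++ 2 :: leaves T := by
  simp [leaves]

theorem leaves_append (T T' : List (List ℕ)) : leaves (T ++ T') = leaves T ++ leaves T' := by
  simp [leaves]

theorem getLastD_append (l l' : List ℕ) (u : ℕ) :
    (l ++ l').getLastD u = l'.getLastD (l.getLastD u) := by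
  induction l generalizing u with
  | nil => rfl
  | cons a l ih => rw [List.cons_append, List.getLastD_cons, List.getLastD_cons, ih]

theorem getLastD_leaves (T : List (List ℕ)) : (leaves T).getLastD 2 = 2 := by
  induction T using List.reverseRecOn with
  | nil => rfl
  | append_singleton T t ih =>
    rw [leaves_append, leaves_cons, getLastD_append]
    simp [leaves]

theorem exists_leaves_append (l : List ℕ) :
    ∃ T t, l = leaves T ++ t ∧ 2 ∉ t ∧ ∀ s ∈ T, 2 ∉ s := by
  induction l using List.reverseRecOn with
  | nil => exact ⟨[], [], rfl, by simp, by simp⟩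
  | append_singleton l a ih =>
    obtain ⟨T, t, rfl, h1, h2⟩ := ih
    by_cases ha : a = 2
    · subst ha
      refine ⟨T ++ [t], [], ?_, by simp, ?_⟩
      · simp [leaves]
      · intro s hs
        rcases List.mem_append.1 hs with hs | hs
        · exact h2 s hs
        · rw [List.mem_singleton.1 hs]; exact h1
    · refine ⟨T, t ++ [a], by simp, ?_, h2⟩
      simp [h1, Ne.symm ha]

theorem exists_eq_leaves (l : List ℕ) (h : l.getLastD 2 = 2) :
    ∃ T, l = leaves T ∧ ∀ s ∈ T, 2 ∉ s := by
  obtain ⟨T, t, rfl, h1, h2⟩ := exists_leaves_append l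
  rcases List.eq_nil_or_concat t with rfl | ⟨t', a, rfl⟩
  · exact ⟨T, by simp, h2⟩
  · rw [List.concat_eq_append, ← List.append_assoc, getLastD_append] at h
    simp at h h1
    exact absurd h.symm h1.2

theorem count_leaves_of_ne {a : ℕ} (ha : a ≠ 2) (T : List (List ℕ)) :
    (leaves T).count a = T.flatten.count a := by
  induction T with
  | nil => rfl
  | cons t T ih =>
    rw [leaves_cons, List.count_append, List.count_cons_of_ne ha.symm, ih, List.flatten_cons,
      List.count_append]

theorem count_leaves_two (T : List (List ℕ)) (h : ∀ s ∈ T, 2 ∉ s) :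
    (leaves T).count 2 = T.length := by
  induction T with
  | nil => rfl
  | cons t T ih =>
    rw [leaves_cons, List.count_append, List.count_cons_self,
      ih fun s hs => h s (List.mem_cons_of_mem _ hs), List.count_eq_zero.2 (h t (by simp))]
    simp

theorem pairs_leaves (T : List (List ℕ)) :
    pairs 2 (leaves T) = (T.map fun t => pairs 2 (t ++ [2])).flatten := by
  induction T with
  | nil => rfl
  | cons t T ih =>
    rw [leaves_cons, List.append_cons, pairs_append, getLastD_append]
    change pairs 2 (t ++ [2]) ++ pairs 2 (leaves T) = _
    rw [ih]
    rfl

theorem fst_mem_pairs (u b : ℕ) (t : List ℕ) (q : ℕ × ℕ) (hq : q ∈ pairs u (t ++ [b])) :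
    q.1 = u ∨ q.1 = 0 ∨ q.1 ∈ t := by
  induction t generalizing u with
  | nil =>
    simp only [List.nil_append, pairs, List.mem_cons, List.not_mem_nil, or_false] at hq
    rcases hq with rfl | rfl <;> simp
  | cons a t ih =>
    simp only [List.cons_append, pairs, List.mem_cons] at hq
    rcases hq with rfl | rfl | hq
    · simp
    · simp
    · have := ih _ hq
      simp only [List.mem_cons]
      tauto

theorem fst_mem_tail_pairs (u b : ℕ) (t : List ℕ) (q : ℕ × ℕ)
    (hq : q ∈ (pairs u (t ++ [b])).tail) : q.1 = 0 ∨ q.1 ∈ t := by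
  cases t with
  | nil =>
    simp only [List.nil_append, pairs, List.tail_cons, List.mem_cons, List.not_mem_nil,
      or_false] at hq
    left; rw [hq]
  | cons a t =>
    simp only [List.cons_append, pairs, List.tail_cons, List.mem_cons] at hq
    rcases hq with rfl | hq
    · simp
    · have := fst_mem_pairs _ _ _ _ hq
      simp only [List.mem_cons]
      tauto

/-- Every block begins with an arc that leaves `s`. A part of the sequence in which no arc after the
first leaves `s` therefore cannot run from one block into the next. -/
theorem segBound_flatten {s b : ℕ} {len : List (ℕ × ℕ) → ℕ}
    (hlen : ∀ P Q, len (P ++ Q) = len P + len Q) (Bs : List (List (ℕ × ℕ)))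
    (h : ∀ P ∈ Bs, len P ≤ b ∧ ∃ q P', P = q :: P' ∧ q.1 = s) : SegBound s b len Bs.flatten := by
  have nil : len [] = 0 := by have := hlen [] []; simp at this; exact this
  induction Bs with
  | nil =>
    intro A B C hP hB
    have : B = [] := by
      have := hP.symm
      simp only [List.flatten_nil, List.append_eq_nil_iff] at this
      exact this.1.2
    rw [this, nil]
    exact Nat.zero_le _
  | cons P Bs ih =>
    intro A B C hP hB
    have ih := ih fun Q hQ => h Q (List.mem_cons_of_mem _ hQ)
    obtain ⟨hb, -⟩ := h P (by simp)
    rw [List.flatten_cons, List.append_assoc] at hP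
    rcases List.append_eq_append_iff.1 hP with ⟨A', h1, h2⟩ | ⟨X, h1, h2⟩
    · exact ih A' B C (by rw [h2, List.append_assoc]) hB
    · rcases List.append_eq_append_iff.1 h2 with ⟨Y, h3, h4⟩ | ⟨Y, h3, h4⟩
      · rw [h1, h3, hlen, hlen] at hb
        omega
      · rcases Y with _ | ⟨y, Y⟩
        · rw [h1, hlen] at hb
          rw [h3, List.append_nil]
          omega
        · have hy : y.1 = s := by
            cases Bs with
            | nil => simp at h4
            | cons Q Bs =>
              obtain ⟨-, q, Q', rfl, hq⟩ := h Q (by simp)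
              simp only [List.flatten_cons, List.cons_append, List.cons.injEq] at h4
              rw [← h4.1]; exact hq
          have hX : X = [] := by
            rcases X with _ | ⟨x, X⟩
            · rfl
            · exfalso
              refine hB y ?_ hy
              rw [h3]; simp
          subst hX
          exact ih [] B C (by rw [h3, h4]; rfl) hB

end StarWalk

/-- A missing or smaller summand would make the sum too small. It is applied to the weights of the
tours, with `W = load` and `K = k + 1`. -/
theorem eq_of_sum_eq_mul {l : List ℕ} {W K : ℕ} (hW : 0 < W) (hl : ∀ x ∈ l, x ≤ W)
    (hK : l.length ≤ K) (hs : l.sum = K * W) : l.length = K ∧ ∀ x ∈ l, x = W := by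
  have le (l : List ℕ) (hl : ∀ x ∈ l, x ≤ W) : l.sum ≤ l.length * W := by
    simpa using List.sum_le_card_nsmul l W hl
  have h1 : l.length = K := le_antisymm hK <| by
    have := le l hl
    rw [hs] at this
    exact Nat.le_of_mul_le_mul_right this hW
  refine ⟨h1, fun x hx => le_antisymm (hl x hx) ?_⟩
  obtain ⟨A, B, rfl⟩ := List.append_of_mem hx
  have hA := le A fun y hy => hl y (by simp [hy])
  have hB := le B fun y hy => hl y (by simp [hy])
  rw [← h1] at hs
  simp only [List.sum_append, List.sum_cons, List.length_append, List.length_cons, add_mul,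
    one_mul] at hs
  omega

/-- Uniqueness of digits in base `2 ^ B`: division by the highest place value isolates the highest
digit, since `sum_blocks_lt` bounds the rest. -/
theorem eq_of_sum_blocks_eq {B : ℕ} (a b : ℕ → ℕ) (n : ℕ) (ha : ∀ r < n, a r < 2 ^ B)
    (hb : ∀ r < n, b r < 2 ^ B)
    (h : ∑ r ∈ Finset.range n, a r * 2 ^ (B * (r + 1)) =
      ∑ r ∈ Finset.range n, b r * 2 ^ (B * (r + 1))) : ∀ r < n, a r = b r := by
  induction n with
  | zero => intro r hr; omega
  | succ n ih =>
    have h1 := Necklace.sum_blocks_lt a n fun r hr => ha r (by omega)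
    have h2 := Necklace.sum_blocks_lt b n fun r hr => hb r (by omega)
    rw [Finset.sum_range_succ, Finset.sum_range_succ] at h
    have hp : 0 < 2 ^ (B * (n + 1)) := by positivity
    have h3 := congrArg (· / 2 ^ (B * (n + 1))) h
    simp only [Nat.add_mul_div_right _ _ hp, Nat.div_eq_of_lt h1, Nat.div_eq_of_lt h2,
      zero_add] at h3
    rw [h3] at h
    intro r hr
    rcases Nat.lt_succ_iff_lt_or_eq.1 hr with hr | rfl
    · exact ih (fun r hr => ha r (by omega)) (fun r hr => hb r (by omega)) (by omega) r hr
    · exact h3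

/-! ### The tours of a route are the parts of a splitting -/

namespace Necklace

open StarWalk

variable (N : Necklace)

/-- The total length of the edges of the leaves of a tour. -/
def tourLen (t : List ℕ) : ℕ := (t.map N.weight).sum

/-- The colour of the bead with leaf `a`. -/
def leafColor (a : ℕ) : ℕ := N.beads.getD (a - 3) 0

theorem tourLen_append (s t : List ℕ) : N.tourLen (s ++ t) = N.tourLen s + N.tourLen t := by
  simp [tourLen]

theorem tourLen_cons (a : ℕ) (t : List ℕ) : N.tourLen (a :: t) = N.weight a + N.tourLen t := by
  simp [tourLen]

theorem tourLen_flatten (T : List (List ℕ)) : N.tourLen T.flatten = (T.map N.tourLen).sum := by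
  induction T with
  | nil => rfl
  | cons t T ih => rw [List.flatten_cons, tourLen_append, ih]; simp

/-- The edge of an inner leaf is run in both directions, the edges of the two ends in one direction
each. -/
theorem pathLen_pairs (u b : ℕ) (t : List ℕ) :
    N.pathLen (pairs u (t ++ [b])) = N.weight u + 2 * N.tourLen t + N.weight b := by
  have w0 : N.weight 0 = 0 := rfl
  induction t generalizing u with
  | nil => simp [pairs, pathLen, tourLen, w0]
  | cons a t ih =>
    have := ih a
    rw [List.cons_append, pairs, tourLen_cons]
    have e : N.pathLen ((u, 0) :: (0, a) :: pairs a (t ++ [b])) =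
        N.weight u + N.weight a + N.pathLen (pairs a (t ++ [b])) := by
      simp [pathLen, w0]; ring
    rw [e, this]; ring

theorem weight_leaf {a : ℕ} (ha : 3 ≤ a) : N.weight a = N.edgeLen (N.leafColor a) := by
  obtain ⟨i, rfl⟩ := Nat.exists_eq_add_of_le' ha
  rfl

theorem leafColor_lt_ell (a : ℕ) : N.leafColor a < N.ell := by
  unfold leafColor
  rw [List.getD_eq_getElem?_getD]
  by_cases h : a - 3 < N.beads.length
  · rw [List.getElem?_eq_getElem h]
    exact N.color_lt_ell (List.getElem_mem h)
  · rw [List.getElem?_eq_none (by omega)]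
    exact (Nat.zero_le _).trans_lt N.k_lt_ell

theorem tourLen_eq_sum (t : List ℕ) (ht : ∀ a ∈ t, 3 ≤ a) : N.tourLen t =
    ∑ r ∈ Finset.range N.ell, t.countP (fun a => N.leafColor a = r) * N.edgeLen r := by
  induction t with
  | nil => simp [tourLen]
  | cons a t ih =>
    have e (r : ℕ) : (a :: t).countP (fun a => N.leafColor a = r) * N.edgeLen r =
        t.countP (fun a => N.leafColor a = r) * N.edgeLen r +
          if N.leafColor a = r then N.edgeLen r else 0 := by
      rw [List.countP_cons]
      split_ifs with h h' h' <;> simp_all [add_mul]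
    rw [tourLen_cons, N.weight_leaf (ht a (by simp)), ih fun b hb => ht b (List.mem_cons_of_mem _ hb)]
    simp only [e]
    rw [Finset.sum_add_distrib, Finset.sum_ite_eq, if_pos (Finset.mem_range.2 (N.leafColor_lt_ell a))]
    ring

theorem sum_mul_edgeLen (f : ℕ → ℕ) (n : ℕ) : ∑ r ∈ Finset.range n, f r * N.edgeLen r =
    ∑ r ∈ Finset.range n, N.k * f r * 2 ^ (N.ell * (r + 1)) :=
  Finset.sum_congr rfl fun r _ => by unfold edgeLen; ring

theorem map_leafColor : (List.range' 3 N.beads.length).map N.leafColor = N.beads := by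
  apply List.ext_getElem
  · simp
  · intro i h1 h2
    simp [leafColor, h2]

theorem countP_leafColor (r : ℕ) :
    (List.range' 3 N.beads.length).countP (fun a => N.leafColor a = r) = N.beads.count r := by
  conv_rhs => rw [← N.map_leafColor, List.count, List.countP_map]
  rfl

theorem tourLen_range' : N.tourLen (List.range' 3 N.beads.length) = N.k * N.load := by
  rw [tourLen_eq_sum _ _ fun a ha => (List.mem_range'_1.1 ha).1, sum_mul_edgeLen, load,
    Finset.mul_sum]
  exact Finset.sum_congr rfl fun r _ => by rw [countP_leafColor]; ring

/-- The tours `T₁`, followed by a tour to the leaf `1` only, followed by the tours `T₂`, visit every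
bead once, and each tour visits the beads of one part of a splitting. -/
structure Tours (T₁ T₂ : List (List ℕ)) : Prop where
  length_eq : T₁.length + T₂.length = N.k
  perm : (T₁ ++ T₂).flatten.Perm (List.range' 3 N.beads.length)
  color : ∀ t ∈ T₁ ++ T₂, ∀ r, t.countP (fun a => N.leafColor a = r) = N.beads.count r / N.k

variable {N}

/-- The exponents start at `ell` rather than `0` for the sake of this parity, which absorbs the
slack in the bound for a tour. -/
theorem two_dvd_pow (r : ℕ) : 2 ∣ 2 ^ (N.ell * (r + 1)) :=
  dvd_pow_self 2 (Nat.mul_ne_zero (by have := N.k_lt_ell; omega) (by omega))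

theorem two_dvd_load : 2 ∣ N.load :=
  Finset.dvd_sum fun r _ => (two_dvd_pow r).mul_left _

theorem weight_of_ne {a : ℕ} (h0 : a ≠ 0) (h2 : a ≠ 2) : 2 ∣ N.weight a ∧ 0 < N.weight a := by
  match a, h0, h2 with
  | 1, _, _ => exact ⟨two_dvd_load, N.load_pos⟩
  | i + 3, _, _ => exact ⟨(two_dvd_pow _).mul_left _, N.edgeLen_pos _⟩

theorem two_dvd_tourLen (t : List ℕ) (h : ∀ a ∈ t, a ≠ 0 ∧ a ≠ 2) : 2 ∣ N.tourLen t := by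
  apply List.dvd_sum
  intro x hx
  obtain ⟨a, ha, rfl⟩ := List.mem_map.1 hx
  exact (weight_of_ne (h a ha).1 (h a ha).2).1

theorem tourLen_perm {s t : List ℕ} (h : s.Perm t) : N.tourLen s = N.tourLen t :=
  (h.map _).sum_eq

theorem count_range' (a : ℕ) : (List.range' 3 N.beads.length).count a =
    if 3 ≤ a ∧ a ≤ N.beads.length + 2 then 1 else 0 := by
  have hn : (List.range' 3 N.beads.length).Nodup := List.nodup_range'
  rw [hn.count]
  refine if_congr ?_ rfl rfl
  rw [List.mem_range'_1]; omega

/-- The capacity bounds the weight of a tour by `load`, the depot frequency bounds the number of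
tours by `k + 1`, and the total weight is `(k + 1) * load`. So equality holds throughout, and the
digits of the weight of a tour count its beads of each colour. -/
theorem Visits.exists_tours {w : N.plan.ClosedWalk} {l : List ℕ} (h : Visits w l)
    (hw : TreePlan.IsVehicleRoute w) :
    ∃ T₁ T₂, N.Tours T₁ T₂ ∧ l = leaves (T₁ ++ [1] :: T₂) := by
  obtain ⟨hc, -, hs⟩ := h.isVehicleRoute_iff.1 hw
  obtain ⟨T, rfl, hT⟩ := exists_eq_leaves l h.last
  have hcard : T.length ≤ N.k + 1 := by
    rw [← count_leaves_two T hT]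
    exact (hc 2 (by omega) (by omega)).2
  have hmem {t : List ℕ} (ht : t ∈ T) {a : ℕ} (ha : a ∈ t) :
      a ≠ 0 ∧ a ≠ 2 ∧ a ≤ N.beads.length + 2 := by
    have := h.leaf a (List.mem_flatMap.2 ⟨t, ht, by simp [ha]⟩)
    exact ⟨this.1, fun h2 => hT t ht (h2 ▸ ha), this.2⟩
  -- For every leaf but the depot the frequency bound is `1`, so it is visited exactly once.
  have hperm : T.flatten.Perm (1 :: List.range' 3 N.beads.length) := by
    rw [List.perm_iff_count]
    intro a
    rw [List.count_cons, count_range']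
    by_cases ha : a ≠ 0 ∧ a ≠ 2 ∧ a ≤ N.beads.length + 2
    · rw [← count_leaves_of_ne ha.2.1]
      have h1 := hc a ha.1 ha.2.2
      have h2 : N.freqs a = 1 := by
        match a, ha with
        | 1, _ => rfl
        | i + 3, _ => rfl
      rw [h2] at h1
      have h3 : (leaves T).count a = 1 := by omega
      rw [h3]
      by_cases h4 : a = 1
      · simp [h4]
      · rw [if_pos (by omega), if_neg (by simpa using Ne.symm h4)]
    · rw [List.count_eq_zero.2]
      · have h1 : a ≠ 1 := by omega
        rw [if_neg (by omega), if_neg (by simpa using h1.symm)]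
      · intro hm
        obtain ⟨t, ht, hat⟩ := List.mem_flatten.1 hm
        exact ha (hmem ht hat)
  have hsum : (T.map N.tourLen).sum = (N.k + 1) * N.load := by
    rw [← tourLen_flatten, tourLen_perm hperm, tourLen_cons, tourLen_range']
    change N.load + _ = _
    ring
  have hle : ∀ x ∈ T.map N.tourLen, x ≤ N.load := by
    intro x hx
    obtain ⟨t, ht, rfl⟩ := List.mem_map.1 hx
    obtain ⟨X, Y, hXY⟩ := List.append_of_mem ht
    have h1 := hs (pairs 2 (leaves X)) (pairs 2 (t ++ [2])) (pairs 2 (leaves Y)) (by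
      rw [pairs_leaves, hXY, pairs_leaves, pairs_leaves]; simp) (by
      intro q hq
      rcases fst_mem_tail_pairs _ _ _ _ hq with h0 | h0
      · omega
      · exact (hmem ht h0).2.1)
    -- Now `2 * (depotLen + weight) ≤ 2 * (depotLen + load + 1)`. The weight is thus at most `load +
    -- 1`, and as both are even, at most `load`.
    rw [pathLen_pairs, pow_succ] at h1
    have h2 : N.weight 2 = N.depotLen := rfl
    have h3 := N.depotLen_add
    have h4 : 2 ∣ N.tourLen t := two_dvd_tourLen t fun a ha => ⟨(hmem ht ha).1, (hmem ht ha).2.1⟩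
    have h5 := two_dvd_load (N := N)
    omega
  obtain ⟨hlen, heq⟩ := eq_of_sum_eq_mul N.load_pos hle (by simpa using hcard) hsum
  rw [List.length_map] at hlen
  obtain ⟨t, ht, h1t⟩ := List.mem_flatten.1 (hperm.mem_iff.2 (List.mem_cons_self))
  -- The leaf `1` alone has the full weight `load`, and the weights of all other leaves of the tour
  -- are positive.
  have ht1 : t = [1] := by
    have hp := List.perm_cons_erase h1t
    have h1 := tourLen_perm (N := N) hp
    rw [heq _ (List.mem_map.2 ⟨t, ht, rfl⟩), tourLen_cons] at h1
    have h2 : N.weight 1 = N.load := rfl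
    have h3 : t.erase 1 = [] := by
      rcases h4 : t.erase 1 with _ | ⟨a, s⟩
      · rfl
      · exfalso
        have ha : a ∈ t := List.mem_of_mem_erase (a := a) (b := 1) (by rw [h4]; simp)
        have := (weight_of_ne (N := N) (hmem ht ha).1 (hmem ht ha).2.1).2
        rw [h4, tourLen_cons] at h1
        omega
    rw [h3] at hp
    exact List.perm_singleton.1 hp
  subst ht1
  obtain ⟨T₁, T₂, rfl⟩ := List.append_of_mem ht
  have hperm' : (T₁ ++ T₂).flatten.Perm (List.range' 3 N.beads.length) := by
    refine List.Perm.cons_inv (a := 1) (List.Perm.trans ?_ hperm)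
    simp only [List.flatten_append, List.flatten_cons, List.singleton_append]
    exact List.perm_middle.symm
  refine ⟨T₁, T₂, ⟨by simp at hlen; omega, hperm', ?_⟩, rfl⟩
  intro t ht r
  have ht' : t ∈ T₁ ++ [1] :: T₂ := by
    rcases List.mem_append.1 ht with h | h <;> simp [h]
  have hsub : t.Sublist (T₁ ++ T₂).flatten := List.sublist_flatten_of_mem ht
  have h3 : ∀ a ∈ t, 3 ≤ a := fun a ha =>
    (List.mem_range'_1.1 (hperm'.mem_iff.1 (hsub.subset ha))).1
  have hcount (r : ℕ) : t.countP (fun a => N.leafColor a = r) ≤ N.beads.count r := by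
    rw [← countP_leafColor, ← hperm'.countP_eq]
    exact hsub.countP_le
  have h4 := heq _ (List.mem_map.2 ⟨t, ht', rfl⟩)
  rw [tourLen_eq_sum _ _ h3, sum_mul_edgeLen, load] at h4
  -- As `ell` is at least `k` plus the number of beads, even `k` times a count is an admissible
  -- digit.
  have hkm : N.k * N.beads.length < 2 ^ N.ell := by
    have h5 : N.k < 2 ^ N.k := Nat.lt_two_pow_self
    have h6 : N.beads.length < 2 ^ N.beads.length := Nat.lt_two_pow_self
    refine (Nat.mul_lt_mul'' h5 h6).trans_le ?_
    rw [← pow_add]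
    exact Nat.pow_le_pow_right (by omega) (by rw [ell_eq]; omega)
  have h5 := eq_of_sum_blocks_eq _ _ N.ell (fun r _ => ?_) (fun r _ => N.count_lt r) h4
  · by_cases hr : r < N.ell
    · have := h5 r hr
      rw [← this, Nat.mul_div_cancel_left _ N.k_pos]
    · have : N.beads.count r = 0 := by
        rw [List.count_eq_zero]
        intro hr'
        exact hr (N.color_lt_ell hr')
      have h6 := hcount r
      rw [this] at h6 ⊢
      rw [Nat.zero_div]
      exact Nat.le_zero.1 h6
  · exact (Nat.mul_le_mul_left _ ((hcount r).trans List.count_le_length)).trans_lt hkm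

/-- The colour condition gives every tour the weight `load`, so its length `2 * (depotLen + load)`
respects the capacity. -/
theorem Tours.exists_route {T₁ T₂ : List (List ℕ)} (h : N.Tours T₁ T₂) :
    ∃ w : N.plan.Route, Visits w.1 (leaves (T₁ ++ [1] :: T₂)) := by
  have hmem {t : List ℕ} (ht : t ∈ T₁ ++ T₂) {a : ℕ} (ha : a ∈ t) :
      3 ≤ a ∧ a ≤ N.beads.length + 2 := by
    have := List.mem_range'_1.1 (h.perm.mem_iff.1 (List.mem_flatten.2 ⟨t, ht, ha⟩))
    omega
  have hT {t : List ℕ} (ht : t ∈ T₁ ++ [1] :: T₂) : t = [1] ∨ t ∈ T₁ ++ T₂ := by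
    simp only [List.mem_append, List.mem_cons] at ht ⊢; tauto
  have htwo : ∀ t ∈ T₁ ++ [1] :: T₂, 2 ∉ t := by
    intro t ht h2
    rcases hT ht with rfl | ht
    · simp at h2
    · have := hmem ht h2; omega
  have hlen : (T₁ ++ [1] :: T₂).length = N.k + 1 := by
    have := h.length_eq
    simp; omega
  have htour {t : List ℕ} (ht : t ∈ T₁ ++ [1] :: T₂) : N.tourLen t = N.load := by
    rcases hT ht with rfl | ht
    · rfl
    · rw [tourLen_eq_sum _ _ fun a ha => (hmem ht ha).1, load]
      refine Finset.sum_congr rfl fun r _ => ?_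
      rw [h.color t ht r, edgeLen, ← mul_assoc, Nat.div_mul_cancel (N.dvd_count r)]
  have hpath {t : List ℕ} (ht : t ∈ T₁ ++ [1] :: T₂) :
      N.pathLen (pairs 2 (t ++ [2])) ≤ 2 ^ (N.width + 1) := by
    have h2 : N.weight 2 = N.depotLen := rfl
    have h3 := N.depotLen_add
    rw [pathLen_pairs, pow_succ, htour ht]
    omega
  have hperm : (T₁ ++ [1] :: T₂).flatten.Perm (1 :: List.range' 3 N.beads.length) := by
    refine List.Perm.trans ?_ (h.perm.cons 1)
    simp only [List.flatten_append, List.flatten_cons, List.singleton_append]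
    exact List.perm_middle
  obtain ⟨w, hw⟩ := exists_walk_visits (N := N) (leaves (T₁ ++ [1] :: T₂)) (by
    intro a ha
    obtain ⟨t, ht, hat⟩ := List.mem_flatMap.1 ha
    rcases List.mem_append.1 hat with hat | hat
    · rcases hT ht with rfl | ht
      · rw [List.mem_singleton.1 hat]; omega
      · have := hmem ht hat; omega
    · rw [List.mem_singleton.1 hat]; omega) (getLastD_leaves _)
  refine ⟨⟨w, hw.isVehicleRoute_iff.2 ⟨fun b h0 hb => ?_, ?_, ?_⟩⟩, hw⟩
  · by_cases h2 : b = 2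
    · subst h2
      rw [count_leaves_two _ htwo, hlen]
      exact ⟨by omega, le_rfl⟩
    · rw [count_leaves_of_ne h2, hperm.count_eq, List.count_cons, count_range']
      have h3 : N.freqs b = 1 := by
        match b, h0, h2 with
        | 1, _, _ => rfl
        | i + 3, _, _ => rfl
      rw [h3]
      by_cases h1 : b = 1
      · simp [h1]
      · rw [if_pos (by omega), if_neg (by simpa using Ne.symm h1)]
        simp
  · have key (T : List (List ℕ))
        (hT : ∀ t ∈ T, N.pathLen (pairs 2 (t ++ [2])) ≤ 2 ^ (N.width + 1)) :
        N.pathLen (pairs 2 (leaves T)) ≤ T.length * 2 ^ (N.width + 1) := by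
      rw [pairs_leaves]
      induction T with
      | nil => simp [pathLen]
      | cons t T ih =>
        rw [List.map_cons, List.flatten_cons, pathLen_append, List.length_cons, add_mul, one_mul,
          add_comm]
        exact Nat.add_le_add (ih fun s hs => hT s (List.mem_cons_of_mem _ hs)) (hT t (by simp))
    rw [← hlen]
    exact key _ fun t ht => hpath ht
  · rw [pairs_leaves]
    apply segBound_flatten N.pathLen_append
    intro P hP
    obtain ⟨t, ht, rfl⟩ := List.mem_map.1 hP
    refine ⟨hpath ht, ?_⟩
    cases t with
    | nil => exact ⟨_, _, rfl, rfl⟩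
    | cons a t => exact ⟨_, _, rfl, rfl⟩

end Necklace

/-! ### The splitting obtained from a route -/

namespace StarWalk

/-- The bead leaves and the ends of tours in a sequence of visits. The leaf `1` is left out, and
so is the visit to the depot after it; initially, the flag tells whether this is to happen. -/
def tokens : Bool → List ℕ → List (Option ℕ)
  | _, [] => []
  | b, 0 :: l => tokens b l
  | _, 1 :: l => tokens true l
  | true, 2 :: l => tokens false l
  | false, 2 :: l => none :: tokens false l
  | b, (i + 3) :: l => some i :: tokens b l

/-- The number of tours that end before the bead `i` occurs. -/
def partOf : List (Option ℕ) → ℕ → ℕ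
  | [], _ => 0
  | none :: l, i => partOf l i + 1
  | some j :: l, i => if j = i then 0 else partOf l i

/-- The tokens of a sequence of tours. -/
def tourTokens (T : List (List ℕ)) : List (Option ℕ) :=
  T.flatMap fun t => t.map (fun a => some (a - 3)) ++ [none]

theorem tokens_flatMap (b : Bool) (l : List ℕ) :
    tokens b (l.flatMap fun a => [0, a]) = tokens b l := by
  induction l generalizing b with
  | nil => rfl
  | cons a l ih =>
    rw [List.flatMap_cons]
    match a, b with
    | 0, _ => simp [tokens, ih]
    | 1, _ => simp [tokens, ih]
    | 2, true => simp [tokens, ih]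
    | 2, false => simp [tokens, ih]
    | i + 3, _ => simp [tokens, ih]

theorem tokens_append (t l : List ℕ) (ht : ∀ a ∈ t, 3 ≤ a) :
    tokens false (t ++ 2 :: l) = t.map (fun a => some (a - 3)) ++ none :: tokens false l := by
  induction t with
  | nil => rfl
  | cons a t ih =>
    obtain ⟨i, rfl⟩ := Nat.exists_eq_add_of_le' (ht a (by simp))
    simp [tokens, ih fun b hb => ht b (List.mem_cons_of_mem _ hb)]

theorem tokens_leaves (T : List (List ℕ)) (l : List ℕ) (hT : ∀ t ∈ T, ∀ a ∈ t, 3 ≤ a) :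
    tokens false (leaves T ++ l) = tourTokens T ++ tokens false l := by
  induction T with
  | nil => rfl
  | cons t T ih =>
    rw [leaves_cons, List.append_assoc, List.cons_append, tokens_append _ _ (hT t (by simp)),
      ih fun s hs => hT s (List.mem_cons_of_mem _ hs)]
    simp [tourTokens]

theorem partOf_append_of_notMem (t : List ℕ) (l : List (Option ℕ)) (i : ℕ) (ht : ∀ a ∈ t, 3 ≤ a)
    (hi : i + 3 ∉ t) : partOf (t.map (fun a => some (a - 3)) ++ l) i = partOf l i := by
  induction t with
  | nil => rfl
  | cons a t ih =>
    have h3 := ht a (by simp)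
    rw [List.mem_cons, not_or] at hi
    rw [List.map_cons, List.cons_append, partOf, if_neg (by omega),
      ih (fun b hb => ht b (List.mem_cons_of_mem _ hb)) hi.2]

theorem partOf_append_of_mem (t : List ℕ) (l : List (Option ℕ)) (i : ℕ) (ht : ∀ a ∈ t, 3 ≤ a)
    (hi : i + 3 ∈ t) : partOf (t.map (fun a => some (a - 3)) ++ l) i = 0 := by
  induction t with
  | nil => simp at hi
  | cons a t ih =>
    have h3 := ht a (by simp)
    rw [List.map_cons, List.cons_append, partOf]
    split_ifs with h
    · rfl
    · refine ih (fun b hb => ht b (List.mem_cons_of_mem _ hb)) ?_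
      exact (List.mem_cons.1 hi).resolve_left (by omega)

/-- Each `none` closes a tour, so the number of those before a bead is the index of its tour. -/
theorem getElem?_partOf (T : List (List ℕ)) (i : ℕ) (hT : ∀ t ∈ T, ∀ a ∈ t, 3 ≤ a)
    (hi : i + 3 ∈ T.flatten) : ∃ t, T[partOf (tourTokens T) i]? = some t ∧ i + 3 ∈ t := by
  induction T with
  | nil => simp at hi
  | cons t T ih =>
    have ht := hT t (by simp)
    have e : tourTokens (t :: T) = t.map (fun a => some (a - 3)) ++ none :: tourTokens T := by
      simp [tourTokens]
    rw [e]
    by_cases h : i + 3 ∈ t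
    · rw [partOf_append_of_mem _ _ _ ht h]
      exact ⟨t, rfl, h⟩
    · rw [partOf_append_of_notMem _ _ _ ht h, partOf, List.getElem?_cons_succ]
      rw [List.flatten_cons, List.mem_append] at hi
      exact ih (fun s hs => hT s (List.mem_cons_of_mem _ hs)) (hi.resolve_left h)

theorem index_unique {T : List (List ℕ)} (hT : T.flatten.Nodup) {i j a : ℕ} {s t : List ℕ}
    (hs : T[i]? = some s) (ht : T[j]? = some t) (has : a ∈ s) (hat : a ∈ t) : i = j := by
  have hp := (List.nodup_flatten.1 hT).2
  rw [List.pairwise_iff_getElem] at hp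
  obtain ⟨hi, rfl⟩ := List.getElem?_eq_some_iff.1 hs
  obtain ⟨hj, rfl⟩ := List.getElem?_eq_some_iff.1 ht
  rcases lt_trichotomy i j with h | h | h
  · exact (hp i j hi hj h has hat).elim
  · exact h
  · exact (hp j i hj hi h hat has).elim

/-- Leaves of different tours are separated by a visit to the depot. -/
theorem exists_tour_of_adjacent (T : List (List ℕ)) {A B : List ℕ} {p q : ℕ} (hp : p ≠ 2)
    (hq : q ≠ 2) (h : leaves T = A ++ p :: q :: B) : ∃ t ∈ T, p ∈ t ∧ q ∈ t := by
  induction T generalizing A with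
  | nil => simp [leaves] at h
  | cons t T ih =>
    rw [leaves_cons] at h
    rcases List.append_eq_append_iff.1 h with ⟨X, -, h2⟩ | ⟨X, rfl, h2⟩
    · rcases X with _ | ⟨x, X⟩
      · simp only [List.nil_append, List.cons.injEq] at h2
        exact absurd h2.1.symm hp
      · simp only [List.cons_append, List.cons.injEq] at h2
        obtain ⟨s, hs, h3⟩ := ih h2.2
        exact ⟨s, List.mem_cons_of_mem _ hs, h3⟩
    · rcases X with _ | ⟨x, _ | ⟨y, X⟩⟩
      · simp only [List.nil_append, List.cons.injEq] at h2
        exact absurd h2.1 hp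
      · simp only [List.cons_append, List.nil_append, List.cons.injEq] at h2
        exact absurd h2.2.1 hq
      · simp only [List.cons_append, List.cons.injEq] at h2
        obtain ⟨rfl, rfl, -⟩ := h2
        exact ⟨_, List.mem_cons_self, by simp, by simp⟩

theorem exists_adjacent_of_tour {T : List (List ℕ)} {t A B : List ℕ} {p q : ℕ} (ht : t ∈ T)
    (h : t = A ++ p :: q :: B) : ∃ A' B', leaves T = A' ++ p :: q :: B' := by
  obtain ⟨X, Y, rfl⟩ := List.append_of_mem ht
  exact ⟨leaves X ++ A, B ++ 2 :: leaves Y, by rw [leaves_append, leaves_cons, h]; simp⟩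

/-- If `q` is visited before `p`, then on the first arrival at `q` the preceding leaf `p` is unused
and complains. Otherwise some leaf follows `p`, because the walk ends in the depot; it is `q`, or
else `q` complains. -/
theorem fwd_or_bwd {m : ℕ} {l : List ℕ} {p q : ℕ} (hl : l.getLastD 2 = 2) (hp : p ∈ l)
    (hq : q ∈ l) (hp2 : p ≠ 2) (hq2 : q ≠ 2) (hpq : p ≠ q) (hnx : nx m p = q) (hpv : pv m q = p) :
    Fwd m (2 :: l) q ∨ Bwd m (2 :: l) p ∨ ∃ A B, l = A ++ p :: q :: B := by
  obtain ⟨A, B, rfl, hpA⟩ := List.eq_append_cons_of_mem hp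
  by_cases hqA : q ∈ A
  · obtain ⟨A₁, A₂, rfl, hqA₁⟩ := List.eq_append_cons_of_mem hqA
    right; left
    obtain ⟨C, a, hC⟩ := (List.eq_nil_or_concat (2 :: A₁)).resolve_left (List.cons_ne_nil _ _)
    rw [List.concat_eq_append] at hC
    refine ⟨C, a, q, A₂ ++ p :: B, ?_, hpv, ?_⟩
    · rw [List.append_assoc, ← List.cons_append, hC]; simp
    · rw [List.append_cons, ← hC]
      simp only [List.mem_append, List.mem_cons, not_or] at hpA ⊢
      simp [hp2, hpA]
  · rcases B with _ | ⟨b, B⟩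
    · rw [getLastD_append] at hl
      exact absurd hl hp2
    · by_cases hb : b = q
      · subst hb
        exact Or.inr (Or.inr ⟨A, B, rfl⟩)
      · left
        refine ⟨2 :: A, p, b, B, rfl, hnx, ?_⟩
        simp [hqA, hq2, Ne.symm hpq, Ne.symm hb]

theorem append_cons_inj {α : Type*} {A B A' B' : List α} {p : α} (hA : p ∉ A) (hA' : p ∉ A')
    (h : A ++ p :: B = A' ++ p :: B') : A = A' ∧ B = B' := by
  rcases List.append_eq_append_iff.1 h with ⟨X, rfl, h2⟩ | ⟨X, rfl, h2⟩ <;> rcases X with _ | ⟨x, X⟩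
  · simpa using h2
  · simp only [List.cons_append, List.cons.injEq] at h2
    exact absurd (by simp [h2.1]) hA'
  · simpa using h2.symm
  · simp only [List.cons_append, List.cons.injEq] at h2
    exact absurd (by simp [h2.1]) hA

/-- Of two different entries, each cannot occur before the other. -/
theorem append_cons_ne {α : Type*} {A B A' B' : List α} {p q : α} (hpq : p ≠ q) (hA : q ∉ A)
    (hA' : p ∉ A') : A ++ p :: B ≠ A' ++ q :: B' := by
  intro h
  rcases List.append_eq_append_iff.1 h with ⟨X, rfl, h2⟩ | ⟨X, rfl, h2⟩ <;> rcases X with _ | ⟨x, X⟩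
  · exact hpq (by simpa using (List.cons.inj h2).1)
  · simp only [List.cons_append, List.cons.injEq] at h2
    exact absurd (by simp [h2.1]) hA'
  · exact hpq (by simpa using (List.cons.inj h2).1.symm)
  · simp only [List.cons_append, List.cons.injEq] at h2
    exact absurd (by simp [h2.1]) hA

end StarWalk

/-! ### The splitting of a route and the lower bound for its unfairness -/

namespace Necklace

open StarWalk

variable {N : Necklace}

/-- The part of the bead `i` according to the route. -/
def part (w : N.plan.ClosedWalk) (i : ℕ) : ℕ := partOf (tokens true (w.support.map Fin.val)) i

variable {w : N.plan.ClosedWalk} {T₁ T₂ : List (List ℕ)}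

theorem Tours.three_le (hT : N.Tours T₁ T₂) {t : List ℕ} (ht : t ∈ T₁ ++ T₂) {a : ℕ}
    (ha : a ∈ t) : 3 ≤ a ∧ a ≤ N.beads.length + 2 := by
  have := List.mem_range'_1.1 (hT.perm.mem_iff.1 (List.mem_flatten.2 ⟨t, ht, ha⟩))
  omega

theorem Tours.nodup (hT : N.Tours T₁ T₂) : (T₁ ++ T₂).flatten.Nodup :=
  hT.perm.nodup_iff.2 List.nodup_range'

theorem Tours.mem_flatten (hT : N.Tours T₁ T₂) {i : ℕ} (hi : i < N.beads.length) :
    i + 3 ∈ (T₁ ++ T₂).flatten :=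
  hT.perm.mem_iff.2 (List.mem_range'_1.2 (by omega))

/-- The tokens omit the leaf `1` together with the depot visit after it, so the parts are numbered
from `0` to `k - 1` wherever that tour stands. -/
theorem Tours.getElem?_part (hT : N.Tours T₁ T₂) (hw : Visits w (leaves (T₁ ++ [1] :: T₂)))
    {i : ℕ} (hi : i < N.beads.length) :
    ∃ t, (T₁ ++ T₂)[part w i]? = some t ∧ i + 3 ∈ t := by
  have e : tokens true (w.support.map Fin.val) = tourTokens (T₁ ++ T₂) := by
    rw [hw.support, tokens, tokens_flatMap, leaves_append,
      tokens_leaves _ _ fun t ht a ha => (hT.three_le (List.mem_append_left _ ht) ha).1, leaves_cons]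
    have h2 := tokens_leaves T₂ [] fun t ht a ha => (hT.three_le (List.mem_append_right _ ht) ha).1
    rw [List.append_nil] at h2
    simp only [List.singleton_append, tokens, h2, List.append_nil]
    simp [tourTokens]
  rw [part, e]
  exact getElem?_partOf _ _ (fun t ht a ha => (hT.three_le ht ha).1) (hT.mem_flatten hi)

theorem Tours.part_eq_iff (hT : N.Tours T₁ T₂) (hw : Visits w (leaves (T₁ ++ [1] :: T₂)))
    {i : ℕ} (hi : i < N.beads.length) {j : ℕ} {t : List ℕ} (ht : (T₁ ++ T₂)[j]? = some t) :
    part w i = j ↔ i + 3 ∈ t := by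
  obtain ⟨s, hs, his⟩ := hT.getElem?_part hw hi
  constructor
  · rintro rfl
    rw [hs, Option.some.injEq] at ht
    rwa [← ht]
  · intro h
    exact index_unique hT.nodup hs ht his h

theorem Tours.part_lt (hT : N.Tours T₁ T₂) (hw : Visits w (leaves (T₁ ++ [1] :: T₂)))
    {i : ℕ} (hi : i < N.beads.length) : part w i < N.k := by
  obtain ⟨t, ht, -⟩ := hT.getElem?_part hw hi
  have := (List.getElem?_eq_some_iff.1 ht).1
  rw [← hT.length_eq, ← List.length_append]
  exact this

theorem Tours.isSplitting (hT : N.Tours T₁ T₂) (hw : Visits w (leaves (T₁ ++ [1] :: T₂))) :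
    N.IsSplitting fun i => ⟨part w i, hT.part_lt hw i.isLt⟩ := by
  intro j r
  have hj : j.val < (T₁ ++ T₂).length := by
    rw [List.length_append, hT.length_eq]; exact j.isLt
  have ht := List.getElem?_eq_getElem hj
  have hmem := List.getElem_mem hj
  rw [← hT.color _ hmem r, List.countP_eq_length_filter,
    ← List.toFinset_card_of_nodup (((List.nodup_flatten.1 hT.nodup).1 _ hmem).filter _)]
  have hcol (i : Fin N.beads.length) : N.leafColor (i.val + 3) = N.color i := by
    simp [leafColor]
    rfl
  refine Finset.card_bij (fun i _ => i.val + 3) ?_ ?_ ?_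
  · intro i hi
    rw [Finset.mem_filter, Fin.ext_iff, hT.part_eq_iff hw i.isLt ht] at hi
    simp only [List.mem_toFinset, List.mem_filter, hcol, decide_eq_true_eq]
    exact hi.2
  · intro a _ b _ h
    exact Fin.ext (by simpa using h)
  · intro b hb
    simp only [List.mem_toFinset, List.mem_filter, decide_eq_true_eq] at hb
    obtain ⟨h3, h4⟩ := hT.three_le hmem hb.1
    obtain ⟨i, rfl⟩ := Nat.exists_eq_add_of_le' h3
    have hi : i < N.beads.length := by omega
    refine ⟨⟨i, hi⟩, ?_, rfl⟩
    rw [Finset.mem_filter, Fin.ext_iff, hT.part_eq_iff hw hi ht]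
    exact ⟨Finset.mem_univ _, hb.1, (hcol ⟨i, hi⟩).symm.trans hb.2⟩

theorem exists_tours_visits (w : N.plan.Route) :
    ∃ T₁ T₂, N.Tours T₁ T₂ ∧ Visits w.1 (leaves (T₁ ++ [1] :: T₂)) := by
  obtain ⟨l, hl⟩ := exists_visits w.1
  obtain ⟨T₁, T₂, hT, rfl⟩ := hl.exists_tours w.2
  exact ⟨T₁, T₂, hT, hl⟩

theorem part_lt (w : N.plan.Route) (i : Fin N.beads.length) : part w.1 i < N.k := by
  obtain ⟨T₁, T₂, hT, hw⟩ := exists_tours_visits w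
  exact hT.part_lt hw i.isLt

/-- The splitting obtained from a route: the beads visited in one tour form a part. -/
def splitting (w : N.plan.Route) : N.Splitting :=
  ⟨fun i => ⟨part w.1 i, part_lt w i⟩, by
    obtain ⟨T₁, T₂, hT, hw⟩ := exists_tours_visits w
    exact hT.isSplitting hw⟩

theorem splitting_isCut_iff (w : N.plan.Route) (i j : Fin N.beads.length) :
    (splitting w).IsCut i j ↔ j.val = i + 1 ∧ part w.1 i ≠ part w.1 j := by
  unfold Splitting.IsCut splitting
  simp [Fin.ext_iff]

/-- The boundaries of the cyclic order of the leaves at which a complaint arises; each of them is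
denoted by the leaf that follows it. -/
def boundaries (m : ℕ) (V : List ℕ) : Set ℕ := {b | Fwd m V b} ∪ nx m '' {b | Bwd m V b}

/-- The leaves of the beads after the cuts. -/
def cutLeaves (S : N.Splitting) : Set ℕ := {b | ∃ i j, S.IsCut i j ∧ b = j.val + 3}

theorem ncard_cutLeaves (S : N.Splitting) : (cutLeaves S).ncard = S.size := by
  have e : cutLeaves S = (fun p : Fin N.beads.length × Fin N.beads.length => p.2.val + 3) ''
      {p | S.IsCut p.1 p.2} := by
    ext b
    constructor
    · rintro ⟨i, j, h, rfl⟩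
      exact ⟨(i, j), h, rfl⟩
    · rintro ⟨⟨i, j⟩, h, rfl⟩
      exact ⟨i, j, h, rfl⟩
  rw [e, Set.InjOn.ncard_image]
  · rfl
  · rintro ⟨i, j⟩ h ⟨i', j'⟩ h' hh
    have h1 : j.val = j'.val := by simpa using hh
    have h2 := h.1
    have h3 := h'.1
    simp only at h2 h3
    exact Prod.ext (Fin.ext (by simp only; omega)) (Fin.ext h1)

theorem cutLeaves_subset (S : N.Splitting) : cutLeaves S ⊆ Set.Ioc 3 (N.beads.length + 2) := by
  rintro b ⟨i, j, h, rfl⟩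
  have h1 := h.1
  have h2 := j.isLt
  constructor <;> omega

/-- Leaves after cuts are at least `4`, so the boundaries `1` and `e` are two additional ones. -/
theorem ncard_cutLeaves_union (S : N.Splitting) {e : ℕ} (h1 : 1 < e) (h3 : e ≤ 3) :
    (cutLeaves S ∪ {1, e}).ncard = S.size + 2 := by
  have hfin : (cutLeaves S).Finite := (Set.finite_Ioc _ _).subset (cutLeaves_subset S)
  rw [Set.ncard_union_eq _ hfin, ncard_cutLeaves, Set.ncard_pair (by omega)]
  rw [Set.disjoint_left]
  intro b hb hb'
  have := (cutLeaves_subset S hb).1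
  rcases hb' with rfl | rfl <;> omega

theorem Tours.mem_leaves (hT : N.Tours T₁ T₂) {a : ℕ} (ha : a ≠ 0) (ha' : a ≤ N.beads.length + 2)
    (h2 : a ≠ 2) : a ∈ leaves (T₁ ++ [1] :: T₂) := by
  rw [← List.count_pos_iff, count_leaves_of_ne h2, List.count_pos_iff]
  by_cases h1 : a = 1
  · simp [h1]
  · have := hT.mem_flatten (i := a - 3) (by omega)
    rw [show a - 3 + 3 = a by omega] at this
    simp only [List.flatten_append, List.flatten_cons, List.mem_append] at this ⊢
    tauto

/-- Beads of different parts lie in different tours and are never visited one directly after the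
other, so only the complaints of `fwd_or_bwd` remain. -/
theorem complaint_of_isCut (w : N.plan.Route) {l : List ℕ} (hl : Visits w.1 l)
    {i j : Fin N.beads.length} (h : (splitting w).IsCut i j) :
    Fwd N.beads.length (2 :: l) (j + 3) ∨ Bwd N.beads.length (2 :: l) (i + 3) := by
  obtain ⟨T₁, T₂, hT, rfl⟩ := hl.exists_tours w.2
  obtain ⟨hj, hne⟩ := (splitting_isCut_iff w i j).1 h
  have hjl := j.isLt
  have hil := i.isLt
  rcases fwd_or_bwd (m := N.beads.length) (p := i + 3) (q := j + 3) hl.last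
    (hT.mem_leaves (by omega) (by omega) (by omega)) (hT.mem_leaves (by omega) (by omega) (by omega))
    (by omega) (by omega) (by omega) (by unfold nx; rw [if_neg (by omega)]; omega)
    (by unfold pv; rw [if_neg (by omega)]; omega) with h | h | ⟨A, B, h⟩
  · exact Or.inl h
  · exact Or.inr h
  · obtain ⟨t, ht, h1, h2⟩ := exists_tour_of_adjacent _ (by omega) (by omega) h
    have ht' : t ∈ T₁ ++ T₂ := by
      simp only [List.mem_append, List.mem_cons] at ht ⊢
      rcases ht with ht | rfl | ht
      · exact Or.inl ht
      · simp at h1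
      · exact Or.inr ht
    obtain ⟨x, hx, rfl⟩ := List.mem_iff_getElem.1 ht'
    have hx' := List.getElem?_eq_getElem hx
    exact absurd (((hT.part_eq_iff hl hil hx').2 h1).trans ((hT.part_eq_iff hl hjl hx').2 h2).symm)
      hne

theorem length_beads_pos : 0 < N.beads.length := List.length_pos_iff.2 N.nonempty

/-- The boundary `1` separates the last bead from the leaf `1`, which is alone in its tour. The
boundary `e` is next to the depot. If the first tour is `[1]`, then leaf `3`, which follows the
depot, has a forward complaint at once and `e = 3`. Otherwise leaf `1`, which precedes the depot,
has a backward complaint at the first return and `e = 2`. -/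
theorem exists_subset_boundaries (w : N.plan.Route) {l : List ℕ} (hl : Visits w.1 l) :
    ∃ e, 1 < e ∧ e ≤ 3 ∧ cutLeaves (splitting w) ∪ {1, e} ⊆ boundaries N.beads.length (2 :: l) := by
  have hm := N.length_beads_pos
  have hcut : cutLeaves (splitting w) ⊆ boundaries N.beads.length (2 :: l) := by
    rintro b ⟨i, j, h, rfl⟩
    rcases complaint_of_isCut w hl h with h' | h'
    · exact Or.inl h'
    · refine Or.inr ⟨_, h', ?_⟩
      have h1 := h.1
      have h2 := j.isLt
      unfold nx
      rw [if_neg (by omega)]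
      omega
  obtain ⟨T₁, T₂, hT, rfl⟩ := hl.exists_tours w.2
  have hone : 1 ∈ boundaries N.beads.length (2 :: leaves (T₁ ++ [1] :: T₂)) := by
    have hnx : nx N.beads.length (N.beads.length + 2) = 1 := if_pos rfl
    rcases fwd_or_bwd (m := N.beads.length) (p := N.beads.length + 2) (q := 1) hl.last
      (hT.mem_leaves (by omega) (by omega) (by omega))
      (hT.mem_leaves (by omega) (by omega) (by omega)) (by omega) (by omega) (by omega)
      hnx (if_pos rfl) with h | h | ⟨A, B, h⟩
    · exact Or.inl h
    · exact Or.inr ⟨_, h, hnx⟩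
    · obtain ⟨t, ht, h1, h2⟩ := exists_tour_of_adjacent _ (by omega) (by omega) h
      exfalso
      have : t = [1] ∨ t ∈ T₁ ++ T₂ := by
        simp only [List.mem_append, List.mem_cons] at ht ⊢; tauto
      rcases this with rfl | ht
      · simp at h1
      · have := (hT.three_le ht h2).1; omega
  rcases T₁ with _ | ⟨t, T₁⟩
  · refine ⟨3, by omega, le_rfl, Set.union_subset hcut ?_⟩
    rintro b (rfl | rfl)
    · exact hone
    · refine Or.inl ⟨[], 2, 1, 2 :: leaves T₂, ?_, ?_, by simp⟩
      · rw [List.nil_append, leaves_cons]; rfl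
      · unfold nx; rw [if_neg (by omega)]
  · refine ⟨2, by omega, by omega, Set.union_subset hcut ?_⟩
    rintro b (rfl | rfl)
    · exact hone
    · refine Or.inr ⟨1, ?_, ?_⟩
      · obtain ⟨C, a, hC⟩ := (List.eq_nil_or_concat (2 :: t)).resolve_left (List.cons_ne_nil _ _)
        rw [List.concat_eq_append] at hC
        refine ⟨C, a, 2, leaves (T₁ ++ [1] :: T₂), ?_, rfl, ?_⟩
        · rw [List.cons_append, leaves_cons, ← List.cons_append, hC]; simp
        · rw [List.append_cons, ← hC]
          have h1 : 1 ∉ t := fun h1 => by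
            have := (hT.three_le (by simp) h1).1; omega
          simp [h1]
      · unfold nx; rw [if_neg (by omega)]

theorem Visits.finite_fwd {l : List ℕ} (hl : Visits w l) :
    {b | Fwd N.beads.length (2 :: l) b}.Finite :=
  (Set.finite_Iic (N.beads.length + 2)).subset fun _ => hl.nx_le

theorem Visits.finite_bwd {l : List ℕ} (hl : Visits w l) :
    {b | Bwd N.beads.length (2 :: l) b}.Finite :=
  (Set.finite_Iic (N.beads.length + 2)).subset fun _ => hl.pv_le

theorem Visits.ncard_boundaries_le {l : List ℕ} (hl : Visits w l) :
    (boundaries N.beads.length (2 :: l)).ncard ≤ TreePlan.unfairness w := by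
  rw [hl.unfairness_eq]
  exact (Set.ncard_union_le _ _).trans (Nat.add_le_add_left (Set.ncard_image_le hl.finite_bwd) _)

theorem Visits.finite_boundaries {l : List ℕ} (hl : Visits w l) :
    (boundaries N.beads.length (2 :: l)).Finite :=
  hl.finite_fwd.union (hl.finite_bwd.image _)

theorem size_add_two_le (w : N.plan.Route) :
    (splitting w).size + 2 ≤ TreePlan.unfairness w.1 := by
  obtain ⟨l, hl⟩ := exists_visits w.1
  obtain ⟨e, h1, h3, h⟩ := exists_subset_boundaries w hl
  rw [← ncard_cutLeaves_union _ h1 h3]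
  exact (Set.ncard_le_ncard h hl.finite_boundaries).trans hl.ncard_boundaries_le

/-- The unavoidable boundaries are as many as the index permits, so by cardinality there are no
further boundaries with complaints. -/
theorem isCut_of_complaint (w : N.plan.Route)
    (hw : TreePlan.unfairness w.1 ≤ (splitting w).size + 2) {l : List ℕ} (hl : Visits w.1 l)
    {i j : Fin N.beads.length} (hij : j.val = i + 1)
    (h : Fwd N.beads.length (2 :: l) (j + 3) ∨ Bwd N.beads.length (2 :: l) (i + 3)) :
    (splitting w).IsCut i j := by
  obtain ⟨e, h1, h3, hsub⟩ := exists_subset_boundaries w hl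
  have heq := Set.eq_of_subset_of_ncard_le hsub
    (by rw [ncard_cutLeaves_union _ h1 h3]; exact hl.ncard_boundaries_le.trans hw)
    hl.finite_boundaries
  have hmem : j.val + 3 ∈ boundaries N.beads.length (2 :: l) := by
    rcases h with h | h
    · exact Or.inl h
    · refine Or.inr ⟨_, h, ?_⟩
      have h2 := j.isLt
      unfold nx
      rw [if_neg (by omega)]
      omega
  rw [← heq] at hmem
  rcases hmem with ⟨i', j', hc, hj⟩ | hmem
  · have hj' : j = j' := Fin.ext (by omega)
    have hi' : i = i' := Fin.ext (by have := hc.1; rw [← hj'] at this; omega)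
    rwa [hi', hj']
  · exfalso
    rcases hmem with h | h
    · omega
    · have : j.val + 3 = e := h
      omega

end Necklace

/-! ### The route obtained from a splitting -/

namespace Necklace

open StarWalk

variable {N : Necklace}

/-- The leaves of the beads of a part, in their order. -/
def partLeaves (S : N.Splitting) (j : Fin N.k) : List ℕ :=
  ((List.finRange N.beads.length).filter fun i => S.1 i = j).map fun i => i.val + 3

/-- One tour for each part. -/
def partTours (S : N.Splitting) : List (List ℕ) := (List.finRange N.k).map (partLeaves S)

theorem mem_partLeaves {S : N.Splitting} {j : Fin N.k} {a : ℕ} :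
    a ∈ partLeaves S j ↔ ∃ i, S.1 i = j ∧ i.val + 3 = a := by
  simp [partLeaves]

/-- The empty list of first tours means that the leaf `1` is served first. This places the boundary
next to the depot at leaf `3`. -/
theorem tours_partTours (S : N.Splitting) : N.Tours [] (partTours S) := by
  have hinj : Function.Injective fun i : Fin N.beads.length => i.val + 3 := fun a b h =>
    Fin.ext (by simpa using h)
  refine ⟨by simp [partTours], ?_, ?_⟩
  · rw [List.nil_append]
    refine (List.perm_ext_iff_of_nodup ?_ List.nodup_range').2 ?_
    · rw [List.nodup_flatten]
      constructor
      · intro t ht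
        obtain ⟨j, -, rfl⟩ := List.mem_map.1 ht
        exact ((List.nodup_finRange _).filter _).map hinj
      · rw [partTours, List.pairwise_map]
        refine (List.nodup_finRange _).imp fun {a b} hab => ?_
        intro x hx hx'
        obtain ⟨i, hi, rfl⟩ := mem_partLeaves.1 hx
        obtain ⟨i', hi', h⟩ := mem_partLeaves.1 hx'
        obtain rfl : i' = i := hinj h
        exact hab (hi.symm.trans hi')
    · intro a
      rw [List.mem_flatten, List.mem_range'_1]
      constructor
      · rintro ⟨t, ht, ha⟩
        obtain ⟨j, -, rfl⟩ := List.mem_map.1 ht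
        obtain ⟨i, -, rfl⟩ := mem_partLeaves.1 ha
        omega
      · intro h
        refine ⟨partLeaves S (S.1 ⟨a - 3, by omega⟩), List.mem_map.2 ⟨_, List.mem_finRange _, rfl⟩,
          mem_partLeaves.2 ⟨⟨a - 3, by omega⟩, rfl, ?_⟩⟩
        simp only
        omega
  · intro t ht r
    obtain ⟨j, -, rfl⟩ := List.mem_map.1 ht
    rw [← S.2 j r, partLeaves, List.countP_map, List.countP_filter, List.countP_eq_length_filter]
    have e (q : Fin N.beads.length → Prop) [DecidablePred q] :
        (Finset.univ.filter q).card = ((List.finRange N.beads.length).filter q).length := rfl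
    rw [e]
    congr 2
    ext i
    have hcol : N.leafColor (i.val + 3) = N.color i := by
      simp [leafColor]
      rfl
    simp [hcol, and_comm]

theorem Tours.count_leaves_le_one {T₁ T₂ : List (List ℕ)} (hT : N.Tours T₁ T₂) {a : ℕ} (ha : 3 ≤ a) :
    (2 :: leaves (T₁ ++ [1] :: T₂)).count a ≤ 1 := by
  rw [List.count_cons_of_ne (by omega), count_leaves_of_ne (by omega)]
  have h1 : (T₁ ++ [1] :: T₂).flatten.count a = (T₁ ++ T₂).flatten.count a := by
    have : List.count a [1] = 0 := List.count_eq_zero.2 (by simp; omega)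
    simp only [List.flatten_append, List.flatten_cons, List.count_append, this]
    omega
  rw [h1]
  exact List.nodup_iff_count_le_one.1 hT.nodup a

theorem notMem_of_count_le {V A B : List ℕ} {p : ℕ} (h : V.count p ≤ 1) (hV : V = A ++ p :: B) :
    p ∉ A ∧ p ∉ B := by
  rw [hV, List.count_append, List.count_cons_self] at h
  exact ⟨List.count_eq_zero.1 (by omega), List.count_eq_zero.1 (by omega)⟩

/-- No bead lies between `i` and `j`, so they remain neighbours when the beads of their common part
are selected in order. -/
theorem exists_adjacent_of_not_isCut (S : N.Splitting) {i j : Fin N.beads.length}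
    (hij : j.val = i + 1) (h : ¬ S.IsCut i j) :
    ∃ A B, 2 :: leaves ([1] :: partTours S) = A ++ (i.val + 3) :: (j.val + 3) :: B := by
  have hS : S.1 i = S.1 j := by
    by_contra hne
    exact h ⟨hij, hne⟩
  have hsplit : ∃ A B, List.finRange N.beads.length = A ++ i :: j :: B := by
    refine ⟨(List.finRange N.beads.length).take i, (List.finRange N.beads.length).drop (i + 2), ?_⟩
    have hi : i.val < (List.finRange N.beads.length).length := by simp
    have hj : i.val + 1 < (List.finRange N.beads.length).length := by
      rw [← hij]; simp
    conv_lhs => rw [← List.take_append_drop i.val (List.finRange N.beads.length)]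
    rw [List.drop_eq_getElem_cons hi, List.drop_eq_getElem_cons hj]
    have e1 : (List.finRange N.beads.length)[i.val] = i := by simp
    have e2 : (List.finRange N.beads.length)[i.val + 1] = j := by
      rw [List.getElem_finRange]; exact Fin.ext hij.symm
    rw [e1, e2]
  obtain ⟨A, B, hAB⟩ := hsplit
  have ht : ∃ A B, partLeaves S (S.1 i) = A ++ (i.val + 3) :: (j.val + 3) :: B := by
    refine ⟨(A.filter fun x => S.1 x = S.1 i).map fun x => x.val + 3,
      (B.filter fun x => S.1 x = S.1 i).map fun x => x.val + 3, ?_⟩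
    rw [partLeaves, hAB]
    simp [List.filter_append, hS]
  obtain ⟨A, B, ht⟩ := ht
  obtain ⟨A', B', h⟩ := exists_adjacent_of_tour (T := [1] :: partTours S)
    (List.mem_cons_of_mem _ (List.mem_map.2 ⟨_, List.mem_finRange (S.1 i), rfl⟩)) ht
  exact ⟨2 :: A', B', by rw [h]; rfl⟩

theorem leaves_partTours (S : N.Splitting) :
    2 :: leaves ([1] :: partTours S) = 2 :: 1 :: 2 :: leaves (partTours S) := by
  rw [leaves_cons]; rfl

theorem mem_leaves_partTours (S : N.Splitting) {a : ℕ} (ha : a ∈ leaves (partTours S)) :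
    a = 2 ∨ 3 ≤ a ∧ a ≤ N.beads.length + 2 := by
  obtain ⟨t, ht, hat⟩ := List.mem_flatMap.1 ha
  rcases List.mem_append.1 hat with hat | hat
  · exact Or.inr ((tours_partTours S).three_le (by simpa using ht) hat)
  · exact Or.inl (List.mem_singleton.1 hat)

/-- The leaf `b` follows the leaf `a` that is being left. After the depot it is leaf `3`; after leaf
`1` it is the depot and after the last bead leaf `1`, both used by then. After any other bead it is
the next bead, which is visited immediately unless there is a cut. The last clause, that `i` comes
before `j`, excludes a backward complaint at the same boundary. -/
theorem fwd_partTours (S : N.Splitting) {b : ℕ}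
    (hb : Fwd N.beads.length (2 :: leaves ([1] :: partTours S)) b) :
    b = 3 ∨ ∃ i j, S.IsCut i j ∧ b = j.val + 3 ∧ ∃ A B,
      2 :: leaves ([1] :: partTours S) = A ++ (i.val + 3) :: B ∧ b ∉ A := by
  have hm := N.length_beads_pos
  have hcount {a : ℕ} := Tours.count_leaves_le_one (a := a) (tours_partTours S)
  obtain ⟨A, a, c, B, hV, h1, h2⟩ := hb
  have hV' := hV
  rw [leaves_partTours] at hV'
  -- The walk visits `2`, `1`, `2` and then the parts: the leaf that is left is the initial depot,
  -- the leaf `1`, or a later one.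
  rcases A with _ | ⟨x, _ | ⟨y, A⟩⟩
  · simp only [List.nil_append, List.cons.injEq] at hV'
    obtain ⟨rfl, rfl, -⟩ := hV'
    left
    rw [← h1, nx, if_neg (by omega)]
  · simp only [List.cons_append, List.nil_append, List.cons.injEq] at hV'
    obtain ⟨rfl, rfl, -⟩ := hV'
    rw [nx, if_neg (by omega)] at h1
    exact absurd (by simp [← h1]) h2
  · simp only [List.cons_append, List.cons.injEq] at hV'
    obtain ⟨rfl, rfl, hV'⟩ := hV'
    have ha : a ∈ 2 :: leaves (partTours S) := by rw [hV']; simp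
    have ha : a = 2 ∨ 3 ≤ a ∧ a ≤ N.beads.length + 2 := by
      rcases List.mem_cons.1 ha with h | h
      · exact Or.inl h
      · exact mem_leaves_partTours S h
    rcases ha with rfl | ⟨ha, ha'⟩
    · left
      rw [← h1, nx, if_neg (by omega)]
    · have hne : a ≠ N.beads.length + 2 := by
        rintro rfl
        rw [nx, if_pos rfl] at h1
        exact absurd (by simp [← h1]) h2
      rw [nx, if_neg hne] at h1
      right
      refine ⟨⟨a - 3, by omega⟩, ⟨a - 2, by omega⟩, ?_, by simp only; omega,
        2 :: 1 :: A, c :: B, ?_, fun h => h2 (List.mem_append_left _ h)⟩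
      · by_contra hcut
        obtain ⟨A', B', hadj⟩ := exists_adjacent_of_not_isCut S (by simp only; omega) hcut
        simp only [show a - 3 + 3 = a by omega, show a - 2 + 3 = a + 1 by omega] at hadj
        -- As `a` is visited only once, both decompositions are the same and the leaf after `a` is
        -- `a + 1`.
        have h3 := notMem_of_count_le (hcount ha) hadj
        have h4 := notMem_of_count_le (hcount ha) hV
        have h5 := (append_cons_inj h4.1 h3.1 (hV.symm.trans hadj)).2
        have h6 := (List.cons.inj h5).1
        exact h2 (by simp [← h1, h6])
      · rw [hV]; simp [show a - 3 + 3 = a by omega]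

/-- The mirror image: the first arrival is at leaf `1`, preceded by `m + 2`. After that the leaves
`1` and `2` are used, so arrivals at the depot and at the bead `3` are harmless, and an arrival at
another bead hurts the bead before it only if there is a cut. -/
theorem bwd_partTours (S : N.Splitting) {b : ℕ}
    (hb : Bwd N.beads.length (2 :: leaves ([1] :: partTours S)) b) :
    b = N.beads.length + 2 ∨ ∃ i j, S.IsCut i j ∧ b = i.val + 3 ∧ ∃ A B,
      2 :: leaves ([1] :: partTours S) = A ++ (j.val + 3) :: B ∧ b ∉ A := by
  have hcount {a : ℕ} := Tours.count_leaves_le_one (a := a) (tours_partTours S)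
  obtain ⟨A, a, c, B, hV, h1, h2⟩ := hb
  have hV' := hV
  rw [leaves_partTours] at hV'
  rcases A with _ | ⟨x, A⟩
  · simp only [List.nil_append, List.cons.injEq] at hV'
    obtain ⟨rfl, rfl, -⟩ := hV'
    left
    rw [← h1]; rfl
  · simp only [List.cons_append, List.cons.injEq] at hV'
    obtain ⟨rfl, hV'⟩ := hV'
    have h1mem : 1 ∈ A ++ [a] := by
      rcases A with _ | ⟨y, A⟩
      · simp only [List.nil_append, List.cons.injEq] at hV'
        simp [hV'.1]
      · simp only [List.cons_append, List.cons.injEq] at hV'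
        simp [hV'.1]
    have h1mem' : 1 ∈ (2 :: A) ++ [a, c] := by
      simp only [List.mem_append, List.mem_singleton] at h1mem
      simp only [List.mem_append, List.mem_cons]; tauto
    have hb1 : b ≠ 1 := fun h => h2 (h ▸ h1mem')
    have hb2 : b ≠ 2 := fun h => h2 (by simp [h])
    have hc : c ∈ leaves (partTours S) ∨ c = 2 := by
      rcases A with _ | ⟨y, A⟩
      · simp only [List.nil_append, List.cons.injEq] at hV'
        exact Or.inr hV'.2.1.symm
      · simp only [List.cons_append, List.cons.injEq] at hV'
        rcases A with _ | ⟨z, A⟩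
        · simp only [List.nil_append, List.cons.injEq] at hV'
          left; rw [hV'.2.2]; simp
        · simp only [List.cons_append, List.cons.injEq] at hV'
          left; rw [hV'.2.2]; simp
    have hc' : c = 2 ∨ 3 ≤ c ∧ c ≤ N.beads.length + 2 := by
      rcases hc with hc | hc
      · exact mem_leaves_partTours S hc
      · exact Or.inl hc
    have hc4 : 4 ≤ c ∧ c ≤ N.beads.length + 2 ∧ b = c - 1 := by
      unfold pv at h1
      split_ifs at h1 <;> omega
    right
    refine ⟨⟨c - 4, by omega⟩, ⟨c - 3, by omega⟩, ?_, by simp only; omega,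
      2 :: A ++ [a], B, ?_, fun h => h2 ?_⟩
    · by_contra hcut
      obtain ⟨A', B', hadj⟩ := exists_adjacent_of_not_isCut S (by simp only; omega) hcut
      simp only [show c - 4 + 3 = b by omega, show c - 3 + 3 = c by omega] at hadj
      rw [List.append_cons] at hadj hV
      have h3 := notMem_of_count_le (hcount (by omega)) hadj
      have h4 := notMem_of_count_le (hcount (by omega)) hV
      have h5 := (append_cons_inj h4.1 h3.1 (hV.symm.trans hadj)).1
      have h6 : a = b := by simpa using (List.append_inj' h5 rfl).2
      exact h2 (by simp [← h6])
    · rw [hV]; simp [show c - 3 + 3 = c by omega]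
    · simp only [List.mem_append, List.mem_cons] at h ⊢; tauto

/-- All complaints lie at cuts or at the boundaries `1` and `3`, and no boundary carries both kinds:
at a cut, a forward complaint needs the left bead to be visited first, a backward complaint the
right one. -/
theorem exists_route_of_splitting (S : N.Splitting) :
    ∃ w : N.plan.Route, splitting w = S ∧ TreePlan.unfairness w.1 ≤ S.size + 2 := by
  have hm := N.length_beads_pos
  have hT := tours_partTours S
  obtain ⟨w, hw⟩ := hT.exists_route
  refine ⟨w, ?_, ?_⟩
  · apply Subtype.ext
    funext i
    apply Fin.ext
    have ht : ([] ++ partTours S)[(S.1 i).val]? = some (partLeaves S (S.1 i)) := by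
      simp [partTours]
    exact (hT.part_eq_iff hw i.isLt ht).2 (mem_partLeaves.2 ⟨i, rfl, rfl⟩)
  · rw [List.nil_append] at hw
    rw [hw.unfairness_eq, ← ncard_cutLeaves_union S (e := 3) (by omega) le_rfl]
    -- `nx` sends both `0` and `m + 2` to `1`, so the centre has to be excluded.
    have hinj : Set.InjOn (nx N.beads.length)
        {b | Bwd N.beads.length (2 :: leaves ([1] :: partTours S)) b} := by
      intro a ha b hb hab
      have h1 := hw.pv_le ha
      have h2 := hw.pv_le hb
      have h3 (c : ℕ) (hc : Bwd N.beads.length (2 :: leaves ([1] :: partTours S)) c) : c ≠ 0 := by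
        rcases bwd_partTours S hc with h | ⟨i, j, -, h, -⟩ <;> omega
      have h4 := h3 a ha
      have h5 := h3 b hb
      unfold nx at hab
      split_ifs at hab <;> omega
    have hdisj : Disjoint {b | Fwd N.beads.length (2 :: leaves ([1] :: partTours S)) b}
        (nx N.beads.length '' {b | Bwd N.beads.length (2 :: leaves ([1] :: partTours S)) b}) := by
      rw [Set.disjoint_left]
      rintro b hf ⟨a, ha, rfl⟩
      have hf' := fwd_partTours S hf
      rcases bwd_partTours S ha with rfl | ⟨i, j, h1, h2, A, B, h3, h4⟩
      · rw [nx, if_pos rfl] at hf'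
        rcases hf' with h | ⟨i, j, -, h, -⟩ <;> omega
      · have h5 := h1.1
        have h6 := j.isLt
        have h7 : nx N.beads.length a = j.val + 3 := by
          rw [nx, if_neg (by omega)]; omega
        rw [h7] at hf'
        rcases hf' with h | ⟨i', j', h8, h9, A', B', h10, h11⟩
        · omega
        · have h12 := h8.1
          have hi : i'.val = i.val := by omega
          rw [hi] at h10
          refine append_cons_ne (p := i.val + 3) (q := j.val + 3) (by omega) ?_ ?_
            (h10.symm.trans h3)
          · exact h11
          · rwa [h2] at h4
    rw [← hinj.ncard_image, ← Set.ncard_union_eq hdisj hw.finite_fwd (hw.finite_bwd.image _)]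
    refine Set.ncard_le_ncard ?_ (((Set.finite_Ioc _ _).subset (cutLeaves_subset S)).union
      (Set.toFinite _))
    rintro b (hb | ⟨a, ha, rfl⟩)
    · rcases fwd_partTours S hb with h | ⟨i, j, h, rfl, -⟩
      · right; simp [h]
      · exact Or.inl ⟨i, j, h, rfl⟩
    · rcases bwd_partTours S ha with rfl | ⟨i, j, h1, h2, -⟩
      · right; left; exact if_pos rfl
      · have h5 := h1.1
        have h6 := j.isLt
        left
        refine ⟨i, j, h1, ?_⟩
        rw [nx, if_neg (by omega)]; omega

end Necklace

/-! ### The program that reads a splitting off a route -/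

namespace StarWalk

/-- Remove the bead `0` and decrease the numbers of all other beads by one. -/
def shift : List (Option ℕ) → List (Option ℕ)
  | [] => []
  | none :: l => none :: shift l
  | some 0 :: l => shift l
  | some (i + 1) :: l => some i :: shift l

/-- A finite control cannot compare bead numbers; by shifting, every bead becomes the bead `0` in
its turn. -/
theorem partOf_shift (l : List (Option ℕ)) (i : ℕ) : partOf (shift l) i = partOf l (i + 1) := by
  induction l with
  | nil => rfl
  | cons a l ih =>
    match a with
    | none => simp [shift, partOf, ih]
    | some 0 => simp [shift, partOf, ih]
    | some (j + 1) => simp [shift, partOf, ih]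

/-- The representation of tokens by strings. -/
def encToken : Option ℕ → List Γ'
  | none => [Γ'.ket]
  | some i => encUnary i

end StarWalk

namespace RouteReader

open LoopProg LoopProg.Cmd Function StarWalk
open PlanWriter (one)

/-- The control states: a counter, two flags, and the symbol of the input that was read. -/
abbrev Ctl : Type := Fin 4 × Bool × Bool × Option (Γ' ⊕ Γ')

/-- The programs of this section. -/
abbrev Prog : Type := Cmd Bool Ctl (Γ' ⊕ Γ') Γ'

/-- The state with given contents of the work stacks and given output. -/
def mk (v : Ctl) (R R' X : List Γ') : St Bool Ctl Γ' := ⟨v, fun i => bif i then R else R', X.reverse⟩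

variable (w : List (Γ' ⊕ Γ')) (v : Ctl) (R R' X : List Γ')

theorem update_true (l : List Γ') :
    update (fun i => bif i then R else R') true l = fun i => bif i then l else R' := by
  funext i; cases i <;> rfl

theorem update_false (l : List Γ') :
    update (fun i => bif i then R else R') false l = fun i => bif i then R else l := by
  funext i; cases i <;> rfl

theorem den_seq (a b : Prog) (s : St Bool Ctl Γ') : (seq a b).den w s = b.den w (a.den w s) := rfl

theorem den_ite (p : Ctl → Bool) (a b : Prog) :
    (ite p a b).den w (mk v R R' X) = bif p v then a.den w (mk v R R' X) else
      b.den w (mk v R R' X) := rfl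

theorem den_push (f : Ctl → Γ') :
    (push true f : Prog).den w (mk v R R' X) = mk v (f v :: R) R' X := by
  simp [den, mk, update_true]

theorem den_load (f : Ctl → Ctl) : (load f : Prog).den w (mk v R R' X) = mk (f v) R R' X := rfl

theorem den_emit (f : Ctl → Γ') :
    (emit f : Prog).den w (mk v R R' X) = mk v R R' (X ++ [f v]) := by
  simp [den, mk]

theorem den_move : (move true false : Prog).den w (mk v R R' X) = mk v [] (R.reverse ++ R') X := by
  simp [Cmd.den_move, mk, update_true, update_false]

/-- Store a symbol of the input. -/
def rd (v : Ctl) (a : Γ' ⊕ Γ') : Ctl := (v.1, v.2.1, v.2.2.1, some a)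

/-- Do nothing. -/
def skip : Prog := load id

/-- Forget the symbol that was read. -/
def forget : Prog := load fun v => (v.1, v.2.1, v.2.2.1, none)

/-- Run the body of a loop for every symbol of a string. -/
def pass (b : Prog) (l : List (Γ' ⊕ Γ')) (s : St Bool Ctl Γ') : St Bool Ctl Γ' :=
  l.foldl (fun s a => b.den w { s with v := rd s.v a }) s

theorem pass_append (b : Prog) (l l' : List (Γ' ⊕ Γ')) (s : St Bool Ctl Γ') :
    pass w b (l ++ l') s = pass w b l' (pass w b l s) := List.foldl_append ..

theorem pass_cons (b : Prog) (a : Γ' ⊕ Γ') (l : List (Γ' ⊕ Γ')) :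
    pass w b (a :: l) (mk v R R' X) = pass w b l (b.den w (mk (rd v a) R R' X)) := rfl

theorem pass_nil (b : Prog) (s : St Bool Ctl Γ') : pass w b [] s = s := rfl

theorem pass_eq_self (b : Prog) (l : List (Γ' ⊕ Γ')) (s : St Bool Ctl Γ')
    (h : ∀ a ∈ l, b.den w { s with v := rd s.v a } = s) : pass w b l s = s := by
  induction l with
  | nil => rfl
  | cons a l ih =>
    have h1 : pass w b (a :: l) s = pass w b l (b.den w { s with v := rd s.v a }) := rfl
    rw [h1, h a (by simp), ih fun c hc => h c (List.mem_cons_of_mem _ hc)]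

/-- The reaction to the end of the name of a vertex. -/
def endVertex : Prog :=
  seq (ite (fun v => decide (v.1 = 3)) (push true fun _ => Γ'.comma) <|
    ite (fun v => decide (v.1 = 2))
      (ite (fun v => v.2.1) (load fun v => (v.1, false, v.2.2)) (push true fun _ => Γ'.ket)) <|
    ite (fun v => decide (v.1 = 1)) (load fun v => (v.1, true, v.2.2)) skip) <|
  load fun v => (0, v.2)

/-- The body of the loop that translates a route into tokens. -/
def tokenBody : Prog :=
  seq (ite (fun v => decide (v.2.2.2 = some (Sum.inr one)))
    (ite (fun v => decide (v.1 = 3)) (push true fun _ => one) (load fun v => (v.1 + 1, v.2))) <|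
    ite (fun v => decide (v.2.2.2 = some (Sum.inr Γ'.comma))) endVertex skip) forget

theorem pass_bead (i : ℕ) (b : Bool) :
    pass w tokenBody ((encUnary i).map Sum.inr) (mk (3, b, false, none) R R' X) =
      mk (0, b, false, none) ((encUnary i).reverse ++ R) R' X := by
  induction i generalizing R with
  | zero =>
    simp [encUnary, pass_cons, pass_nil, tokenBody, endVertex, skip, forget, den_seq, den_ite,
      den_push, den_load, rd]
  | succ i ih =>
    have e : encUnary (i + 1) = one :: encUnary i := rfl
    have e' : tokenBody.den w (mk (rd (3, b, false, none) (Sum.inr one)) R R' X) =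
        mk (3, b, false, none) (one :: R) R' X := by
      simp [tokenBody, endVertex, skip, forget, den_seq, den_ite, den_push, den_load, rd]
    rw [e, List.map_cons, pass_cons, e', ih]
    simp

/-- The counter distinguishes the names `0`, `1`, `2` and stops at `3`, after which ticks are
copied; thus the vertex `i + 3` becomes the bead `i`. The string `x` is the contribution of the
vertex and `b'` the flag that it leaves. -/
theorem pass_vertex (a : ℕ) (b : Bool) (l : List ℕ) : ∃ b' x,
    pass w tokenBody ((encUnary a).map Sum.inr) (mk (0, b, false, none) R R' X) =
      mk (0, b', false, none) (x.reverse ++ R) R' X ∧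
    (tokens b (a :: l)).flatMap encToken = x ++ (tokens b' l).flatMap encToken := by
  match a, b with
  | 0, b =>
    refine ⟨b, [], ?_, by cases b <;> rfl⟩
    simp [encUnary, pass_cons, pass_nil, tokenBody, endVertex, skip, forget, den_seq, den_ite,
      den_push, den_load, rd]
  | 1, b =>
    refine ⟨true, [], ?_, by cases b <;> rfl⟩
    simp [encUnary, pass_cons, pass_nil, tokenBody, endVertex, skip, forget, den_seq, den_ite,
      den_push, den_load, rd]
  | 2, true =>
    refine ⟨false, [], ?_, rfl⟩
    simp [encUnary, pass_cons, pass_nil, tokenBody, endVertex, skip, forget, den_seq, den_ite,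
      den_push, den_load, rd, List.replicate_succ]
  | 2, false =>
    refine ⟨false, [Γ'.ket], ?_, rfl⟩
    simp [encUnary, pass_cons, pass_nil, tokenBody, endVertex, skip, forget, den_seq, den_ite,
      den_push, den_load, rd, List.replicate_succ]
  | i + 3, b =>
    refine ⟨b, encUnary i, ?_, by cases b <;> rfl⟩
    have e : encUnary (i + 3) = [one, one, one] ++ encUnary i := rfl
    rw [e, List.map_append, pass_append, ← pass_bead]
    congr 1

theorem pass_vertices (l : List ℕ) (b : Bool) : ∃ b',
    pass w tokenBody ((l.flatMap encUnary).map Sum.inr) (mk (0, b, false, none) R R' X) =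
      mk (0, b', false, none) (((tokens b l).flatMap encToken).reverse ++ R) R' X := by
  induction l generalizing b R with
  | nil => exact ⟨b, by simp [pass_nil, tokens]⟩
  | cons a l ih =>
    obtain ⟨b₁, x, h1, h2⟩ := pass_vertex w R R' X a b l
    obtain ⟨b₂, h3⟩ := ih (x.reverse ++ R) b₁
    refine ⟨b₂, ?_⟩
    rw [List.flatMap_cons, List.map_append, pass_append, h1, h3, h2]
    simp

/-- Translate a route into tokens. -/
def tokenize : Prog :=
  seq (load fun _ => (0, true, false, none)) <| seq (forIn true rd tokenBody) <| move true false

/-- Symbols of the necklace and brackets are skipped; the flag `true` at the start suppresses the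
initial visit to the depot. -/
theorem den_tokenize (c : List Γ') (l : List ℕ) :
    ∃ b, tokenize.den (c.map Sum.inl ++ (encList encUnary l).map Sum.inr) (mk v [] [] X) =
      mk (0, b, false, none) [] ((tokens true l).flatMap encToken) X := by
  set w := c.map Sum.inl ++ (encList encUnary l).map Sum.inr with hw
  have h0 (a : Γ' ⊕ Γ') (ha : a ≠ Sum.inr one) (ha' : a ≠ Sum.inr Γ'.comma) (b : Bool)
      (R R' : List Γ') : tokenBody.den w (mk (rd (0, b, false, none) a) R R' X) =
      mk (0, b, false, none) R R' X := by
    simp [tokenBody, den_seq, den_ite, rd, ha, ha', skip, forget, den_load]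
  obtain ⟨b, hb⟩ := pass_vertices w [] [] X l true
  refine ⟨b, ?_⟩
  have e : pass w tokenBody w (mk (0, true, false, none) [] [] X) =
      mk (0, b, false, none) ((tokens true l).flatMap encToken).reverse [] X := by
    conv_lhs => rw [show pass w tokenBody w = pass w tokenBody (c.map Sum.inl ++
      (Sum.inr Γ'.bra :: ((l.flatMap encUnary).map Sum.inr ++ [Sum.inr Γ'.ket]))) from
      congrArg _ (by rw [hw, encList]; simp)]
    rw [pass_append, pass_eq_self w tokenBody (c.map Sum.inl), pass_cons, h0 _ (by simp) (by simp),
      pass_append, hb, pass_cons, h0 _ (by simp) (by simp), pass_nil, List.append_nil]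
    intro a ha
    obtain ⟨x, -, rfl⟩ := List.mem_map.1 ha
    exact h0 _ (by simp) (by simp) _ _ _
  have e' : (forIn true rd tokenBody : Prog).den w (mk (0, true, false, none) [] [] X) =
    pass w tokenBody w (mk (0, true, false, none) [] [] X) := rfl
  rw [tokenize, den_seq, den_load, den_seq, e', e, den_move]
  simp

/-- A pass over the tokens that removes the bead `0`, decreases the numbers of the other beads, and
writes a tick for every tour that ends before the bead `0`. The flags tell whether a token begins
and whether the bead `0` was found. -/
def shiftPass : Prog :=
  drain false true true
    (fun v a => (v.1, decide (a ≠ one), v.2.2.1 || (v.2.1 && decide (a = Γ'.comma)), v.2.2.2))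
    (fun v a => if v.2.1 && decide (a ≠ Γ'.ket) then none else some (true, a))
    (fun v a => if decide (a = Γ'.ket) && !v.2.2.1 then some one else none)

/-- Write the part of the bead `0`, and remove it. -/
def nextBead : Prog :=
  seq shiftPass <| seq (emit fun _ => Γ'.comma) <| seq (load fun v => (v.1, true, false, v.2.2.2)) <|
    move true false

/-- The step of the pass. -/
def shiftStep : St Bool Ctl Γ' → Γ' → St Bool Ctl Γ' := drainStep true true
    (fun v a => (v.1, decide (a ≠ one), v.2.2.1 || (v.2.1 && decide (a = Γ'.comma)), v.2.2.2))
    (fun v a => if v.2.1 && decide (a ≠ Γ'.ket) then none else some (true, a))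
    (fun v a => if decide (a = Γ'.ket) && !v.2.2.1 then some one else none)

theorem foldl_shiftStep_encUnary (i : ℕ) (n : Fin 4) (b : Bool) (y : Option (Γ' ⊕ Γ')) :
    (encUnary i).foldl shiftStep (mk (n, false, b, y) R R' X) =
      mk (n, true, b, y) ((encUnary i).reverse ++ R) R' X := by
  induction i generalizing R with
  | zero => simp [encUnary, shiftStep, drainStep, mk, update_true]
  | succ i ih =>
    have e : encUnary (i + 1) = one :: encUnary i := rfl
    have e' : shiftStep (mk (n, false, b, y) R R' X) one = mk (n, false, b, y) (one :: R) R' X := by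
      simp [shiftStep, drainStep, mk, update_true]
    rw [e, List.foldl_cons, e', ih]
    simp

/-- The flag `b` tells that bead `0` has been found, after which the ends of tours are no longer
counted. At the beginning of a token a comma is bead `0` and a tick is the decrement, so both are
dropped. -/
theorem foldl_shiftStep (l : List (Option ℕ)) (n : Fin 4) (b : Bool) (y : Option (Γ' ⊕ Γ')) :
    ∃ b', (l.flatMap encToken).foldl shiftStep (mk (n, true, b, y) R R' X) =
      mk (n, true, b', y) (((shift l).flatMap encToken).reverse ++ R) R'
        (X ++ List.replicate (if b then 0 else partOf l 0) one) := by
  induction l generalizing b R X with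
  | nil => exact ⟨b, by simp [shift, partOf]⟩
  | cons a l ih =>
    rw [List.flatMap_cons, List.foldl_append]
    match a with
    | none =>
      have e : [Γ'.ket].foldl shiftStep (mk (n, true, b, y) R R' X) =
          mk (n, true, b, y) (Γ'.ket :: R) R' (X ++ List.replicate (if b then 0 else 1) one) := by
        cases b <;> simp [shiftStep, drainStep, mk, update_true]
      obtain ⟨b', h⟩ := ih (Γ'.ket :: R) (X ++ List.replicate (if b then 0 else 1) one) b
      refine ⟨b', ?_⟩
      rw [encToken, e, h, shift, partOf]
      cases b <;> simp [encToken, List.replicate_succ]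
    | some 0 =>
      have e : (encUnary 0).foldl shiftStep (mk (n, true, b, y) R R' X) =
          mk (n, true, true, y) R R' X := by
        simp [encUnary, shiftStep, drainStep, mk]
      obtain ⟨b', h⟩ := ih R X true
      refine ⟨b', ?_⟩
      rw [encToken, e, h, shift, partOf]
      cases b <;> simp
    | some (i + 1) =>
      have e : encUnary (i + 1) = one :: encUnary i := rfl
      have e' : shiftStep (mk (n, true, b, y) R R' X) one = mk (n, false, b, y) R R' X := by
        simp [shiftStep, drainStep, mk]
      obtain ⟨b', h⟩ := ih ((encUnary i).reverse ++ R) X b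
      refine ⟨b', ?_⟩
      rw [encToken, e, List.foldl_cons, e', foldl_shiftStep_encUnary, h, shift, partOf]
      simp [encToken]

theorem den_nextBead (l : List (Option ℕ)) (n : Fin 4) (y : Option (Γ' ⊕ Γ')) :
    nextBead.den w (mk (n, true, false, y) [] (l.flatMap encToken) X) =
      mk (n, true, false, y) [] ((shift l).flatMap encToken) (X ++ encUnary (partOf l 0)) := by
  obtain ⟨b', h⟩ := foldl_shiftStep [] [] X l n false y
  have e : shiftPass.den w (mk (n, true, false, y) [] (l.flatMap encToken) X) =
      (l.flatMap encToken).foldl shiftStep (mk (n, true, false, y) [] [] X) := by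
    simp only [shiftPass, den, mk, update_false]
    rfl
  rw [nextBead, den_seq, e, h, den_seq, den_emit, den_seq, den_load, den_move]
  simp [encUnary]

/-- The body of the loop over the beads. -/
def partBody : Prog :=
  seq (ite (fun v => decide (v.2.2.2 = some (Sum.inl Γ'.bra)))
    (load fun v => (v.1, true, v.2.2)) <|
    ite (fun v => v.2.1 && decide (v.2.2.2 = some (Sum.inl Γ'.comma))) nextBead skip) forget

/-- The colour is irrelevant here: the list of beads only controls the loop, each closing comma
starting one round. -/
theorem pass_bead_code (c : ℕ) (l : List (Option ℕ)) :
    pass w partBody ((encUnary c).map Sum.inl) (mk (0, true, false, none) [] (l.flatMap encToken) X) =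
      mk (0, true, false, none) [] ((shift l).flatMap encToken) (X ++ encUnary (partOf l 0)) := by
  rw [encUnary, List.map_append, pass_append,
    pass_eq_self w partBody ((List.replicate c one).map Sum.inl)]
  · simp [pass_cons, pass_nil, partBody, den_seq, den_ite, den_nextBead, rd, forget, den_load]
  · intro a ha
    obtain ⟨x, hx, rfl⟩ := List.mem_map.1 ha
    rw [List.eq_of_mem_replicate hx]
    change partBody.den w (mk (rd (0, true, false, none) _) [] _ X) = _
    simp [partBody, den_seq, den_ite, rd, forget, skip, den_load]

theorem pass_beads (cs : List ℕ) (l : List (Option ℕ)) :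
    ∃ l', pass w partBody ((cs.flatMap encUnary).map Sum.inl)
        (mk (0, true, false, none) [] (l.flatMap encToken) X) =
      mk (0, true, false, none) [] l'
        (X ++ (List.range cs.length).flatMap fun i => encUnary (partOf l i)) := by
  induction cs generalizing l X with
  | nil => exact ⟨_, by simp [pass_nil]; rfl⟩
  | cons c cs ih =>
    obtain ⟨l', h⟩ := ih (X ++ encUnary (partOf l 0)) (shift l)
    refine ⟨l', ?_⟩
    rw [List.flatMap_cons, List.map_append, pass_append, pass_bead_code, h]
    simp [List.range_succ_eq_map, List.flatMap_map, partOf_shift]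

/-- Write the parts of all beads. -/
def writeParts : Prog :=
  seq (load fun _ => (0, false, false, none)) <| seq (emit fun _ => Γ'.bra) <|
    seq (forIn true rd partBody) <| emit fun _ => Γ'.ket

/-- The program that computes the splitting obtained from a route. -/
def program : Prog := seq tokenize writeParts

theorem out_program (N : Necklace) (l : List ℕ) :
    (program.den (N.code.map Sum.inl ++ (encList encUnary l).map Sum.inr)
      ⟨(0, false, false, none), fun _ => [], []⟩).out =
    (encList encUnary ((List.range N.beads.length).map (partOf (tokens true l)))).reverse := by
  set w := N.code.map Sum.inl ++ (encList encUnary l).map Sum.inr with hw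
  have e : (⟨(0, false, false, none), fun _ => [], []⟩ : St Bool Ctl Γ') =
      mk (0, false, false, none) [] [] [] := by
    unfold mk
    congr 1
    funext k; cases k <;> rfl
  obtain ⟨b, hb⟩ := den_tokenize (0, false, false, none) [] N.code l
  rw [← hw] at hb
  obtain ⟨R', hR'⟩ := pass_beads w [Γ'.bra] N.beads (tokens true l)
  -- Before the bracket the flag is `false`, so the comma behind `k` is not taken for a bead.
  have h0 (a : Γ' ⊕ Γ') (ha : a ≠ Sum.inl Γ'.bra) (b : Bool) (hb : b = false ∨ a ≠ Sum.inl Γ'.comma)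
      (R R' X : List Γ') : partBody.den w (mk (rd (0, b, false, none) a) R R' X) =
      mk (0, b, false, none) R R' X := by
    have : (b && decide (a = Sum.inl Γ'.comma)) = false := by
      rcases hb with rfl | hb <;> simp_all
    simp [partBody, den_seq, den_ite, rd, ha, this, skip, forget, den_load]
  have h1 (R R' X : List Γ') :
      partBody.den w (mk (rd (0, false, false, none) (Sum.inl Γ'.bra)) R R' X) =
      mk (0, true, false, none) R R' X := by
    simp [partBody, den_seq, den_ite, rd, forget, den_load]
  have e' (s : St Bool Ctl Γ') :
    (forIn true rd partBody : Prog).den w s = pass w partBody w s := rfl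
  have e'' : pass w partBody w = pass w partBody ((encUnary N.k).map Sum.inl ++
      (Sum.inl Γ'.bra :: ((N.beads.flatMap encUnary).map Sum.inl ++
        (Sum.inl Γ'.ket :: (encList encUnary l).map Sum.inr)))) :=
    congrArg _ (by rw [hw, Necklace.code]; simp [encList])
  rw [e, program, den_seq, hb, writeParts, den_seq, den_load, den_seq, den_emit, den_seq, e', e'',
    pass_append, pass_eq_self w partBody ((encUnary N.k).map Sum.inl), pass_cons, h1, pass_append,
    List.nil_append, hR', pass_cons, h0 _ (by simp) _ (Or.inr (by simp)), pass_eq_self, den_emit]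
  · simp [mk, encList, List.flatMap_map]
  · intro a ha
    obtain ⟨x, -, rfl⟩ := List.mem_map.1 ha
    exact h0 _ (by simp) _ (Or.inr (by simp)) _ _ _
  · intro a ha
    obtain ⟨x, hx, rfl⟩ := List.mem_map.1 ha
    refine h0 _ ?_ _ (Or.inl rfl) _ _ _
    rintro ⟨⟩
    simp [encUnary] at hx

theorem wf_program : program.WF := by
  simp [program, tokenize, writeParts, WF, tokenBody, endVertex, skip, forget, partBody, nextBead,
    shiftPass, Cmd.move, uses]

/-- The splitting obtained from a route is computable in polynomial time. -/
theorem polyTime_splitting : Nonempty (Turing.TM2ComputableInPolyTime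
    (fun p : (Σ N : Necklace, N.plan.Route) =>
      (necklaceSplitting.encInst p.1).map (Sum.inl : Γ' → Γ' ⊕ Γ') ++
        (unfairnessMinimisation.encSol p.1.plan p.2).map Sum.inr)
    (fun q : (Σ N : Necklace, N.Splitting) => necklaceSplitting.encSol q.1 q.2)
    (fun p => ⟨p.1, Necklace.splitting p.2⟩)) := by
  refine LoopProg.polyTime _ _ _ program wf_program (0, false, false, none) ?_
  rintro ⟨N, r⟩
  have h1 : unfairnessMinimisation.encSol N.plan r = encList encUnary (r.1.support.map Fin.val) := by
    change encList (fun v => encUnary v.val) r.1.support = _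
    unfold encList
    rw [List.flatMap_map]
  have h2 : necklaceSplitting.encSol N (Necklace.splitting r) =
      encList encUnary ((List.range N.beads.length).map
        (partOf (tokens true (r.1.support.map Fin.val)))) := by
    change encList (fun j => encUnary j.val) (List.ofFn (Necklace.splitting r).1) = _
    unfold encList
    rw [List.flatMap_map, List.ofFn_eq_map, List.flatMap_map, ← List.map_coe_finRange_eq_range,
      List.flatMap_map]
    rfl
  dsimp only
  rw [h1, h2]
  exact out_program N _

end RouteReader

/-! ### The reduction and its properties -/

namespace Necklace

open StarWalk

variable (N : Necklace)

/-- The leaf of a bead. -/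
def leaf (i : Fin N.beads.length) : Fin N.plan.n :=
  (⟨i.val + 3, Nat.add_lt_add_right i.isLt 3⟩ : Fin (N.beads.length + 3))

theorem isNecklaceStar : N.plan.IsNecklaceStar N N.centre N.leaf where
  star := rfl
  depot_ne := depot_ne_zero
  u_inj i j h := by
    have : i.val + 3 = j.val + 3 := congrArg Fin.val h
    exact Fin.ext (by omega)
  u_ne i := by
    constructor
    · intro h
      have : i.val + 3 = 0 := congrArg Fin.val h
      omega
    · intro h
      have : i.val + 3 = N.plan.depot.val := congrArg Fin.val h
      rw [depot_val] at this
      omega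
  weights := by
    refine ⟨N.edgeLen, fun i => ?_, N.sum_edgeLen_lt⟩
    change N.weight 0 + N.edgeLen (N.beads.getD i.val 0) = N.edgeLen (N.color i)
    have h0 : N.weight 0 = 0 := rfl
    have h1 : N.beads.getD i.val 0 = N.color i := by simp; rfl
    rw [h0, h1, zero_add]
  limit_eq q i hq _ := by
    have hq : q < 1 := hq
    obtain rfl : q = 0 := by omega
    change (([[1]] : List (List ℚ)).getD 0 []).getD _ _ = 1
    generalize i - 1 = i
    cases i <;> rfl

variable {N}

theorem exists_eq_spoke_iff (P : ℕ → Prop) (i : Fin N.beads.length) :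
    (∃ y : Fin N.plan.n, s(N.centre, N.leaf i) = s(N.centre, y) ∧ P y.val) ↔ P (i.val + 3) := by
  constructor
  · rintro ⟨y, h, hy⟩
    rw [← Sym2.congr_right.1 h] at hy
    exact hy
  · intro h
    exact ⟨_, rfl, h⟩

theorem complaint_iff {w : N.plan.ClosedWalk} {l : List ℕ} (hl : Visits w l)
    (i j : Fin N.beads.length) :
    (TreePlan.ForwardComplaint w s(N.centre, N.leaf j) ∨
      TreePlan.BackwardComplaint w s(N.centre, N.leaf i)) ↔
    (Fwd N.beads.length (2 :: l) (j + 3) ∨ Bwd N.beads.length (2 :: l) (i + 3)) := by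
  rw [hl.forwardComplaint_iff, hl.backwardComplaint_iff, exists_eq_spoke_iff, exists_eq_spoke_iff]

theorem exists_route_unfairness_eq (S : N.Splitting) :
    ∃ w : N.plan.Route, TreePlan.unfairness w.1 = S.size + 2 := by
  obtain ⟨w, rfl, h⟩ := exists_route_of_splitting S
  exact ⟨w, le_antisymm h (size_add_two_le w)⟩

/-- The polynomial reduction of necklace splitting to unfairness minimisation. -/
noncomputable def reduction : PolyReduction necklaceSplitting unfairnessMinimisation where
  f := plan
  g _ := splitting
  f_poly := PlanWriter.polyTime_plan
  g_poly := RouteReader.polyTime_splitting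
  solvable _ := fun ⟨S⟩ => ⟨(exists_route_of_splitting S).choose⟩
  optimal N w hw S := by
    -- An optimal route is no worse than the route matching `S`, and both sides carry the same
    -- constant `2`.
    obtain ⟨w', h⟩ := exists_route_unfairness_eq S
    have h1 := size_add_two_le w
    have h2 : TreePlan.unfairness w.1 ≤ TreePlan.unfairness w'.1 := hw w'
    change (splitting w).size ≤ S.size
    omega

end Necklace

theorem theorem4 :
    ∃ R : PolyReduction necklaceSplitting unfairnessMinimisation, ∀ N : Necklace,
      let I : TreePlan := R.f N
      let g : I.Route → N.Splitting := R.g N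
      -- the plan is a star with super-increasing lengths
      ∃ (x : Fin I.n) (u : Fin N.beads.length → Fin I.n), I.IsNecklaceStar N x u ∧
        -- the capacity
        I.c = 1 / (N.k + 1) ∧
        -- complaints along a route pay for the cuts of the splitting obtained from it
        (∀ w : I.Route, (g w).size + 2 ≤ TreePlan.unfairness w.1 ∧
          ∀ i j, (g w).IsCut i j →
            TreePlan.ForwardComplaint w.1 s(x, u j) ∨
              TreePlan.BackwardComplaint w.1 s(x, u i)) ∧
        -- every splitting is matched by a route
        (∀ S : N.Splitting, ∃ w : I.Route, TreePlan.unfairness w.1 = S.size + 2) ∧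
        -- for a route of minimal unfairness, complaints and cuts are the same
        (∀ w : I.Route, (∀ w' : I.Route, TreePlan.unfairness w.1 ≤ TreePlan.unfairness w'.1) →
          (g w).size + 2 = TreePlan.unfairness w.1 ∧
          ∀ i j : Fin N.beads.length, (j : ℕ) = i + 1 →
            ((g w).IsCut i j ↔
              TreePlan.ForwardComplaint w.1 s(x, u j) ∨
                TreePlan.BackwardComplaint w.1 s(x, u i))) := by
  refine ⟨Necklace.reduction, fun N => ?_⟩
  intro I g
  refine ⟨N.centre, N.leaf, N.isNecklaceStar, rfl, fun w => ⟨Necklace.size_add_two_le w, ?_⟩,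
    Necklace.exists_route_unfairness_eq, fun w hw => ?_⟩
  · intro i j h
    obtain ⟨l, hl⟩ := Necklace.exists_visits w.1
    exact (Necklace.complaint_iff hl i j).2 (Necklace.complaint_of_isCut w hl h)
  -- The minimal route is compared with the route that matches its own splitting.
  · obtain ⟨w', h⟩ := Necklace.exists_route_unfairness_eq (Necklace.splitting w)
    have h1 : TreePlan.unfairness w.1 ≤ (Necklace.splitting w).size + 2 := h ▸ hw w'
    refine ⟨le_antisymm (Necklace.size_add_two_le w) h1, fun i j hij => ?_⟩
    obtain ⟨l, hl⟩ := Necklace.exists_visits w.1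
    refine Iff.trans ?_ (Necklace.complaint_iff hl i j).symm
    exact ⟨Necklace.complaint_of_isCut w hl, Necklace.isCut_of_complaint w h1 hl hij⟩
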